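/- For $n\ge 0$ let $\#_n(S^2\times S^1)$ denote the $n$-fold connected sum of copies of $S^2\times S^1$, where $\#_0(S^2\times S^1)=S^3$ is the empty connected sum and $\#_{n+1}(S^2\times S^1)=\bigl(\#_n(S^2\times S^1)\bigr)\#(S^2\times S^1)$. For every integer $n\ge 0$ there exist a closed connected surface $B$, an oriented (i.e. principal) circle bundle $p\colon E\to B$ which is non-trivial, meaning that there is no homeomorphism $E\to B\times S^1$ over $B$, and a continuous map $f\colon E\to\#_n(S^2\times S^1)$ such that 1. $f$ is a branched double covering: every point of the target has an open neighbourhood over which $f$ is either a trivial two-sheeted covering or, in suitable local coordinates on source and target, the map $\mathbb{C}\times\mathbb{R}\to\mathbb{C}\times\mathbb{R}$, $(z,t)\mapsto(z^2,t)$; 2. $f$ is $\pi_1$-surjective: for every $x\in E$ the homomorphism $f_*\colon\pi_1(E,x)\to\pi_1(\#_n(S^2\times S^1),f(x))$ is surjective. (The manifold $E$ and the surface $B$ are then automatically orientable.) -/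

import Mathlib

open Topology

noncomputable section

namespace BranchedCircleBundles

/-! ### The spheres -/

/-- The unit sphere `S²` in `ℂ × ℝ = ℝ³`. -/
abbrev S2 : Type := {p : ℂ × ℝ // ‖p.1‖ ^ 2 + p.2 ^ 2 = 1}

/-- The unit sphere `S³` in `ℂ × ℂ = ℝ⁴`. -/
abbrev S3 : Type := {p : ℂ × ℂ // ‖p.1‖ ^ 2 + ‖p.2‖ ^ 2 = 1}

/-! ### Connected sums of three-manifolds

The model three-ball is the closed unit ball of `ℂ × ℝ` in the norm `max ‖z‖ |t|` of the product,
that is, the cylinder `D² × [-1, 1]`; its boundary is the unit sphere of that norm.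
A (locally flat) three-ball in a three-manifold `X` is given by an open embedding `ℂ × ℝ → X`,
restricted to the unit ball. -/

section ConnectedSum

variable {X Y : Type}

/-- `X` with the open ball `i (interior of D² × [-1, 1])` removed. -/
abbrev Punctured (i : ℂ × ℝ → X) : Type := {x : X // x ∉ i '' Metric.ball (0 : ℂ × ℝ) 1}

/-- The gluing of the boundary spheres of two punctured spaces: `i b` is identified with `j b` for
each point `b` of the boundary of the model ball. -/
inductive GlueRel (i : ℂ × ℝ → X) (j : ℂ × ℝ → Y) :
    Punctured i ⊕ Punctured j → Punctured i ⊕ Punctured j → Prop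
  | glue (b : ℂ × ℝ) (hb : b ∈ Metric.sphere (0 : ℂ × ℝ) 1)
      (hi : i b ∉ i '' Metric.ball (0 : ℂ × ℝ) 1) (hj : j b ∉ j '' Metric.ball (0 : ℂ × ℝ) 1) :
      GlueRel i j (Sum.inl ⟨i b, hi⟩) (Sum.inr ⟨j b, hj⟩)

/-- The connected sum of `X` and `Y` along the balls given by `i` and `j`, with the quotient
topology. -/
abbrev ConnSum (i : ℂ × ℝ → X) (j : ℂ × ℝ → Y) : Type := Quot (GlueRel i j)

end ConnectedSum

/-- The central projection `(z, 1) / ‖(z, 1)‖` of the plane to the open upper hemisphere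
of `S²`. -/
def hemisphere (z : ℂ) : S2 :=
  ⟨(z / (Real.sqrt (1 + ‖z‖ ^ 2) : ℂ), 1 / Real.sqrt (1 + ‖z‖ ^ 2)), by
    have h : 0 < 1 + ‖z‖ ^ 2 := by positivity
    have h' : Real.sqrt (1 + ‖z‖ ^ 2) ^ 2 = 1 + ‖z‖ ^ 2 := Real.sq_sqrt h.le
    simp only [norm_div, Complex.norm_real, Real.norm_eq_abs, div_pow, sq_abs, h', one_pow]
    field_simp
    ring⟩

/-- A ball in `S³`: the map `(z, t) ↦ (z, e^{i arctan t}) / ‖(z, e^{i arctan t})‖`. -/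
def discS3 (p : ℂ × ℝ) : S3 :=
  ⟨(p.1 / (Real.sqrt (1 + ‖p.1‖ ^ 2) : ℂ),
      (Circle.exp (Real.arctan p.2) : ℂ) / (Real.sqrt (1 + ‖p.1‖ ^ 2) : ℂ)), by
    have h : 0 < 1 + ‖p.1‖ ^ 2 := by positivity
    have h' : Real.sqrt (1 + ‖p.1‖ ^ 2) ^ 2 = 1 + ‖p.1‖ ^ 2 := Real.sq_sqrt h.le
    simp only [norm_div, Complex.norm_real, Real.norm_eq_abs, div_pow, sq_abs, h',
      Circle.norm_coe, one_pow]
    field_simp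
    ring⟩

/-- The ball in `S² × S¹` along which the next connected sum attaches this copy to the preceding
ones: the upper hemisphere times the right half circle. -/
def discIn (p : ℂ × ℝ) : S2 × Circle :=
  (hemisphere p.1, Circle.exp (Real.arctan p.2))

/-- A second ball in `S² × S¹`, disjoint from the first one and of the opposite orientation: the
upper hemisphere times the left half circle. -/
def discOut (p : ℂ × ℝ) : S2 × Circle :=
  (hemisphere p.1, Circle.exp (Real.pi - Real.arctan p.2))

theorem discOut_notMem (p : ℂ × ℝ) : discOut p ∉ discIn '' Metric.ball (0 : ℂ × ℝ) 1 := by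
  rintro ⟨q, -, hq⟩
  have h : (Circle.exp (Real.arctan q.2) : ℂ).re = (Circle.exp (Real.pi - Real.arctan p.2) : ℂ).re :=
    congrArg (fun u : S2 × Circle => (u.2 : ℂ).re) hq
  rw [Circle.coe_exp, Circle.coe_exp, Complex.exp_ofReal_mul_I_re, Complex.exp_ofReal_mul_I_re,
    Real.cos_pi_sub] at h
  have h1 := Real.cos_arctan_pos q.2
  have h2 := Real.cos_arctan_pos p.2
  linarith

/-- A space together with a ball in it. -/
structure SpaceWithDisc where
  carrier : Type
  [top : TopologicalSpace carrier]
  disc : ℂ × ℝ → carrier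

attribute [instance] SpaceWithDisc.top

/-- The iterated connected sum, starting with the empty connected sum `S³`. In each step one copy of
`S² × S¹` is added, and the ball for the next step is taken in this new copy. All gluing maps
are compatible with orientations, since `discIn` and `discOut` have opposite orientations. -/
def iterSum : ℕ → SpaceWithDisc
  | 0 => ⟨S3, discS3⟩
  | n + 1 => ⟨ConnSum (iterSum n).disc discIn,
      fun p => Quot.mk _ (Sum.inr ⟨discOut p, discOut_notMem p⟩)⟩

/-- The connected sum `#ₙ (S² × S¹)`: `S³` for `n = 0`, and `(#ₙ (S² × S¹)) # (S² × S¹)`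
for `n + 1`. -/
abbrev SharpS2S1 (n : ℕ) : Type := (iterSum n).carrier

/-! ### Surfaces, circle bundles, branched double coverings -/

/-- A closed surface: a compact connected Hausdorff two-manifold. -/
structure IsClosedSurface (B : Type) [TopologicalSpace B] : Prop where
  t2 : T2Space B
  compact : CompactSpace B
  connected : ConnectedSpace B
  charted : Nonempty (ChartedSpace (EuclideanSpace ℝ (Fin 2)) B)

/-- `p : E → B` is an (oriented, i.e. principal) circle bundle: the circle acts continuously on `E`,
preserving the fibres of `p`, and `p` is locally equivariantly isomorphic to the product
`U × S¹`, on which the circle acts by multiplication in the second factor.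
Since the bundle is principal, the base of a circle bundle with orientable total space is
orientable. The total space of a branched covering of the orientable manifold `#ₙ (S² × S¹)` is
orientable, so for such a total space the base is an orientable surface. -/
structure IsCircleBundle {E B : Type} [TopologicalSpace E] [TopologicalSpace B]
    [MulAction Circle E] (p : E → B) : Prop where
  continuous_smul : Continuous fun q : Circle × E => q.1 • q.2
  map_smul : ∀ (g : Circle) (x : E), p (g • x) = p x
  locally_trivial : ∀ b : B, ∃ e : Bundle.Trivialization Circle p, b ∈ e.baseSet ∧
    ∀ (g : Circle) (x : E), x ∈ e.source → (e (g • x)).2 = g * (e x).2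

/-- `f : E → X` is a branched double covering of three-manifolds: over a neighbourhood of each point
`x` of `X`, it is either a trivial two-sheeted covering or, in suitable coordinates, the map
`(z, t) ↦ (z ^ 2, t)` from `ℂ × ℝ` to `ℂ × ℝ`, which is branched along the line `z = 0`. -/
structure IsBranchedDoubleCovering {E X : Type} [TopologicalSpace E] [TopologicalSpace X]
    (f : E → X) : Prop where
  continuous : Continuous f
  local_model : ∀ x : X, IsEvenlyCovered f x (Fin 2) ∨
    ∃ (φ : ℂ × ℝ → E) (ψ : ℂ × ℝ → X), IsOpenEmbedding φ ∧ IsOpenEmbedding ψ ∧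
      x ∈ Set.range ψ ∧ Set.range φ = f ⁻¹' Set.range ψ ∧
      ∀ q : ℂ × ℝ, f (φ q) = ψ (q.1 ^ 2, q.2)

/-- The continuous map `f` is surjective on fundamental groups, at every base point. -/
def IsPiOneSurjective {E X : Type} [TopologicalSpace E] [TopologicalSpace X] (f : C(E, X)) : Prop :=
  ∀ x : E, Function.Surjective (FundamentalGroup.map f x)

end BranchedCircleBundles

end

/-! Let `D` be a planar disc with `n` holes and glue the boundary fibres of `D × S¹` to themselves
by the reflections `w ∼ w'` for `w * w' = twist p`, where `twist : ∂D → S¹`. An arc in `D` with end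
points on the boundary then gives a two-sphere (an annulus with both boundary circles folded), so
that cutting `D` along arcs corresponds to cutting the quotient along spheres. A disc gives `S³`
(two balls), an annulus with trivial twist gives `S² × S¹`, and joining annuli to a disc along arcs
gives connected sums. Hence the quotient is `#ₙ (S² × S¹)`. A twist along an arc of the outer
boundary does not change this, since it can be absorbed by rotating the slices of a ball.

The same quotient arises from a circle bundle. Over the double of `D`, whose points are pairs `(p,
s)` with `|s| = rho p`, take the pairs `(u, v)` of complex numbers with `u * v = twist p` and `|u|²
- |v|² = s`. The circle acts by `(g u, g⁻¹ v)`. Exchanging `u` and `v` covers the reflection of the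
double, and the quotient is `D × S¹` with folded boundary fibres. The fixed points are the points `u
= v` over `∂D`; there `s` and the angle of `u` relative to a square root of `twist` change sign,
which gives the model `(z, t) ↦ (z², t)` (`exists_oddChart`,
`IsInvolutionQuotient.isBranchedDoubleCovering`).

Non-triviality: a global section would extend `twist` from `∂D` to a map `D → S¹`
(`exists_extension_of_trivial`). The chosen `twist` winds once around the outer boundary and is `1`
on the boundaries of the holes, so no extension exists (`not_exists_extension`).

Surjectivity on `π₁`: paths lift up to homotopy even through the branch locus, and a loop based at a
branch point lifts to a loop because that point has only one preimage.

The identification of the quotient is the induction `exists_isTippedFolding`: the right tip of the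
`n`-th hexagon carries the ball for the next sum, and it is replaced by a piece with one hole which
folds to `S² × S¹` minus a ball (`isTippedFolding_zero`, `IsTippedFolding.succ`). -/

noncomputable section

namespace BranchedCircleBundles


/-! ### Surjectivity on fundamental groups -/

section PiOne

open unitInterval

variable {E X : Type} [TopologicalSpace E] [TopologicalSpace X]

/-- The path `γ` is, relative to its end points, homotopic to the image under `f` of some path that
starts at `e`. -/
def LiftsUpToHomotopy (f : C(E, X)) {a b : X} (γ : Path a b) (e : E) : Prop :=
  ∃ (ha : a = f e) (e' : E) (hb : b = f e') (Γ : Path e e'),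
    ((Γ.map f.continuous).cast ha hb).Homotopic γ

theorem LiftsUpToHomotopy.of_homotopic {f : C(E, X)} {a b : X} {γ γ' : Path a b} {e : E}
    (h : LiftsUpToHomotopy f γ e) (hγ : γ.Homotopic γ') : LiftsUpToHomotopy f γ' e := by
  obtain ⟨ha, e', hb, Γ, hΓ⟩ := h
  exact ⟨ha, e', hb, Γ, hΓ.trans hγ⟩

/-- The end point of the first lift is not prescribed, so the second path has to lift from every
point over `b`. -/
theorem LiftsUpToHomotopy.trans {f : C(E, X)} {a b c : X} {γ : Path a b} {γ' : Path b c} {e : E}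
    (h : LiftsUpToHomotopy f γ e) (h' : ∀ e', f e' = b → LiftsUpToHomotopy f γ' e') :
    LiftsUpToHomotopy f (γ.trans γ') e := by
  obtain ⟨rfl, e', rfl, Γ, hΓ⟩ := h
  obtain ⟨ha, e'', rfl, Γ', hΓ'⟩ := h' e' rfl
  refine ⟨rfl, e'', rfl, Γ.trans Γ', ?_⟩
  have := hΓ.hcomp hΓ'
  simpa [Path.map_trans] using this

/-- Paths in `U` lift up to homotopy. -/
def LiftsPathsIn (f : C(E, X)) (U : Set X) : Prop :=
  ∀ (a b : X) (γ : Path a b), (∀ t, γ t ∈ U) → ∀ e, f e = a → LiftsUpToHomotopy f γ e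

theorem IsEvenlyCovered.exists_liftsPathsIn {f : C(E, X)} {x : X}
    (h : IsEvenlyCovered f x (Fin 2)) : ∃ U, IsOpen U ∧ x ∈ U ∧ LiftsPathsIn f U := by
  obtain ⟨-, U, hxU, hU, -, H, hH⟩ := h
  refine ⟨U, hU, hxU, ?_⟩
  rintro a b γ hγ e rfl
  have he : f e ∈ U := by simpa using hγ 0
  -- An honest lift: it stays in the sheet that contains `e`.
  let Γ : I → E := fun t => (H.symm (⟨γ t, hγ t⟩, (H ⟨e, he⟩).2)).1
  have hΓ : Continuous Γ := by fun_prop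
  have hf : ∀ t, f (Γ t) = γ t := fun t => by
    have := hH (H.symm (⟨γ t, hγ t⟩, (H ⟨e, he⟩).2))
    rw [Homeomorph.apply_symm_apply] at this
    exact this.symm
  have h0 : Γ 0 = e := by
    have : ((⟨γ 0, hγ 0⟩, (H ⟨e, he⟩).2) : U × Fin 2) = H ⟨e, he⟩ := by
      refine Prod.ext (Subtype.ext ?_) rfl
      rw [hH]; simp
    simp only [Γ]
    rw [this, Homeomorph.symm_apply_apply]
  refine ⟨rfl, Γ 1, by rw [hf]; simp, ⟨⟨Γ, hΓ⟩, h0, rfl⟩, ?_⟩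
  convert Path.Homotopic.refl γ
  ext t
  exact hf t

/-- The path itself need not be lifted. The model is simply connected, so any path upstairs from the
given point to a preimage of the end point has an image homotopic to the given path. -/
theorem exists_liftsPathsIn_of_squareModel {f : C(E, X)} {x : X} {φ : ℂ × ℝ → E} {ψ : ℂ × ℝ → X}
    (hφ : IsOpenEmbedding φ) (hψ : IsOpenEmbedding ψ) (hx : x ∈ Set.range ψ)
    (hr : Set.range φ = f ⁻¹' Set.range ψ) (hf : ∀ q : ℂ × ℝ, f (φ q) = ψ (q.1 ^ 2, q.2)) :
    ∃ U, IsOpen U ∧ x ∈ U ∧ LiftsPathsIn f U := by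
  refine ⟨Set.range ψ, hψ.isOpen_range, hx, ?_⟩
  rintro a b γ hγ e rfl
  obtain ⟨q₀, rfl⟩ : e ∈ Set.range φ := by rw [hr]; simpa using hγ 0
  let h := hψ.toIsEmbedding.toHomeomorph
  have hh : ∀ y, ψ (h.symm y) = y := fun y => congrArg Subtype.val (h.apply_symm_apply y)
  let δ : I → ℂ × ℝ := fun t => h.symm ⟨γ t, hγ t⟩
  have hδ : ∀ t, ψ (δ t) = γ t := fun t => hh _
  have hδ0 : δ 0 = (q₀.1 ^ 2, q₀.2) := hψ.injective (by rw [hδ, ← hf]; simp)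
  obtain ⟨z, hz⟩ : ∃ z : ℂ, (δ 1).1 = z ^ 2 := by
    obtain ⟨z, hz⟩ := IsAlgClosed.exists_pow_nat_eq (δ 1).1 two_pos
    exact ⟨z, hz.symm⟩
  have hδ1 : δ 1 = (z ^ 2, (δ 1).2) := Prod.ext hz rfl
  let q₁ : ℂ × ℝ := (z, (δ 1).2)
  let L : Path q₀ q₁ := PathConnectedSpace.somePath q₀ q₁
  have hsq : Continuous fun q : ℂ × ℝ => ((q.1 ^ 2, q.2) : ℂ × ℝ) := by fun_prop
  let δ' : Path ((q₀.1 ^ 2, q₀.2) : ℂ × ℝ) (z ^ 2, (δ 1).2) :=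
    ⟨⟨δ, by fun_prop⟩, hδ0, hδ1⟩
  have hb : b = f (φ q₁) := by rw [hf, ← hδ1, hδ]; simp
  refine ⟨rfl, φ q₁, hb, L.map hφ.continuous, ?_⟩
  have hom : (L.map hsq).Homotopic δ' := SimplyConnectedSpace.paths_homotopic _ _
  have hom' := (hom.map ⟨ψ, hψ.continuous⟩).pathCast (hf q₀) (hb.trans (hf q₁))
  convert hom' using 1
  · ext t
    exact hf (L t)
  · ext t
    exact (hδ t).symm

/-- By compactness the path is cut into finitely many pieces, each in a good open set, and the lifts
are concatenated. -/
theorem liftsUpToHomotopy_of_local {f : C(E, X)}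
    (h : ∀ x, ∃ U, IsOpen U ∧ x ∈ U ∧ LiftsPathsIn f U) {a b : X} (γ : Path a b) {e : E}
    (he : f e = a) : LiftsUpToHomotopy f γ e := by
  choose U hUo hxU hU using h
  obtain ⟨t, ht0, htm, ⟨N, hN⟩, ht⟩ := exists_monotone_Icc_subset_open_cover_unitInterval
    (c := fun x => γ ⁻¹' U x) (fun x => (hUo x).preimage γ.continuous)
    (fun s _ => Set.mem_iUnion.2 ⟨γ s, hxU (γ s)⟩)
  have key : ∀ n, LiftsUpToHomotopy f (γ.subpath 0 (t n)) e := by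
    intro n
    induction n with
    | zero =>
      rw [ht0]
      refine ⟨by rw [he]; simp, e, by rw [he]; simp, Path.refl e, ?_⟩
      convert Path.Homotopic.refl _
      ext s
      simp [he]
    | succ n ih =>
      refine LiftsUpToHomotopy.of_homotopic (ih.trans (γ' := γ.subpath (t n) (t (n + 1))) ?_)
        ⟨Path.Homotopy.subpathTransSubpath γ _ _ _⟩
      intro e' he'
      obtain ⟨x, hx⟩ := ht n
      refine hU x _ _ _ (fun s => ?_) e' he'
      have : γ.subpath (t n) (t (n + 1)) s ∈ Set.range (γ.subpath (t n) (t (n + 1))) := ⟨s, rfl⟩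
      rw [γ.range_subpath_of_le _ _ (htm (Nat.le_succ n))] at this
      obtain ⟨s', hs', hs''⟩ := this
      rw [← hs'']
      exact hx hs'
  have h1 := key N
  rw [hN N le_rfl, γ.subpath_zero_one] at h1
  obtain ⟨ha, e', hb, Γ, hΓ⟩ := h1
  refine ⟨he.symm, e', by rw [← hb]; simp, Γ, ?_⟩
  have := hΓ.pathCast γ.source.symm γ.target.symm
  exact this

/-- A branched double covering with connected total space and nonempty branch locus is surjective
on fundamental groups. -/
theorem IsBranchedDoubleCovering.isPiOneSurjective [PathConnectedSpace E] {f : C(E, X)}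
    (hf : IsBranchedDoubleCovering f) {e₀ : E} (he₀ : ∀ e, f e = f e₀ → e = e₀) :
    IsPiOneSurjective f := by
  have hloc : ∀ x, ∃ U, IsOpen U ∧ x ∈ U ∧ LiftsPathsIn f U := by
    intro x
    rcases hf.local_model x with h | ⟨φ, ψ, hφ, hψ, hx, hr, hq⟩
    · exact IsEvenlyCovered.exists_liftsPathsIn h
    · exact exists_liftsPathsIn_of_squareModel hφ hψ hx hr hq
  intro x g
  obtain ⟨γ, rfl⟩ := Path.Homotopic.Quotient.mk_surjective g
  let α : Path e₀ x := PathConnectedSpace.somePath e₀ x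
  let α' := α.map f.continuous
  -- The loop is moved to the branch point `f e₀`. The lift ends over `f e₀`, hence at `e₀`, so it
  -- is closed, and conjugation by `α` brings it back to `x`.
  obtain ⟨ha, e', hb, Γ, hΓ⟩ := liftsUpToHomotopy_of_local hloc ((α'.trans γ).trans α'.symm)
    (e := e₀) rfl
  obtain rfl := he₀ e' hb.symm
  refine ⟨Path.Homotopic.Quotient.mk ((α.symm.trans Γ).trans α), ?_⟩
  change Path.Homotopic.Quotient.mk _ = Path.Homotopic.Quotient.mk γ
  have h1 : ((Γ.map f.continuous)).Homotopic ((α'.trans γ).trans α'.symm) := hΓ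
  have h2 : Path.Homotopic.Quotient.mk (Γ.map f.continuous) = _ :=
    Path.Homotopic.Quotient.eq.2 h1
  have h3 : ((α.symm.trans Γ).trans α).map f.continuous
      = (α'.symm.trans (Γ.map f.continuous)).trans α' := by
    simp only [Path.map_trans, Path.map_symm, α']
  refine (congrArg Path.Homotopic.Quotient.mk h3).trans ?_
  simp only [Path.Homotopic.Quotient.mk_trans, Path.Homotopic.Quotient.mk_symm] at h2 ⊢
  rw [h2]
  simp only [Path.Homotopic.Quotient.trans_assoc, Path.Homotopic.Quotient.symm_trans,
    Path.Homotopic.Quotient.trans_refl]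
  simp only [← Path.Homotopic.Quotient.trans_assoc, Path.Homotopic.Quotient.symm_trans,
    Path.Homotopic.Quotient.refl_trans]

end PiOne


/-! ### Quotients by involutions -/

section Involution

variable {E X : Type} [TopologicalSpace E] [TopologicalSpace X]

/-- The map `f : E → X` exhibits `X` as the quotient of `E` by the continuous involution `τ`. -/
structure IsInvolutionQuotient (τ : E → E) (f : E → X) : Prop where
  continuous_invol : Continuous τ
  involutive : Function.Involutive τ
  isQuotientMap : IsQuotientMap f
  eq_iff : ∀ a b, f a = f b ↔ b = a ∨ b = τ a

namespace IsInvolutionQuotient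

variable {τ : E → E} {f : E → X}

theorem apply_invol (h : IsInvolutionQuotient τ f) (e : E) : f (τ e) = f e :=
  ((h.eq_iff e (τ e)).2 (Or.inr rfl)).symm

theorem preimage_image (h : IsInvolutionQuotient τ f) (U : Set E) :
    f ⁻¹' (f '' U) = U ∪ τ ⁻¹' U := by
  ext e
  simp only [Set.mem_preimage, Set.mem_image, Set.mem_union, h.eq_iff]
  constructor
  · rintro ⟨x, hx, rfl | rfl⟩
    · exact Or.inl hx
    · exact Or.inr (by rwa [h.involutive x])
  · rintro (he | he)
    · exact ⟨e, he, Or.inl rfl⟩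
    · exact ⟨τ e, he, Or.inr (h.involutive e).symm⟩

theorem isOpenMap (h : IsInvolutionQuotient τ f) : IsOpenMap f := fun U hU => by
  rw [← h.isQuotientMap.isOpen_preimage, h.preimage_image]
  exact hU.union (hU.preimage h.continuous_invol)

/-- A small neighbourhood `W` of `e` is disjoint from its image under `τ`, and the preimage of `f ''
W` is the disjoint union of these two sheets. -/
theorem isEvenlyCovered [T2Space E] (h : IsInvolutionQuotient τ f) {e : E} (he : τ e ≠ e) :
    IsEvenlyCovered f (f e) (Fin 2) := by
  obtain ⟨U, V, hU, hV, heU, heV, hUV⟩ := t2_separation he.symm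
  let W : Set E := U ∩ τ ⁻¹' V
  have hW : IsOpen W := hU.inter (hV.preimage h.continuous_invol)
  have heW : e ∈ W := ⟨heU, heV⟩
  have hWτ : ∀ x ∈ W, τ x ∉ W := fun x hx hx' => Set.disjoint_left.1 hUV hx'.1 hx.2
  have hcover : ∀ x, f x ∈ f '' W → x ∈ W ∨ τ x ∈ W := fun x hx => by
    have : x ∈ f ⁻¹' (f '' W) := hx
    rwa [h.preimage_image] at this
  have hemb : IsOpenEmbedding fun w : W => f w := by
    refine .of_continuous_injective_isOpenMap
      (h.isQuotientMap.continuous.comp continuous_subtype_val) ?_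
      (h.isOpenMap.comp hW.isOpenMap_subtype_val)
    intro a b hab
    rcases (h.eq_iff _ _).1 hab with h1 | h1
    · exact Subtype.ext h1.symm
    · exact absurd (h1 ▸ b.2) (hWτ a a.2)
  have hrange : Set.range (fun w : W => f w) = f '' W := by
    rw [Set.image_eq_range]
  let k : W ≃ₜ f '' W := hemb.toIsEmbedding.toHomeomorph.trans (Homeomorph.setCongr hrange)
  have hk : ∀ w, (k w : X) = f w := fun w => rfl
  have hks : ∀ y, f (k.symm y) = y := fun y => by rw [← hk, Homeomorph.apply_symm_apply]
  have hks' : ∀ (x : E) (hx : x ∈ W) (hx' : f x ∈ f '' W), (k.symm ⟨f x, hx'⟩ : E) = x := by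
    intro x hx hx'
    have : (⟨f x, hx'⟩ : f '' W) = k ⟨x, hx⟩ := Subtype.ext rfl
    rw [this, Homeomorph.symm_apply_apply]
  classical
  refine ⟨inferInstance, f '' W, ⟨e, heW, rfl⟩, h.isOpenMap _ hW,
    (h.isOpenMap _ hW).preimage h.isQuotientMap.continuous, ?_⟩
  -- The first sheet. Its complement is the second one, so it is clopen and the sheet number is
  -- continuous.
  let S : Set (f ⁻¹' (f '' W)) := Subtype.val ⁻¹' W
  have hSo : IsOpen S := hW.preimage continuous_subtype_val
  have hSc : Sᶜ = Subtype.val ⁻¹' (τ ⁻¹' W) := by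
    ext x
    constructor
    · intro hx
      exact (hcover x x.2).resolve_left hx
    · intro hx hx'
      exact hWτ _ hx' hx
  have hS : IsClopen S := ⟨by
    rw [← isOpen_compl_iff, hSc]
    exact (hW.preimage h.continuous_invol).preimage continuous_subtype_val, hSo⟩
  let into : f ⁻¹' (f '' W) → f '' W × Fin 2 :=
    fun x => (⟨f x, x.2⟩, if x ∈ S then 0 else 1)
  let inv : f '' W × Fin 2 → f ⁻¹' (f '' W) :=
    fun y => if y.2 = 0 then ⟨k.symm y.1, by simp [hks]⟩
      else ⟨τ (k.symm y.1), by simp [h.apply_invol, hks]⟩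
  have hinto : Continuous into := by
    refine .prodMk (.subtype_mk (h.isQuotientMap.continuous.comp continuous_subtype_val) _) ?_
    refine Continuous.if (fun a ha => ?_) continuous_const continuous_const
    have : frontier {a | a ∈ S} = ∅ := hS.frontier_eq
    rw [this] at ha
    exact ha.elim
  have hinv : Continuous inv := by
    refine Continuous.if (fun a ha => ?_) ?_ ?_
    · have : frontier {a : f '' W × Fin 2 | a.2 = 0} = ∅ :=
        ((isClopen_discrete ({0} : Set (Fin 2))).preimage continuous_snd).frontier_eq
      rw [this] at ha
      exact ha.elim
    · fun_prop
    · have := h.continuous_invol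
      fun_prop
  refine ⟨⟨⟨into, inv, ?_, ?_⟩, hinto, hinv⟩, fun x => rfl⟩
  · rintro ⟨x, hx⟩
    by_cases hxW : x ∈ W
    · have : (⟨x, hx⟩ : f ⁻¹' (f '' W)) ∈ S := hxW
      simp only [into, inv, this, if_true]
      exact Subtype.ext (hks' x hxW _)
    · have : (⟨x, hx⟩ : f ⁻¹' (f '' W)) ∉ S := hxW
      simp only [into, inv, this, if_false, one_ne_zero]
      have hτx := (hcover x hx).resolve_left hxW
      apply Subtype.ext
      have h2 : (⟨f x, hx⟩ : f '' W) = ⟨f (τ x), by rwa [h.apply_invol]⟩ :=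
        Subtype.ext (h.apply_invol x).symm
      change τ (k.symm ⟨f x, hx⟩) = x
      rw [h2, hks' _ hτx, h.involutive]
  · rintro ⟨y, i⟩
    fin_cases i
    · simp only [Fin.zero_eta, into, inv, if_true]
      have : (⟨k.symm y, by simp [hks]⟩ : f ⁻¹' (f '' W)) ∈ S := (k.symm y).2
      simp only [this, if_true]
      exact Prod.ext (Subtype.ext (hks y)) rfl
    · simp only [Fin.mk_one, into, inv, one_ne_zero, if_false]
      have : (⟨τ (k.symm y), by simp [h.apply_invol, hks]⟩ : f ⁻¹' (f '' W)) ∉ S :=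
        hWτ _ (k.symm y).2
      simp only [this, if_false]
      exact Prod.ext (Subtype.ext ((h.apply_invol _).trans (hks y))) rfl

end IsInvolutionQuotient

theorem isQuotientMap_sq : IsQuotientMap fun q : ℂ × ℝ => ((q.1 ^ 2, q.2) : ℂ × ℝ) :=
  ((Complex.isOpenQuotientMap_pow 2).prodMap (.id : IsOpenQuotientMap (id : ℝ → ℝ))).isQuotientMap

/-- The shrinking homeomorphism of the plane times the line to a small open cylinder. -/
theorem exists_shrink (t₀ : ℝ) {ε : ℝ} (hε : 0 < ε) : ∃ k : ℂ × ℝ → ℂ × ℝ, IsOpenEmbedding k ∧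
    (∀ q, k q ∈ Metric.ball (0, t₀) ε) ∧ k (0, 0) = (0, t₀) ∧
    ∀ z t, k (-z, t) = (-(k (z, t)).1, (k (z, t)).2) := by
  have hu : ∀ {V : Type} [NormedAddCommGroup V] [NormedSpace ℝ V],
      IsOpenEmbedding (OpenPartialHomeomorph.univUnitBall : V → V) := fun {V} _ _ =>
    OpenPartialHomeomorph.univUnitBall.isOpenEmbedding rfl
  have hb : ∀ {V : Type} [NormedAddCommGroup V] [NormedSpace ℝ V] (x : V),
      ‖ε • OpenPartialHomeomorph.univUnitBall x‖ < ε := fun {V} _ _ x => by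
    have h1 : OpenPartialHomeomorph.univUnitBall x ∈ Metric.ball (0 : V) 1 :=
      OpenPartialHomeomorph.univUnitBall.map_source trivial
    rw [mem_ball_zero_iff] at h1
    rw [norm_smul, Real.norm_of_nonneg hε.le]
    nlinarith
  let g : ℂ × ℝ ≃ₜ ℂ × ℝ :=
    (Homeomorph.smulOfNeZero ε hε.ne').prodCongr
      ((Homeomorph.smulOfNeZero ε hε.ne').trans (Homeomorph.addLeft t₀))
  refine ⟨g ∘ Prod.map OpenPartialHomeomorph.univUnitBall OpenPartialHomeomorph.univUnitBall,
    g.isOpenEmbedding.comp (hu.prodMap hu), ?_, ?_, ?_⟩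
  · rintro ⟨z, t⟩
    rw [← ball_prod_same, Set.mem_prod]
    refine ⟨by simpa [g] using hb z, ?_⟩
    have := hb t
    rw [Real.norm_eq_abs] at this
    simpa [g, Real.dist_eq] using this
  · simp [g, OpenPartialHomeomorph.univUnitBall_apply_zero]
  -- `univUnitBall` multiplies a vector by a function of its norm, hence is odd.
  · intro z t
    simp [g, OpenPartialHomeomorph.univUnitBall]

namespace IsInvolutionQuotient

variable {τ : E → E} {f : E → X}

/-- An odd chart at a fixed point of the involution gives the square model for the quotient. -/
theorem exists_squareModel (h : IsInvolutionQuotient τ f) {e : E}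
    (χ : OpenPartialHomeomorph E (ℂ × ℝ)) (he : e ∈ χ.source)
    (he0 : (χ e).1 = 0) (hτs : ∀ x ∈ χ.source, τ x ∈ χ.source)
    (hτ : ∀ x ∈ χ.source, χ (τ x) = (-(χ x).1, (χ x).2)) :
    ∃ (φ : ℂ × ℝ → E) (ψ : ℂ × ℝ → X), IsOpenEmbedding φ ∧ IsOpenEmbedding ψ ∧
      f e ∈ Set.range ψ ∧ Set.range φ = f ⁻¹' Set.range ψ ∧
      ∀ q : ℂ × ℝ, f (φ q) = ψ (q.1 ^ 2, q.2) := by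
  obtain ⟨ε, hε, hball⟩ := Metric.isOpen_iff.1 χ.open_target _ (χ.map_source he)
  have hχe : χ e = (0, (χ e).2) := Prod.ext he0 rfl
  rw [hχe] at hball
  obtain ⟨k, hk, hkb, hk0, hkn⟩ := exists_shrink (χ e).2 hε
  have hkt : ∀ q, k q ∈ χ.target := fun q => hball (hkb q)
  let φ : ℂ × ℝ → E := fun q => χ.symm (k q)
  have hφc : Continuous φ := by
    refine χ.symm.continuousOn.comp_continuous hk.continuous hkt
  have hφ : IsOpenEmbedding φ := by
    refine .of_continuous_injective_isOpenMap hφc ?_ ?_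
    · intro a b hab
      exact hk.injective (χ.symm.injOn (hkt a) (hkt b) hab)
    · intro U hU
      have : φ '' U = χ.symm '' (k '' U) := by rw [Set.image_image]
      rw [this]
      refine χ.symm.isOpen_image_of_subset_source (hk.isOpenMap _ hU) ?_
      rintro _ ⟨q, -, rfl⟩
      exact hkt q
  have hφτ : ∀ z t, φ (-z, t) = τ (φ (z, t)) := by
    intro z t
    have hs : φ (z, t) ∈ χ.source := χ.map_target (hkt _)
    apply χ.injOn (χ.map_target (hkt _)) (hτs _ hs)
    rw [hτ _ hs]
    simp only [φ, χ.right_inv (hkt (z, t))]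
    rw [← hkn]
    exact χ.right_inv (hkt _)
  have hφe : φ (0, 0) = e := by
    simp only [φ, hk0, ← hχe]
    exact χ.left_inv he
  -- An arbitrary, discontinuous square root suffices: both roots have the same image under `f ∘ φ`,
  -- since `φ` carries the sign change to `τ`.
  choose s hs using fun z : ℂ => IsAlgClosed.exists_pow_nat_eq z two_pos
  let ψ : ℂ × ℝ → X := fun q => f (φ (s q.1, q.2))
  have hψφ : ∀ q : ℂ × ℝ, f (φ q) = ψ (q.1 ^ 2, q.2) := by
    rintro ⟨z, t⟩
    rcases sq_eq_sq_iff_eq_or_eq_neg.1 (hs (z ^ 2)) with h1 | h1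
    · simp only [ψ, h1]
    · simp only [ψ, h1, hφτ, h.apply_invol]
  have hψc : Continuous ψ := by
    -- Squaring is a quotient map, so continuity descends from `f ∘ φ`.
    rw [isQuotientMap_sq.continuous_iff]
    have : ψ ∘ (fun q : ℂ × ℝ => ((q.1 ^ 2, q.2) : ℂ × ℝ)) = f ∘ φ := funext fun q => (hψφ q).symm
    rw [this]
    exact h.isQuotientMap.continuous.comp hφc
  have hsur : Function.Surjective fun q : ℂ × ℝ => ((q.1 ^ 2, q.2) : ℂ × ℝ) :=
    isQuotientMap_sq.surjective
  have hrange : Set.range ψ = f '' Set.range φ := by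
    ext x
    constructor
    · rintro ⟨q, rfl⟩
      exact ⟨_, ⟨_, rfl⟩, rfl⟩
    · rintro ⟨_, ⟨q, rfl⟩, rfl⟩
      exact ⟨_, (hψφ q).symm⟩
  refine ⟨φ, ψ, hφ, ?_, ?_, ?_, hψφ⟩
  · refine .of_continuous_injective_isOpenMap hψc ?_ ?_
    · intro a b hab
      obtain ⟨⟨z, t⟩, rfl⟩ := hsur a
      obtain ⟨⟨z', t'⟩, rfl⟩ := hsur b
      have hab' : f (φ (z, t)) = f (φ (z', t')) := by rw [hψφ, hψφ]; exact hab
      rcases (h.eq_iff _ _).1 hab' with h1 | h1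
      · rw [hφ.injective h1]
      · rw [← hφτ] at h1
        have h2 := hφ.injective h1
        simp only [Prod.mk.injEq] at h2
        simp [h2.1, h2.2]
    · intro U hU
      have : ψ '' U = f '' (φ '' ((fun q : ℂ × ℝ => ((q.1 ^ 2, q.2) : ℂ × ℝ)) ⁻¹' U)) := by
        ext x
        constructor
        · rintro ⟨q, hq, rfl⟩
          obtain ⟨q', rfl⟩ := hsur q
          exact ⟨_, ⟨q', hq, rfl⟩, hψφ q'⟩
        · rintro ⟨_, ⟨q, hq, rfl⟩, rfl⟩
          exact ⟨_, hq, (hψφ q).symm⟩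
      rw [this]
      exact h.isOpenMap _ (hφ.isOpenMap _ (hU.preimage isQuotientMap_sq.continuous))
  · rw [hrange]
    exact ⟨e, ⟨_, hφe⟩, rfl⟩
  · rw [hrange, h.preimage_image]
    refine (Set.union_eq_left.2 ?_).symm
    rintro x ⟨⟨z, t⟩, hq⟩
    refine ⟨(-z, t), ?_⟩
    rw [hφτ, hq, h.involutive]

/-- The quotient by an involution with odd charts at the fixed points is a branched double
covering. -/
theorem isBranchedDoubleCovering [T2Space E] (h : IsInvolutionQuotient τ f)
    (hχ : ∀ e, τ e = e → ∃ χ : OpenPartialHomeomorph E (ℂ × ℝ), e ∈ χ.source ∧ (χ e).1 = 0 ∧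
      (∀ x ∈ χ.source, τ x ∈ χ.source) ∧
      ∀ x ∈ χ.source, χ (τ x) = (-(χ x).1, (χ x).2)) :
    IsBranchedDoubleCovering f where
  continuous := h.isQuotientMap.continuous
  local_model x := by
    obtain ⟨e, rfl⟩ := h.isQuotientMap.surjective x
    by_cases he : τ e = e
    · obtain ⟨χ, h1, h2, h3, h4⟩ := hχ e he
      exact Or.inr (h.exists_squareModel χ h1 h2 h3 h4)
    · exact Or.inl (h.isEvenlyCovered he)

end IsInvolutionQuotient

end Involution


/-! ### Phases and polar coordinates -/

/-- The phase `z / |z|` of a complex number, with value `1` at the origin. -/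
def phase (z : ℂ) : Circle :=
  if h : z = 0 then 1 else ⟨z / ‖z‖, by
    change z / (‖z‖ : ℂ) ∈ Metric.sphere (0 : ℂ) 1
    rw [mem_sphere_zero_iff_norm, norm_div, Complex.norm_real, norm_norm,
      div_self (norm_ne_zero_iff.2 h)]⟩

theorem coe_phase {z : ℂ} (hz : z ≠ 0) : (phase z : ℂ) = z / ‖z‖ := by
  simp [phase, hz]

theorem norm_mul_phase (z : ℂ) : (‖z‖ : ℂ) * phase z = z := by
  by_cases hz : z = 0
  · simp [hz]
  · rw [coe_phase hz, mul_div_cancel₀]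
    simpa using hz

theorem phase_ofReal_mul {r : ℝ} (hr : 0 < r) (w : Circle) : phase (r * w) = w := by
  apply Circle.ext
  have : (r * w : ℂ) ≠ 0 := mul_ne_zero (by exact_mod_cast hr.ne') w.coe_ne_zero
  rw [coe_phase this, norm_mul, Circle.norm_coe, mul_one, Complex.norm_real,
    Real.norm_of_nonneg hr.le, mul_div_cancel_left₀]
  exact_mod_cast hr.ne'

theorem phase_coe (w : Circle) : phase w = w := by
  simpa using phase_ofReal_mul one_pos w

theorem phase_mul {z z' : ℂ} (hz : z ≠ 0) (hz' : z' ≠ 0) :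
    phase (z * z') = phase z * phase z' := by
  apply Circle.ext
  rw [Circle.coe_mul, coe_phase hz, coe_phase hz', coe_phase (mul_ne_zero hz hz'), norm_mul]
  push_cast
  rw [mul_div_mul_comm]

theorem isEmbedding_circleCoe : IsEmbedding fun w : Circle => (w : ℂ) :=
  IsEmbedding.subtypeVal

theorem continuousAt_phase {z : ℂ} (hz : z ≠ 0) : ContinuousAt phase z := by
  rw [isEmbedding_circleCoe.isInducing.continuousAt_iff]
  have h : (fun z : ℂ => z / (‖z‖ : ℂ)) =ᶠ[𝓝 z] (fun w : Circle => (w : ℂ)) ∘ phase := by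
    filter_upwards [isOpen_ne.mem_nhds hz] with y hy
    exact (coe_phase hy).symm
  refine ContinuousAt.congr ?_ h
  refine continuousAt_id.div (by fun_prop) ?_
  simpa using hz

/-- The solution `a ≥ 0` of the equations `a ^ 2 - b ^ 2 = s` and `a * b = c`. -/
def radius (s c : ℝ) : ℝ := Real.sqrt ((s + Real.sqrt (s ^ 2 + 4 * c ^ 2)) / 2)

theorem continuous_radius : Continuous fun q : ℝ × ℝ => radius q.1 q.2 := by
  unfold radius
  fun_prop

theorem radius_eq {a b s c : ℝ} (ha : 0 ≤ a) (hs : a ^ 2 - b ^ 2 = s)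
    (hc : a * b = c) : radius s c = a := by
  subst hs hc
  have : (a ^ 2 - b ^ 2) ^ 2 + 4 * (a * b) ^ 2 = (a ^ 2 + b ^ 2) ^ 2 := by ring
  rw [radius, this, Real.sqrt_sq (by positivity)]
  ring_nf
  exact Real.sqrt_sq ha

theorem abs_le_sqrt_aux (s c : ℝ) : |s| ≤ Real.sqrt (s ^ 2 + 4 * c ^ 2) :=
  Real.le_sqrt_of_sq_le (by rw [sq_abs]; nlinarith [sq_nonneg c])

theorem radius_sq (s c : ℝ) : radius s c ^ 2 = (s + Real.sqrt (s ^ 2 + 4 * c ^ 2)) / 2 := by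
  rw [radius, Real.sq_sqrt]
  have := (abs_le.1 (abs_le_sqrt_aux s c)).1
  linarith

theorem radius_pos {s c : ℝ} (h : 0 < s ∨ c ≠ 0) : 0 < radius s c := by
  refine Real.sqrt_pos.2 ?_
  rcases h with h | h
  · have := Real.sqrt_nonneg (s ^ 2 + 4 * c ^ 2)
    linarith
  · have h1 : |s| < Real.sqrt (s ^ 2 + 4 * c ^ 2) := by
      rw [Real.lt_sqrt (abs_nonneg s), sq_abs]
      have : 0 < c ^ 2 := by positivity
      linarith
    have := (abs_lt.1 h1).1
    linarith

/-- If `|u|² - |v|² = s` and `|u| |v| = c`, then `radius s c` is `|u|` and `radius (-s) c` is `|v|`.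
-/
theorem radius_mul_radius_neg (s : ℝ) {c : ℝ} (hc : 0 ≤ c) :
    radius s c * radius (-s) c = c := by
  have h1 := radius_sq s c
  have h2 := radius_sq (-s) c
  have h3 := Real.sq_sqrt (show 0 ≤ s ^ 2 + 4 * c ^ 2 by positivity)
  rw [neg_sq] at h2
  have h4 : (radius s c * radius (-s) c) ^ 2 = c ^ 2 := by
    rw [mul_pow, h1, h2]
    linear_combination h3 / 4
  exact (pow_left_inj₀ (mul_nonneg (Real.sqrt_nonneg _) (Real.sqrt_nonneg _)) hc two_ne_zero).1 h4

theorem radius_sq_sub (s c : ℝ) : radius s c ^ 2 - radius (-s) c ^ 2 = s := by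
  rw [radius_sq, radius_sq, neg_sq]
  ring

/-! ### The double of a planar domain and a circle bundle over it -/

/-- A compact connected planar domain `{0 ≤ rho}` with locally flat boundary `{rho = 0}`, together
with a twisting function. -/
structure TwistedDomain where
  rho : ℝ × ℝ → ℝ
  twist : ℝ × ℝ → ℂ
  continuous_rho : Continuous rho
  continuous_twist : Continuous twist
  -- Only the boundary values lie on the circle. In the interior `twist` may vanish, and this is
  -- what leaves room for a non-trivial bundle.
  norm_twist : ∀ p, rho p = 0 → ‖twist p‖ = 1
  flat : ∀ p, rho p = 0 → ∃ H : ℝ × ℝ ≃ₜ ℝ × ℝ, ∀ᶠ q in 𝓝 p, rho q = (H q).1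
  isCompact : IsCompact {p | 0 ≤ rho p}
  isPathConnected : IsPathConnected {p | 0 ≤ rho p}
  exists_boundary : ∃ p, rho p = 0

namespace TwistedDomain

variable (D : TwistedDomain)

/-- The domain itself. -/
def domain : Set (ℝ × ℝ) := {p | 0 ≤ D.rho p}

/-- The double of the domain. -/
abbrev Double : Type := {b : (ℝ × ℝ) × ℝ // |b.2| = D.rho b.1}

/-- The total space of the circle bundle: over a point `(p, s)` of the double, it consists of the
pairs `(u, v)` with `u * v = twist p` and `|u| ^ 2 - |v| ^ 2 = s`. -/
abbrev Total : Type := {e : (ℝ × ℝ) × ℂ × ℂ //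
  e.2.1 * e.2.2 = D.twist e.1 ∧ |‖e.2.1‖ ^ 2 - ‖e.2.2‖ ^ 2| = D.rho e.1}

variable {D}

/-- The bundle projection. -/
def proj (e : D.Total) : D.Double :=
  ⟨(e.1.1, ‖e.1.2.1‖ ^ 2 - ‖e.1.2.2‖ ^ 2), e.2.2⟩

/-- The involution of the total space. -/
def swap (e : D.Total) : D.Total :=
  ⟨(e.1.1, e.1.2.2, e.1.2.1), by rw [← e.2.1, mul_comm], by rw [← e.2.2, abs_sub_comm]⟩

/-- The reflection of the double. -/
def reflect (b : D.Double) : D.Double := ⟨(b.1.1, -b.1.2), by rw [← b.2, abs_neg]⟩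

theorem continuous_proj : Continuous (proj : D.Total → D.Double) := by
  unfold proj
  fun_prop

theorem continuous_swap : Continuous (swap : D.Total → D.Total) := by
  unfold swap
  fun_prop

theorem swap_swap (e : D.Total) : swap (swap e) = e := rfl

theorem continuous_reflect : Continuous (reflect : D.Double → D.Double) := by
  unfold reflect
  fun_prop

theorem reflect_reflect (b : D.Double) : reflect (reflect b) = b := by
  simp [reflect]

theorem proj_swap (e : D.Total) : proj (swap e) = reflect (proj e) := by
  simp [reflect, proj, swap]

/-- The action on `v` is by the inverse, so that `u * v` is preserved. -/
instance : MulAction Circle D.Total where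
  smul g e := ⟨(e.1.1, g * e.1.2.1, (g⁻¹ : Circle) * e.1.2.2), by
    rw [← e.2.1]
    change (g : ℂ) * e.1.2.1 * ((g⁻¹ : Circle) * e.1.2.2) = _
    rw [Circle.coe_inv]
    field_simp, by
    rw [← e.2.2]
    rw [norm_mul, norm_mul, Circle.norm_coe, Circle.norm_coe, one_mul, one_mul]⟩
  one_smul e := Subtype.ext <| by
    change (e.1.1, ((1 : Circle) : ℂ) * e.1.2.1, ((1⁻¹ : Circle) : ℂ) * e.1.2.2) = e.1
    simp
  mul_smul g h e := Subtype.ext <| by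
    change (e.1.1, ((g * h : Circle) : ℂ) * e.1.2.1, (((g * h)⁻¹ : Circle) : ℂ) * e.1.2.2) =
      (e.1.1, (g : ℂ) * (h * e.1.2.1), ((g⁻¹ : Circle) : ℂ) * ((h⁻¹ : Circle) * e.1.2.2))
    rw [mul_inv]
    push_cast
    simp only [mul_assoc]

theorem proj_smul (g : Circle) (e : D.Total) : proj (g • e) = proj e := by
  refine Subtype.ext (Prod.ext rfl ?_)
  change ‖(g : ℂ) * e.1.2.1‖ ^ 2 - ‖((g⁻¹ : Circle) : ℂ) * e.1.2.2‖ ^ 2 = _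
  rw [norm_mul, norm_mul, Circle.norm_coe, Circle.norm_coe, one_mul, one_mul]
  rfl

theorem continuous_smul : Continuous fun q : Circle × D.Total => q.1 • q.2 := by
  refine Continuous.subtype_mk (f := fun q : Circle × D.Total =>
    (q.2.1.1, (q.1 : ℂ) * q.2.1.2.1, ((q.1⁻¹ : Circle) : ℂ) * q.2.1.2.2)) ?_ _
  fun_prop

/-- The modulus of `u` at the point `(u, v)` over `b`. -/
def modulus (b : D.Double) : ℝ := radius b.1.2 ‖D.twist b.1.1‖

theorem continuous_modulus : Continuous (modulus : D.Double → ℝ) := by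
  have := D.continuous_twist
  exact continuous_radius.comp (f := fun b : D.Double => (b.1.2, ‖D.twist b.1.1‖)) (by fun_prop)

theorem modulus_proj (e : D.Total) : modulus (proj e) = ‖e.1.2.1‖ := by
  refine radius_eq (b := ‖e.1.2.2‖) (norm_nonneg _) rfl ?_
  rw [← norm_mul, e.2.1]
  rfl

theorem modulus_reflect_proj (e : D.Total) : modulus (reflect (proj e)) = ‖e.1.2.2‖ := by
  rw [← proj_swap, modulus_proj]
  rfl

/-- The two coordinates `u`, `v` never vanish together: their norms differ if `s ≠ 0`, and their
product has norm one if `s = 0`. So the phases of `u` and `v` trivialize the bundle over two open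
sets that cover the base. -/
theorem modulus_pos_or (b : D.Double) : 0 < modulus b ∨ 0 < modulus (reflect b) := by
  rcases lt_trichotomy b.1.2 0 with h | h | h
  · exact Or.inr (radius_pos (Or.inl (neg_pos.2 h)))
  · refine Or.inl (radius_pos (Or.inr ?_))
    rw [D.norm_twist _ (by rw [← b.2, h, abs_zero])]
    exact one_ne_zero
  · exact Or.inl (radius_pos (Or.inl h))

/-- The point of the total space over `b` with a given phase of `u`. -/
def point (b : D.Double) (w : Circle) (hb : 0 < modulus b) : D.Total :=
  ⟨(b.1.1, modulus b * w, D.twist b.1.1 / (modulus b * w)), by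
    have : (modulus b * w : ℂ) ≠ 0 := mul_ne_zero (by exact_mod_cast hb.ne') w.coe_ne_zero
    constructor
    · exact mul_div_cancel₀ _ this
    · simp only [norm_div, norm_mul, Circle.norm_coe, mul_one, Complex.norm_real,
        Real.norm_of_nonneg hb.le]
      have h1 : ‖D.twist b.1.1‖ / modulus b = radius (-b.1.2) ‖D.twist b.1.1‖ := by
        rw [div_eq_iff hb.ne', mul_comm]
        exact (radius_mul_radius_neg _ (norm_nonneg _)).symm
      rw [h1, modulus, radius_sq_sub, b.2]⟩

theorem proj_point (b : D.Double) (w : Circle) (hb : 0 < modulus b) :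
    proj (point b w hb) = b := by
  refine Subtype.ext (Prod.ext rfl ?_)
  change ‖(modulus b * w : ℂ)‖ ^ 2 - ‖D.twist b.1.1 / (modulus b * w)‖ ^ 2 = b.1.2
  simp only [norm_div, norm_mul, Circle.norm_coe, mul_one, Complex.norm_real,
    Real.norm_of_nonneg hb.le]
  have h1 : ‖D.twist b.1.1‖ / modulus b = radius (-b.1.2) ‖D.twist b.1.1‖ := by
    rw [div_eq_iff hb.ne', mul_comm]
    exact (radius_mul_radius_neg _ (norm_nonneg _)).symm
  rw [h1, modulus, radius_sq_sub]

theorem phase_point (b : D.Double) (w : Circle) (hb : 0 < modulus b) :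
    phase (point b w hb).1.2.1 = w := phase_ofReal_mul hb w

theorem point_proj_phase (e : D.Total) (he : 0 < modulus (proj e)) :
    point (proj e) (phase e.1.2.1) he = e := by
  have h1 : (modulus (proj e) : ℂ) * phase e.1.2.1 = e.1.2.1 := by
    rw [modulus_proj, norm_mul_phase]
  have h2 : e.1.2.1 ≠ 0 := by
    rw [modulus_proj] at he
    exact norm_pos_iff.1 he
  refine Subtype.ext (Prod.ext rfl (Prod.ext h1 ?_))
  change D.twist e.1.1 / (modulus (proj e) * phase e.1.2.1) = _
  rw [h1, ← e.2.1, mul_div_cancel_left₀ _ h2]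

/-- A point of the total space is determined by its projection and the phase of `u`. -/
theorem ext_of_phase {e e' : D.Total} (h : proj e = proj e') (he : 0 < modulus (proj e))
    (hw : phase e.1.2.1 = phase e'.1.2.1) : e = e' := by
  rw [← point_proj_phase e he, ← point_proj_phase e' (h ▸ he)]
  congr 1

theorem nonempty_total (b : D.Double) : Nonempty D.Total := by
  rcases modulus_pos_or b with h | h
  · exact ⟨point _ 1 h⟩
  · exact ⟨point _ 1 h⟩

theorem proj_surjective : Function.Surjective (proj : D.Total → D.Double) := fun b => by
  rcases modulus_pos_or b with h | h
  · exact ⟨point b 1 h, proj_point _ _ _⟩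
  · exact ⟨swap (point _ 1 h), by rw [proj_swap, proj_point, reflect_reflect]⟩

/-- The trivialization of the bundle over the set where `u` does not vanish, as a partial
homeomorphism. -/
def phaseChart (e₀ : D.Total) : OpenPartialHomeomorph D.Total (D.Double × Circle) where
  toFun e := (proj e, phase e.1.2.1)
  -- The value `e₀` is only used outside the target.
  invFun y := open Classical in if h : 0 < modulus y.1 then point y.1 y.2 h else e₀
  source := {e | 0 < modulus (proj e)}
  target := {b | 0 < modulus b} ×ˢ Set.univ
  map_source' e he := ⟨he, trivial⟩
  map_target' y hy := by
    have hy : 0 < modulus y.1 := hy.1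
    simp only [hy, dite_true, Set.mem_ofPred_eq, proj_point]
  left_inv' e he := by
    have he : 0 < modulus (proj e) := he
    simp only [he, dite_true, point_proj_phase]
  right_inv' y hy := by
    have hy : 0 < modulus y.1 := hy.1
    simp only [hy, dite_true, proj_point, phase_point]
  open_source := isOpen_lt continuous_const (continuous_modulus.comp continuous_proj)
  open_target := (isOpen_lt continuous_const continuous_modulus).prod isOpen_univ
  continuousOn_toFun := by
    refine continuous_proj.continuousOn.prodMk fun e he => ContinuousAt.continuousWithinAt ?_
    have h2 : e.1.2.1 ≠ 0 := by
      have he : 0 < modulus (proj e) := he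
      rw [modulus_proj] at he
      exact norm_pos_iff.1 he
    exact (continuousAt_phase h2).comp (f := fun e : D.Total => e.1.2.1) (by fun_prop)
  continuousOn_invFun := by
    refine Topology.IsInducing.subtypeVal.continuousOn_iff.2 ?_
    have h : Set.EqOn (fun y : D.Double × Circle => ((y.1.1.1, (modulus y.1 : ℂ) * y.2,
        D.twist y.1.1.1 / ((modulus y.1 : ℂ) * y.2)) : (ℝ × ℝ) × ℂ × ℂ))
        (Subtype.val ∘ fun y : D.Double × Circle => open Classical in
          if h : 0 < modulus y.1 then point y.1 y.2 h else e₀)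
        ({b | 0 < modulus b} ×ˢ Set.univ) := by
      intro y hy
      have hy : 0 < modulus y.1 := hy.1
      simp only [Function.comp, hy, dite_true]
      rfl
    refine ContinuousOn.congr ?_ h.symm
    have h1 := D.continuous_twist
    have h2 : Continuous (modulus : D.Double → ℝ) := continuous_modulus
    refine ContinuousOn.prodMk (by fun_prop) (ContinuousOn.prodMk (by fun_prop) ?_)
    refine ContinuousOn.div (by fun_prop) (by fun_prop) fun y hy => ?_
    have hy : 0 < modulus y.1 := hy.1
    exact mul_ne_zero (by exact_mod_cast hy.ne') y.2.coe_ne_zero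

/-- The reflection as a homeomorphism. -/
def reflectHomeomorph : D.Double ≃ₜ D.Double :=
  ⟨⟨reflect, reflect, reflect_reflect, reflect_reflect⟩, continuous_reflect, continuous_reflect⟩

/-- The involution as a homeomorphism. -/
def swapHomeomorph : D.Total ≃ₜ D.Total :=
  ⟨⟨swap, swap, swap_swap, swap_swap⟩, continuous_swap, continuous_swap⟩

/-- The trivialization over the set where `u` does not vanish. -/
def phaseTrivialization (e₀ : D.Total) : Bundle.Trivialization Circle (proj : D.Total → D.Double) :=
  { phaseChart e₀ with
    baseSet := {b | 0 < modulus b}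
    open_baseSet := isOpen_lt continuous_const continuous_modulus
    source_eq := rfl
    target_eq := rfl
    proj_toFun := fun _ _ => rfl }

/-- The trivialization over the set where `v` does not vanish. -/
def phaseTrivialization' (e₀ : D.Total) :
    Bundle.Trivialization Circle (proj : D.Total → D.Double) :=
  { (swapHomeomorph.transOpenPartialHomeomorph (phaseChart e₀)).transHomeomorph
      -- The inversion restores equivariance, since the circle acts on `v` by the inverse.
      (reflectHomeomorph.prodCongr (Homeomorph.inv Circle)) with
    baseSet := {b | 0 < modulus (reflect b)}
    open_baseSet := isOpen_lt continuous_const (continuous_modulus.comp continuous_reflect)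
    source_eq := by
      ext e
      change 0 < modulus (proj (swap e)) ↔ 0 < modulus (reflect (proj e))
      rw [proj_swap]
    target_eq := by
      ext y
      change (reflect y.1, y.2⁻¹) ∈ ({b : D.Double | 0 < modulus b} ×ˢ (Set.univ : Set Circle)) ↔ _
      simp
    proj_toFun := fun e _ => by
      change reflect (proj (swap e)) = proj e
      rw [proj_swap, reflect_reflect] }

theorem isCircleBundle : IsCircleBundle (proj : D.Total → D.Double) where
  continuous_smul := continuous_smul
  map_smul := proj_smul
  locally_trivial b := by
    obtain ⟨e₀⟩ := nonempty_total b
    rcases modulus_pos_or b with h | h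
    · refine ⟨phaseTrivialization e₀, h, fun g x hx => ?_⟩
      have hx : 0 < modulus (proj x) := hx
      rw [modulus_proj] at hx
      change phase (g * x.1.2.1) = g * phase x.1.2.1
      rw [phase_mul g.coe_ne_zero (norm_pos_iff.1 hx), phase_coe]
    · refine ⟨phaseTrivialization' e₀, h, fun g x hx => ?_⟩
      have hx : 0 < modulus (proj (swap x)) := hx
      rw [modulus_proj] at hx
      change (phase ((g⁻¹ : Circle) * x.1.2.2))⁻¹ = g * (phase x.1.2.2)⁻¹
      have hx' : x.1.2.2 ≠ 0 := norm_pos_iff.1 hx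
      rw [phase_mul (Circle.coe_ne_zero g⁻¹) hx', phase_coe, mul_inv, inv_inv]

end TwistedDomain


namespace TwistedDomain

variable {D : TwistedDomain}

/-! ### The double is a closed surface -/

/-- The chart of the double at a boundary point of the domain, from a straightening of the
boundary. -/
def boundaryChart (b₀ : D.Double) (H : ℝ × ℝ ≃ₜ ℝ × ℝ) (U : Set (ℝ × ℝ)) (hU : IsOpen U)
    (hH : ∀ q ∈ U, D.rho q = (H q).1) : OpenPartialHomeomorph D.Double (ℝ × ℝ) where
  -- On the double the first coordinate of `H p` is `|s|`. Replacing it by `s` unfolds the half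
  -- plane to the plane.
  toFun b := (b.1.2, (H b.1.1).2)
  invFun y := open Classical in if h : H.symm (|y.1|, y.2) ∈ U then
    ⟨(H.symm (|y.1|, y.2), y.1), by rw [hH _ h, Homeomorph.apply_symm_apply]⟩ else b₀
  source := {b | b.1.1 ∈ U}
  target := {y | H.symm (|y.1|, y.2) ∈ U}
  map_source' b hb := by
    have hb : b.1.1 ∈ U := hb
    have : ((|b.1.2|, (H b.1.1).2) : ℝ × ℝ) = H b.1.1 := Prod.ext (by rw [b.2, hH _ hb]) rfl
    change H.symm (|b.1.2|, (H b.1.1).2) ∈ U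
    rwa [this, Homeomorph.symm_apply_apply]
  map_target' y hy := by
    have hy : H.symm (|y.1|, y.2) ∈ U := hy
    simp only [hy, dite_true]
    exact hy
  left_inv' b hb := by
    have hb : b.1.1 ∈ U := hb
    have : ((|b.1.2|, (H b.1.1).2) : ℝ × ℝ) = H b.1.1 := Prod.ext (by rw [b.2, hH _ hb]) rfl
    simp only [this, Homeomorph.symm_apply_apply, hb, dite_true]
  right_inv' y hy := by
    have hy : H.symm (|y.1|, y.2) ∈ U := hy
    simp only [hy, dite_true, Homeomorph.apply_symm_apply]
  open_source := hU.preimage (by fun_prop)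
  open_target := hU.preimage (by fun_prop)
  continuousOn_toFun := by fun_prop
  continuousOn_invFun := by
    refine Topology.IsInducing.subtypeVal.continuousOn_iff.2 ?_
    refine ContinuousOn.congr (f := fun y : ℝ × ℝ => (H.symm (|y.1|, y.2), y.1)) (by fun_prop) ?_
    intro y hy
    have hy : H.symm (|y.1|, y.2) ∈ U := hy
    simp only [Function.comp, hy, dite_true]

/-- The chart of the double at the points of the first copy of the interior of the domain. -/
def interiorChart (b₀ : D.Double) : OpenPartialHomeomorph D.Double (ℝ × ℝ) where
  toFun b := b.1.1
  invFun x := open Classical in if h : 0 ≤ D.rho x then ⟨(x, D.rho x), abs_of_nonneg h⟩ else b₀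
  source := {b | 0 < b.1.2}
  target := {x | 0 < D.rho x}
  map_source' b hb := by
    have hb : 0 < b.1.2 := hb
    change 0 < D.rho b.1.1
    rwa [← b.2, abs_of_pos hb]
  map_target' x hx := by
    have hx : 0 < D.rho x := hx
    simp only [hx.le, dite_true]
    exact hx
  left_inv' b hb := by
    have hb : 0 < b.1.2 := hb
    have h : D.rho b.1.1 = b.1.2 := by rw [← b.2, abs_of_pos hb]
    simp only [h, hb.le, dite_true]
  right_inv' x hx := by
    have hx : 0 < D.rho x := hx
    simp only [hx.le, dite_true]
  open_source := isOpen_lt continuous_const (by fun_prop)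
  open_target := isOpen_lt continuous_const D.continuous_rho
  continuousOn_toFun := by fun_prop
  continuousOn_invFun := by
    refine Topology.IsInducing.subtypeVal.continuousOn_iff.2 ?_
    have := D.continuous_rho
    refine ContinuousOn.congr (f := fun x : ℝ × ℝ => (x, D.rho x)) (by fun_prop) ?_
    intro x hx
    have hx : 0 < D.rho x := hx
    simp only [Function.comp, hx.le, dite_true]

theorem exists_open_flat {p : ℝ × ℝ} (hp : D.rho p = 0) : ∃ (H : ℝ × ℝ ≃ₜ ℝ × ℝ)
    (U : Set (ℝ × ℝ)), IsOpen U ∧ p ∈ U ∧ ∀ q ∈ U, D.rho q = (H q).1 := by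
  obtain ⟨H, hH⟩ := D.flat p hp
  obtain ⟨U, hU, hUo, hpU⟩ := eventually_nhds_iff.1 hH
  exact ⟨H, U, hUo, hpU, hU⟩

theorem exists_chart (b : D.Double) :
    ∃ χ : OpenPartialHomeomorph D.Double (ℝ × ℝ), b ∈ χ.source := by
  rcases lt_trichotomy b.1.2 0 with h | h | h
  · refine ⟨reflectHomeomorph.transOpenPartialHomeomorph (interiorChart b), ?_⟩
    exact neg_pos.2 h
  · obtain ⟨H, U, hU, hbU, hH⟩ := exists_open_flat (show D.rho b.1.1 = 0 by rw [← b.2, h, abs_zero])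
    exact ⟨boundaryChart b H U hU hH, hbU⟩
  · exact ⟨interiorChart b, h⟩

theorem nonempty_chartedSpace :
    Nonempty (ChartedSpace (EuclideanSpace ℝ (Fin 2)) D.Double) := by
  choose χ hχ using exists_chart (D := D)
  let k : ℝ × ℝ ≃ₜ EuclideanSpace ℝ (Fin 2) :=
    Homeomorph.finTwoArrow.symm.trans (EuclideanSpace.equiv (Fin 2) ℝ).symm.toHomeomorph
  exact ⟨{ atlas := Set.range fun b => (χ b).transHomeomorph k
           chartAt := fun b => (χ b).transHomeomorph k
           mem_chart_source := fun b => hχ b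
           chart_mem_atlas := fun b => ⟨b, rfl⟩ }⟩

instance : CompactSpace D.Double := by
  have h1 : IsCompact ((fun q : (ℝ × ℝ) × ℝ => (q.1, q.2 * D.rho q.1)) ''
      ({p | 0 ≤ D.rho p} ×ˢ ({1, -1} : Set ℝ))) := by
    have := D.continuous_rho
    exact (D.isCompact.prod (Set.toFinite _).isCompact).image (by fun_prop)
  have h2 : IsClosed {b : (ℝ × ℝ) × ℝ | |b.2| = D.rho b.1} :=
    isClosed_eq (by fun_prop) (D.continuous_rho.comp continuous_fst)
  refine isCompact_iff_compactSpace.1 (h1.of_isClosed_subset h2 ?_)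
  rintro ⟨p, s⟩ h
  have h : |s| = D.rho p := h
  have h0 : 0 ≤ D.rho p := h ▸ abs_nonneg s
  rcases abs_choice s with hs | hs
  · exact ⟨(p, 1), ⟨h0, Or.inl rfl⟩, Prod.ext rfl (by simp only; rw [← h, hs, one_mul])⟩
  · exact ⟨(p, -1), ⟨h0, Or.inr rfl⟩, Prod.ext rfl (by simp only; rw [← h, hs]; ring)⟩

/-! ### The half of the total space -/

/-- The point of the double over a point of the domain, in the first copy. -/
def upper (p : ℝ × ℝ) (hp : p ∈ D.domain) : D.Double := ⟨(p, D.rho p), abs_of_nonneg hp⟩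

theorem modulus_upper_pos (p : ℝ × ℝ) (hp : p ∈ D.domain) : 0 < modulus (upper p hp) := by
  refine radius_pos ?_
  rcases (show 0 ≤ D.rho p from hp).lt_or_eq with h | h
  · exact Or.inl h
  · refine Or.inr ?_
    change ‖D.twist p‖ ≠ 0
    rw [D.norm_twist p h.symm]
    exact one_ne_zero

/-- The inclusion of the part of the bundle over the first copy of the domain. -/
def halfIncl (q : D.domain × Circle) : D.Total :=
  point (upper q.1.1 q.1.2) q.2 (modulus_upper_pos _ _)

theorem proj_halfIncl (q : D.domain × Circle) :
    proj (halfIncl q) = upper q.1.1 q.1.2 := proj_point _ _ _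

theorem phase_halfIncl (q : D.domain × Circle) :
    phase (halfIncl q).1.2.1 = q.2 := phase_point _ _ _

theorem mem_domain (e : D.Total) : e.1.1 ∈ D.domain := by
  change 0 ≤ D.rho _
  rw [← e.2.2]
  exact abs_nonneg _

theorem continuous_halfIncl : Continuous (halfIncl : D.domain × Circle → D.Total) := by
  refine Topology.IsInducing.subtypeVal.continuous_iff.2 ?_
  have h1 := D.continuous_twist
  have h2 : Continuous (modulus : D.Double → ℝ) := continuous_modulus
  have h3 : Continuous fun q : D.domain × Circle => modulus (upper q.1.1 q.1.2) := by
    have := D.continuous_rho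
    refine h2.comp (Continuous.subtype_mk (by fun_prop) _)
  have h4 : Continuous fun q : D.domain × Circle =>
    ((modulus (upper q.1.1 q.1.2) : ℂ) * q.2) := by fun_prop
  refine Continuous.prodMk (by fun_prop) (Continuous.prodMk h4 ?_)
  refine Continuous.div (f := fun q : D.domain × Circle => D.twist q.1.1) (by fun_prop) h4 fun q => ?_
  exact mul_ne_zero (by exact_mod_cast (modulus_upper_pos q.1.1 q.1.2).ne') q.2.coe_ne_zero

/-- The inequality says `s ≥ 0`, that is, `e` lies over the first copy of the domain. -/
theorem halfIncl_of_le {e : D.Total} (he : ‖e.1.2.2‖ ≤ ‖e.1.2.1‖) :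
    halfIncl (⟨e.1.1, mem_domain e⟩, phase e.1.2.1) = e := by
  have h : upper e.1.1 (mem_domain e) = proj e := by
    refine Subtype.ext (Prod.ext rfl ?_)
    change D.rho e.1.1 = ‖e.1.2.1‖ ^ 2 - ‖e.1.2.2‖ ^ 2
    rw [← e.2.2, abs_of_nonneg]
    nlinarith [norm_nonneg e.1.2.2]
  refine ext_of_phase ?_ ?_ ?_
  · rw [proj_halfIncl, h]
  · rw [proj_halfIncl]
    exact modulus_upper_pos _ _
  · rw [phase_halfIncl]

theorem eq_halfIncl_or (e : D.Total) :
    e ∈ Set.range (halfIncl : D.domain × Circle → D.Total) ∨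
      swap e ∈ Set.range (halfIncl : D.domain × Circle → D.Total) := by
  rcases le_total ‖e.1.2.2‖ ‖e.1.2.1‖ with h | h
  · exact Or.inl ⟨_, halfIncl_of_le h⟩
  · exact Or.inr ⟨_, halfIncl_of_le (e := swap e) h⟩

/-- Over the boundary the two norms are equal and their product is one. -/
theorem norm_eq_of_boundary {e : D.Total} (he : D.rho e.1.1 = 0) :
    ‖e.1.2.1‖ = 1 ∧ ‖e.1.2.2‖ = 1 := by
  have h1 := e.2.1
  have h2 := e.2.2
  rw [he, abs_eq_zero, sub_eq_zero] at h2
  have h3 : ‖e.1.2.1‖ = ‖e.1.2.2‖ :=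
    (pow_left_inj₀ (norm_nonneg _) (norm_nonneg _) two_ne_zero).1 h2
  have h4 := D.norm_twist _ he
  rw [← h1, norm_mul, h3] at h4
  rw [h3]
  have : ‖e.1.2.2‖ = 1 := by nlinarith [norm_nonneg e.1.2.2]
  exact ⟨this, this⟩

/-- Over a boundary point `p` the fixed points are the square roots of `twist p`. Such a point
connects the two halves of the total space, and it later serves as base point for the fundamental
group. -/
theorem exists_fixed : ∃ e : D.Total, swap e = e ∧ D.rho e.1.1 = 0 := by
  obtain ⟨p, hp⟩ := D.exists_boundary
  obtain ⟨z, hz⟩ := IsAlgClosed.exists_pow_nat_eq (D.twist p) two_pos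
  exact ⟨⟨(p, z, z), by rw [← hz, sq], by simp [hp]⟩, rfl, hp⟩

instance : PathConnectedSpace D.Total := by
  have : PathConnectedSpace D.domain := isPathConnected_iff_pathConnectedSpace.1 D.isPathConnected
  have : PathConnectedSpace Circle :=
    Circle.exp_surjective.pathConnectedSpace Circle.exp.continuous
  have h1 : IsPathConnected (Set.range (halfIncl : D.domain × Circle → D.Total)) :=
    isPathConnected_range continuous_halfIncl
  have h2 := h1.image (continuous_swap (D := D))
  obtain ⟨e, he, hr⟩ := exists_fixed (D := D)
  have he' := (norm_eq_of_boundary hr)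
  have h3 : e ∈ Set.range (halfIncl : D.domain × Circle → D.Total) :=
    ⟨_, halfIncl_of_le (by rw [he'.1, he'.2])⟩
  refine pathConnectedSpace_iff_univ.2 ?_
  convert h1.union h2 ⟨e, h3, e, h3, he⟩
  refine (Set.eq_univ_of_forall fun x => ?_).symm
  rcases eq_halfIncl_or x with h | h
  · exact Or.inl h
  · exact Or.inr ⟨_, h, rfl⟩

theorem isClosedSurface : IsClosedSurface D.Double where
  t2 := inferInstance
  compact := inferInstance
  connected := proj_surjective.connectedSpace continuous_proj
  charted := nonempty_chartedSpace

/-! ### Odd charts at the fixed points -/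

/-- The chart of the product of the double with the circle which is obtained from a chart of the
double and the angle relative to a local section. -/
def angleChart (χ : OpenPartialHomeomorph D.Double (ℝ × ℝ)) (V : Set D.Double) (hV : IsOpen V)
    (hVχ : V ⊆ χ.source) (k : D.Double → Circle) (hk : ContinuousOn k V) :
    OpenPartialHomeomorph (D.Double × Circle) (ℂ × ℝ) where
  toFun y := (⟨(χ y.1).1, Complex.arg ((y.2 / k y.1 : Circle) : ℂ)⟩, (χ y.1).2)
  invFun q := (χ.symm (q.1.re, q.2), k (χ.symm (q.1.re, q.2)) * Circle.exp q.1.im)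
  -- On the right half circle `arg` is continuous and odd under inversion.
  source := {y | y.1 ∈ V ∧ 0 < ((y.2 / k y.1 : Circle) : ℂ).re}
  target := {q | (q.1.re, q.2) ∈ χ.target ∩ χ.symm ⁻¹' V ∧ |q.1.im| < Real.pi / 2}
  map_source' y hy := by
    refine ⟨⟨χ.map_source (hVχ hy.1), ?_⟩, ?_⟩
    · change χ.symm (χ y.1) ∈ V
      rw [χ.left_inv (hVχ hy.1)]
      exact hy.1
    · exact Complex.abs_arg_lt_pi_div_two_iff.2 (Or.inl hy.2)
  map_target' q hq := by
    refine ⟨hq.1.2, ?_⟩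
    simp only [mul_div_cancel_left]
    rw [Circle.coe_exp, Complex.exp_ofReal_mul_I_re]
    exact Real.cos_pos_of_mem_Ioo (abs_lt.1 hq.2)
  left_inv' y hy := by
    have h1 : χ.symm (χ y.1) = y.1 := χ.left_inv (hVχ hy.1)
    have h2 : χ.symm ((χ y.1).1, (χ y.1).2) = y.1 := h1
    simp only [h2, Circle.exp_arg, mul_div_cancel]
  right_inv' q hq := by
    have h1 : χ (χ.symm (q.1.re, q.2)) = (q.1.re, q.2) := χ.right_inv hq.1.1
    have h2 := abs_lt.1 hq.2
    have hpi := Real.pi_pos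
    simp only [h1, mul_div_cancel_left]
    rw [Circle.arg_exp (by linarith [h2.1]) (by linarith [h2.2])]
  open_source := by
    have h1 : ContinuousOn (fun y : D.Double × Circle => ((y.2 / k y.1 : Circle) : ℂ).re)
        (V ×ˢ Set.univ) := by
      have : ContinuousOn (fun y : D.Double × Circle => k y.1) (V ×ˢ Set.univ) :=
        hk.comp continuousOn_fst fun y hy => hy.1
      have h2 : ContinuousOn (fun y : D.Double × Circle => y.2 / k y.1) (V ×ˢ Set.univ) :=
        continuousOn_snd.div' this
      exact (Complex.continuous_re.comp isEmbedding_circleCoe.continuous).comp_continuousOn h2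
    convert h1.isOpen_inter_preimage (hV.prod isOpen_univ) (isOpen_Ioi (a := (0 : ℝ))) using 1
    ext y
    simp
  open_target := by
    have h1 : IsOpen (χ.target ∩ χ.symm ⁻¹' V) := χ.isOpen_inter_preimage_symm hV
    exact (h1.preimage (f := fun q : ℂ × ℝ => (q.1.re, q.2)) (by fun_prop)).inter
      (isOpen_lt (f := fun q : ℂ × ℝ => |q.1.im|) (by fun_prop) continuous_const)
  continuousOn_toFun := by
    have h1 : ContinuousOn (fun y : D.Double × Circle => χ y.1)
        {y | y.1 ∈ V ∧ 0 < ((y.2 / k y.1 : Circle) : ℂ).re} :=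
      χ.continuousOn.comp continuousOn_fst fun y hy => hVχ hy.1
    have h2 : ContinuousOn (fun y : D.Double × Circle => k y.1)
        {y | y.1 ∈ V ∧ 0 < ((y.2 / k y.1 : Circle) : ℂ).re} :=
      hk.comp continuousOn_fst fun y hy => hy.1
    have h3 : ContinuousOn (fun y : D.Double × Circle => Complex.arg ((y.2 / k y.1 : Circle) : ℂ))
        {y | y.1 ∈ V ∧ 0 < ((y.2 / k y.1 : Circle) : ℂ).re} := by
      have h4 := isEmbedding_circleCoe.continuous.comp_continuousOn (continuousOn_snd.div' h2)
      exact fun y hy => ContinuousAt.comp_continuousWithinAt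
        (f := fun y : D.Double × Circle => ((y.2 / k y.1 : Circle) : ℂ))
        (Complex.continuousAt_arg (Or.inl hy.2)) (h4 y hy)
    have h5 : ContinuousOn (fun y : D.Double × Circle =>
        (((χ y.1).1 : ℂ) + Complex.arg ((y.2 / k y.1 : Circle) : ℂ) * Complex.I, (χ y.1).2))
        {y | y.1 ∈ V ∧ 0 < ((y.2 / k y.1 : Circle) : ℂ).re} := by
      have h6 := Complex.continuous_ofReal.comp_continuousOn h3
      have h7 := Complex.continuous_ofReal.comp_continuousOn h1.fst
      exact (h7.add (h6.mul continuousOn_const)).prodMk h1.snd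
    refine h5.congr fun y _ => Prod.ext ?_ rfl
    exact Complex.mk_eq_add_mul_I _ _
  continuousOn_invFun := by
    have h1 : ContinuousOn (fun q : ℂ × ℝ => χ.symm (q.1.re, q.2))
        {q | (q.1.re, q.2) ∈ χ.target ∩ χ.symm ⁻¹' V ∧ |q.1.im| < Real.pi / 2} :=
      χ.symm.continuousOn.comp (f := fun q : ℂ × ℝ => (q.1.re, q.2)) (by fun_prop)
        fun q hq => hq.1.1
    have h2 : ContinuousOn (fun q : ℂ × ℝ => k (χ.symm (q.1.re, q.2)))
        {q | (q.1.re, q.2) ∈ χ.target ∩ χ.symm ⁻¹' V ∧ |q.1.im| < Real.pi / 2} :=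
      hk.comp h1 fun q hq => hq.1.2
    exact h1.prodMk (h2.mul (by fun_prop))

/-- The coordinates are `s`, the angle of `u` relative to a local square root `m` of `twist`, and
the position along the boundary. The involution negates `s` and, because `(u / m) * (v / m) = 1`,
also the angle; it keeps the third coordinate. -/
theorem exists_oddChart {e : D.Total} (he : swap e = e) :
    ∃ χ : OpenPartialHomeomorph D.Total (ℂ × ℝ), e ∈ χ.source ∧ (χ e).1 = 0 ∧
      (∀ x ∈ χ.source, swap x ∈ χ.source) ∧
      ∀ x ∈ χ.source, χ (swap x) = (-(χ x).1, (χ x).2) := by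
  have huv : e.1.2.2 = e.1.2.1 := congrArg (fun x : D.Total => x.1.2.1) he
  have hs : (proj e).1.2 = 0 := by
    change ‖e.1.2.1‖ ^ 2 - ‖e.1.2.2‖ ^ 2 = 0
    rw [huv, sub_self]
  have hrho : D.rho e.1.1 = 0 := by
    rw [← e.2.2, huv, sub_self, abs_zero]
  have hu : e.1.2.1 ≠ 0 := by
    rw [← norm_pos_iff, (norm_eq_of_boundary hrho).1]
    exact one_pos
  obtain ⟨H, U, hU, heU, hH⟩ := exists_open_flat hrho
  -- Normalized to be `1` at the given point, so that the principal square root is continuous nearby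
  -- and `m` takes the value `u` at `e`.
  let ζ : ℝ × ℝ → ℂ := fun p => D.twist p / e.1.2.1 ^ 2
  have hζc : Continuous ζ := D.continuous_twist.div_const _
  have hζe : ζ e.1.1 = 1 := by
    simp only [ζ]
    rw [← e.2.1, huv, ← sq, div_self (pow_ne_zero 2 hu)]
  let m : ℝ × ℝ → ℂ := fun p => e.1.2.1 * ζ p ^ ((2 : ℂ)⁻¹)
  have hm2 : ∀ p, m p ^ 2 = D.twist p := fun p => by
    simp only [m, ζ]
    rw [mul_pow, Complex.cpow_ofNat_inv_pow, mul_div_cancel₀ _ (pow_ne_zero 2 hu)]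
  let V : Set D.Double := {b | b.1.1 ∈ U ∧ 0 < (ζ b.1.1).re}
  have hV : IsOpen V := (hU.preimage (by fun_prop)).inter
    (isOpen_lt (f := fun _ : D.Double => (0 : ℝ)) (g := fun b : D.Double => (ζ b.1.1).re)
      continuous_const (by fun_prop))
  have htw : ∀ b ∈ V, D.twist b.1.1 ≠ 0 := fun b hb h => by
    have := hb.2
    simp [ζ, h] at this
  have hm0 : ∀ b ∈ V, m b.1.1 ≠ 0 := fun b hb h => htw b hb (by rw [← hm2, h]; simp)
  let k : D.Double → Circle := fun b => phase (m b.1.1)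
  have hk : ContinuousOn k V := fun b hb => by
    refine ContinuousAt.continuousWithinAt ?_
    refine (continuousAt_phase (hm0 b hb)).comp (f := fun b : D.Double => m b.1.1) ?_
    refine continuousAt_const.mul ?_
    exact (continuousAt_cpow_const (Or.inl hb.2)).comp (f := fun b : D.Double => ζ b.1.1)
      (by fun_prop)
  let χ₁ := boundaryChart (proj e) H U hU hH
  let χ := (phaseChart e).trans (angleChart χ₁ V hV (fun b hb => hb.1) k hk)
  have hVr : ∀ b, reflect b ∈ V ↔ b ∈ V := fun b => Iff.rfl
  have hsource : ∀ x, x ∈ χ.source ↔ (proj x ∈ V ∧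
      0 < ((phase x.1.2.1 / k (proj x) : Circle) : ℂ).re) := by
    intro x
    simp only [χ, OpenPartialHomeomorph.trans_source]
    constructor
    · rintro ⟨-, h⟩
      exact h
    · intro h
      refine ⟨?_, h⟩
      change 0 < modulus (proj x)
      rw [modulus_proj, norm_pos_iff]
      intro h0
      refine htw _ h.1 ?_
      change D.twist x.1.1 = 0
      rw [← x.2.1, h0, zero_mul]
  have hinv : ∀ x, proj x ∈ V →
      phase x.1.2.2 / k (proj x) = (phase x.1.2.1 / k (proj x))⁻¹ := by
    intro x hx
    have h0 := htw _ hx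
    have h1 : D.twist x.1.1 ≠ 0 := h0
    rw [← x.2.1] at h1
    have h2 : phase x.1.2.1 * phase x.1.2.2 = k (proj x) * k (proj x) := by
      simp only [k]
      rw [← phase_mul (left_ne_zero_of_mul h1) (right_ne_zero_of_mul h1), x.2.1,
        ← phase_mul (hm0 _ hx) (hm0 _ hx), ← sq, hm2]
      rfl
    rw [inv_div, div_eq_div_iff_mul_eq_mul, mul_comm (phase x.1.2.2), h2]
  have hre : ∀ w : Circle, ((w⁻¹ : Circle) : ℂ).re = (w : ℂ).re := fun w => by
    rw [Circle.coe_inv_eq_conj, Complex.conj_re]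
  refine ⟨χ, (hsource e).2 ⟨⟨heU, ?_⟩, ?_⟩, ?_, fun x hx => ?_, fun x hx => ?_⟩
  · change 0 < (ζ e.1.1).re
    rw [hζe]
    simp
  · have : k (proj e) = phase e.1.2.1 := by
      change phase (e.1.2.1 * ζ e.1.1 ^ ((2 : ℂ)⁻¹)) = _
      rw [hζe, Complex.one_cpow, mul_one]
    rw [this, div_self']
    simp
  · have : k (proj e) = phase e.1.2.1 := by
      change phase (e.1.2.1 * ζ e.1.1 ^ ((2 : ℂ)⁻¹)) = _
      rw [hζe, Complex.one_cpow, mul_one]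
    change (⟨(proj e).1.2, Complex.arg ((phase e.1.2.1 / k (proj e) : Circle) : ℂ)⟩ : ℂ) = 0
    rw [this, div_self', hs]
    simp
    rfl
  · rw [hsource] at hx ⊢
    refine ⟨hx.1, ?_⟩
    change 0 < ((phase x.1.2.2 / k (proj x) : Circle) : ℂ).re
    rw [hinv x hx.1, hre]
    exact hx.2
  · rw [hsource] at hx
    refine Prod.ext ?_ rfl
    change (⟨‖x.1.2.2‖ ^ 2 - ‖x.1.2.1‖ ^ 2,
      Complex.arg ((phase x.1.2.2 / k (proj x) : Circle) : ℂ)⟩ : ℂ) =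
      -⟨‖x.1.2.1‖ ^ 2 - ‖x.1.2.2‖ ^ 2, Complex.arg ((phase x.1.2.1 / k (proj x) : Circle) : ℂ)⟩
    rw [hinv x hx.1, Circle.coe_inv_eq_conj, Complex.arg_conj, if_neg]
    · apply Complex.ext <;> simp
    · intro h
      have h1 := Complex.abs_arg_lt_pi_div_two_iff.2 (Or.inl hx.2)
      rw [h, abs_of_pos Real.pi_pos] at h1
      linarith [Real.pi_pos]

/-! ### Folding the total space -/

/-- The map `Φ` exhibits `X` as the quotient of the product of the domain with the circle by the
identifications `(p, w) ∼ (p, w')` with `w * w' = twist p` over the boundary. -/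
structure IsFolding (D : TwistedDomain) {X : Type} [TopologicalSpace X]
    (Φ : ℝ × ℝ → Circle → X) : Prop where
  continuousOn : ContinuousOn (fun q : (ℝ × ℝ) × Circle => Φ q.1 q.2) (D.domain ×ˢ Set.univ)
  surjective : ∀ x, ∃ p ∈ D.domain, ∃ w, Φ p w = x
  -- The quotient topology, stated for closed sets; thus no separation property of `X` is involved.
  isClosed : ∀ C : Set X, IsClosed {q : (ℝ × ℝ) × Circle | q.1 ∈ D.domain ∧ Φ q.1 q.2 ∈ C} →
    IsClosed C
  eq_iff : ∀ p ∈ D.domain, ∀ p' ∈ D.domain, ∀ w w', Φ p w = Φ p' w' ↔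
    p = p' ∧ (w = w' ∨ D.rho p = 0 ∧ (w * w' : ℂ) = D.twist p)

/-- The map of the total space which is induced by a folding. -/
def fold {X : Type} (Φ : ℝ × ℝ → Circle → X) (e : D.Total) : X :=
  if ‖e.1.2.2‖ ≤ ‖e.1.2.1‖ then Φ e.1.1 (phase e.1.2.1) else Φ e.1.1 (phase e.1.2.2)

section Folding

variable {X : Type} [TopologicalSpace X] {Φ : ℝ × ℝ → Circle → X}

theorem isClosed_domain : IsClosed D.domain := isClosed_le continuous_const D.continuous_rho

/-- Such points lie over the boundary, where the product of the phases of `u` and `v` is `twist`, so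
`Φ` identifies them. This makes the two cases of `fold` agree on their common boundary. -/
theorem IsFolding.eq_of_norm_eq (h : D.IsFolding Φ) {e : D.Total} (he : ‖e.1.2.2‖ = ‖e.1.2.1‖) :
    Φ e.1.1 (phase e.1.2.1) = Φ e.1.1 (phase e.1.2.2) := by
  have hr : D.rho e.1.1 = 0 := by rw [← e.2.2, he, sub_self, abs_zero]
  obtain ⟨h1, h2⟩ := norm_eq_of_boundary hr
  refine (h.eq_iff _ (mem_domain e) _ (mem_domain e) _ _).2 ⟨rfl, Or.inr ⟨hr, ?_⟩⟩
  have h3 := norm_mul_phase e.1.2.1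
  have h4 := norm_mul_phase e.1.2.2
  rw [h1, Complex.ofReal_one, one_mul] at h3
  rw [h2, Complex.ofReal_one, one_mul] at h4
  rw [h3, h4, e.2.1]

theorem IsFolding.fold_of_le (_ : D.IsFolding Φ) {e : D.Total} (he : ‖e.1.2.2‖ ≤ ‖e.1.2.1‖) :
    fold Φ e = Φ e.1.1 (phase e.1.2.1) := if_pos he

theorem IsFolding.fold_swap (h : D.IsFolding Φ) (e : D.Total) : fold Φ (swap e) = fold Φ e := by
  unfold fold swap
  simp only
  split_ifs with h1 h2 h2
  · exact (h.eq_of_norm_eq (le_antisymm h2 h1)).symm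
  · rfl
  · rfl
  · exact absurd (le_of_not_ge h1) h2

theorem IsFolding.fold_halfIncl (h : D.IsFolding Φ) (q : D.domain × Circle) :
    fold Φ (halfIncl q) = Φ q.1 q.2 := by
  have h1 := congrArg (fun b : D.Double => b.1.2) (proj_halfIncl q)
  have h2 : ‖(halfIncl q).1.2.1‖ ^ 2 - ‖(halfIncl q).1.2.2‖ ^ 2 = D.rho q.1 := h1
  have h3 : 0 ≤ D.rho q.1 := q.1.2
  have h4 : ‖(halfIncl q).1.2.2‖ ≤ ‖(halfIncl q).1.2.1‖ := by
    refine (pow_le_pow_iff_left₀ (norm_nonneg _) (norm_nonneg _) two_ne_zero).1 ?_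
    linarith
  rw [h.fold_of_le h4, phase_halfIncl]
  rfl

theorem IsFolding.continuous_fold (h : D.IsFolding Φ) :
    Continuous (fold Φ : D.Total → X) := by
  have hne : ∀ e : D.Total, ‖e.1.2.2‖ ≤ ‖e.1.2.1‖ → e.1.2.1 ≠ 0 := by
    intro e he h0
    have h1 : ‖e.1.2.2‖ = ‖e.1.2.1‖ := le_antisymm he (by rw [h0, norm_zero]; exact norm_nonneg _)
    have hr : D.rho e.1.1 = 0 := by rw [← e.2.2, h1, sub_self, abs_zero]
    have := (norm_eq_of_boundary hr).1
    rw [h0, norm_zero] at this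
    exact zero_ne_one this
  have h1 : ContinuousOn (fun e : D.Total => Φ e.1.1 (phase e.1.2.1))
      {e | ‖e.1.2.2‖ ≤ ‖e.1.2.1‖} := by
    refine h.continuousOn.comp (f := fun e : D.Total => (e.1.1, phase e.1.2.1)) ?_ ?_
    · refine ContinuousOn.prodMk (by fun_prop) fun e he => ContinuousAt.continuousWithinAt ?_
      exact (continuousAt_phase (hne e he)).comp (f := fun e : D.Total => e.1.2.1) (by fun_prop)
    · exact fun e _ => ⟨mem_domain e, trivial⟩
  have h2 : ContinuousOn (fun e : D.Total => Φ e.1.1 (phase e.1.2.2))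
      {e | ‖e.1.2.1‖ ≤ ‖e.1.2.2‖} :=
    h1.comp (f := (swap : D.Total → D.Total)) continuous_swap.continuousOn fun e he => he
  unfold fold
  refine continuous_if ?_ ?_ ?_
  · intro e he
    refine h.eq_of_norm_eq ?_
    exact frontier_le_subset_eq (f := fun e : D.Total => ‖e.1.2.2‖) (g := fun e => ‖e.1.2.1‖)
      (by fun_prop) (by fun_prop) he
  · refine h1.mono ?_
    exact closure_minimal (fun e he => he) (isClosed_le (by fun_prop) (by fun_prop))
  · refine h2.mono ?_
    exact closure_minimal (fun e he => le_of_not_ge he) (isClosed_le (by fun_prop) (by fun_prop))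

theorem IsFolding.isInvolutionQuotient (h : D.IsFolding Φ) :
    IsInvolutionQuotient (swap : D.Total → D.Total) (fold Φ) where
  continuous_invol := continuous_swap
  involutive := swap_swap
  isQuotientMap := by
    have hq : IsQuotientMap fun q : D.domain × Circle => Φ q.1 q.2 := by
      refine isQuotientMap_iff_isClosed.2 ⟨fun x => ?_, fun C => ⟨fun hC => ?_, fun hC => ?_⟩⟩
      · obtain ⟨p, hp, w, hw⟩ := h.surjective x
        exact ⟨(⟨p, hp⟩, w), hw⟩
      · refine hC.preimage ?_
        exact h.continuousOn.comp_continuous (f := fun q : D.domain × Circle => (q.1.1, q.2))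
          (by fun_prop) fun q => ⟨q.1.2, trivial⟩
      · refine h.isClosed C ?_
        have hemb : IsClosedEmbedding (Prod.map Subtype.val id : D.domain × Circle → _) :=
          isClosed_domain.isClosedEmbedding_subtypeVal.prodMap .id
        convert hemb.isClosedMap _ hC using 1
        ext ⟨p, w⟩
        constructor
        · rintro ⟨hp, hw⟩
          exact ⟨(⟨p, hp⟩, w), hw, rfl⟩
        · rintro ⟨⟨⟨p, hp⟩, w⟩, hw, h2⟩
          cases h2
          exact ⟨hp, hw⟩
    -- One half of the total space already maps onto `X` by a quotient map, hence `fold Φ` is a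
    -- quotient map.
    have hc : (fun q : D.domain × Circle => Φ q.1 q.2) = fold Φ ∘ halfIncl :=
      funext fun q => (h.fold_halfIncl q).symm
    rw [hc] at hq
    exact hq.of_comp continuous_halfIncl h.continuous_fold
  eq_iff a b := by
    constructor
    -- On the first half, the identifications made by `Φ` are exactly those made by `swap` over the
    -- boundary; the other cases reduce to this one by applying `swap`.
    · have key : ∀ q q' : D.domain × Circle, Φ q.1 q.2 = Φ q'.1 q'.2 →
          halfIncl q' = halfIncl q ∨ halfIncl q' = swap (halfIncl q) := by
        rintro ⟨⟨p, hp⟩, w⟩ ⟨⟨p', hp'⟩, w'⟩ hab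
        obtain ⟨hpp, hw⟩ := (h.eq_iff _ hp _ hp' _ _).1 hab
        obtain rfl : p = p' := hpp
        rcases hw with rfl | ⟨hr, hw⟩
        · exact Or.inl rfl
        · refine Or.inr (ext_of_phase ?_ ?_ ?_)
          · rw [proj_swap, proj_halfIncl, proj_halfIncl]
            refine Subtype.ext (Prod.ext rfl ?_)
            change D.rho p = -D.rho p
            rw [hr, neg_zero]
          · rw [proj_halfIncl]
            exact modulus_upper_pos _ _
          · rw [phase_halfIncl]
            set e := halfIncl (⟨p, hp⟩, w) with he
            have hre : D.rho e.1.1 = 0 := hr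
            change w' = phase e.1.2.2
            have h1 : e.1.2.1 = w := by
              have := norm_mul_phase e.1.2.1
              rw [(norm_eq_of_boundary hre).1, he, phase_halfIncl] at this
              rw [he, ← this]
              simp
            have h2 : e.1.2.2 = w' := by
              have h3 := e.2.1
              rw [h1] at h3
              exact mul_left_cancel₀ w.coe_ne_zero (h3.trans hw.symm)
            rw [h2, phase_coe]
      intro hab
      rcases eq_halfIncl_or a with ⟨q, hq⟩ | ⟨q, hq⟩ <;>
      rcases eq_halfIncl_or b with ⟨q', hq'⟩ | ⟨q', hq'⟩
      · rw [← hq, ← hq', h.fold_halfIncl, h.fold_halfIncl] at hab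
        rw [← hq, ← hq']
        exact key q q' hab
      · rw [← h.fold_swap b, ← hq, ← hq', h.fold_halfIncl, h.fold_halfIncl] at hab
        rw [← swap_swap b, ← hq, ← hq']
        rcases key q q' hab with h1 | h1
        · exact Or.inr (congrArg swap h1)
        · exact Or.inl (congrArg swap h1)
      · rw [← h.fold_swap a, ← hq, ← hq', h.fold_halfIncl, h.fold_halfIncl] at hab
        rw [← swap_swap a, ← hq, ← hq']
        exact (key q q' hab).symm
      · rw [← h.fold_swap a, ← h.fold_swap b, ← hq, ← hq', h.fold_halfIncl,
          h.fold_halfIncl] at hab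
        rw [← swap_swap a, ← swap_swap b, ← hq, ← hq']
        rcases key q q' hab with h1 | h1
        · exact Or.inl (congrArg swap h1)
        · exact Or.inr (congrArg swap h1)
    · rintro (rfl | rfl)
      · rfl
      · exact (h.fold_swap a).symm

theorem IsFolding.isBranchedDoubleCovering (h : D.IsFolding Φ) :
    IsBranchedDoubleCovering (fold Φ : D.Total → X) :=
  h.isInvolutionQuotient.isBranchedDoubleCovering fun _ he => exists_oddChart he

theorem IsFolding.isPiOneSurjective (h : D.IsFolding Φ) :
    IsPiOneSurjective (⟨fold Φ, h.continuous_fold⟩ : C(D.Total, X)) := by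
  obtain ⟨e, he, -⟩ := exists_fixed (D := D)
  refine IsBranchedDoubleCovering.isPiOneSurjective (e₀ := e) h.isBranchedDoubleCovering ?_
  intro e' he'
  rcases (h.isInvolutionQuotient.eq_iff _ _).1 he'.symm with h1 | h1
  · exact h1
  · rw [h1, he]

end Folding

/-- A trivialization of the bundle extends the twisting function from the boundary to a map of the
domain to the circle. -/
theorem exists_extension_of_trivial
    (h : IsHomeomorphicTrivialFiberBundle Circle (proj : D.Total → D.Double)) :
    ∃ g : ℝ × ℝ → Circle, ContinuousOn g D.domain ∧ ∀ p, D.rho p = 0 → (g p : ℂ) = D.twist p := by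
  obtain ⟨F, hF⟩ := h
  let s : D.Double → D.Total := fun b => F.symm (b, 1)
  have hs : Continuous s := by fun_prop
  have hps : ∀ b, proj (s b) = b := fun b => by
    rw [← hF]
    simp [s]
  have hu : ∀ b : D.Double, 0 ≤ b.1.2 → (s b).1.2.1 ≠ 0 := by
    intro b hb
    rw [← norm_pos_iff, ← modulus_proj, hps]
    have h1 : upper b.1.1 (show 0 ≤ D.rho b.1.1 from b.2 ▸ abs_nonneg _) = b :=
      Subtype.ext (Prod.ext rfl (by
        change D.rho b.1.1 = b.1.2
        rw [← b.2, abs_of_nonneg hb]))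
    rw [← h1]
    exact modulus_upper_pos _ _
  have hv : ∀ b : D.Double, b.1.2 ≤ 0 → (s b).1.2.2 ≠ 0 := by
    intro b hb
    rw [← norm_pos_iff, ← modulus_reflect_proj, hps]
    have h1 : upper b.1.1 (show 0 ≤ D.rho b.1.1 from b.2 ▸ abs_nonneg _) = reflect b :=
      Subtype.ext (Prod.ext rfl (by
        change D.rho b.1.1 = -b.1.2
        rw [← b.2, abs_of_nonpos hb]))
    rw [← h1]
    exact modulus_upper_pos _ _
  classical
  let up : D.domain → D.Double := fun p => upper p.1 p.2
  have hup : Continuous up := by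
    have := D.continuous_rho
    exact Continuous.subtype_mk (by fun_prop) _
  -- The phase of `u` on the first copy times the phase of `v` on the second copy. On the boundary
  -- the copies coincide and `u * v = twist`.
  let g₀ : D.domain → Circle := fun p =>
    phase (s (up p)).1.2.1 * phase (s (reflect (up p))).1.2.2
  have hg₀ : Continuous g₀ := by
    refine Continuous.mul ?_ ?_
    · refine continuous_iff_continuousAt.2 fun p => ?_
      refine (continuousAt_phase (hu (up p) p.2)).comp
        (f := fun p : D.domain => (s (up p)).1.2.1) ?_
      fun_prop
    · refine continuous_iff_continuousAt.2 fun p => ?_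
      have : Continuous (reflect : D.Double → D.Double) := continuous_reflect
      refine (continuousAt_phase (hv (reflect (up p)) (neg_nonpos.2 p.2))).comp
        (f := fun p : D.domain => (s (reflect (up p))).1.2.2) ?_
      fun_prop
  refine ⟨fun p => if h : p ∈ D.domain then g₀ ⟨p, h⟩ else 1, ?_, fun p hp => ?_⟩
  · rw [continuousOn_iff_continuous_domRestrict]
    convert hg₀ using 1
    ext p
    simp
  · have hpd : p ∈ D.domain := hp.ge
    have h1 : reflect (up ⟨p, hpd⟩) = up ⟨p, hpd⟩ := by
      refine Subtype.ext (Prod.ext rfl ?_)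
      change -D.rho p = D.rho p
      rw [hp, neg_zero]
    have h2 : (s (up ⟨p, hpd⟩)).1.1 = p := congrArg (fun b : D.Double => b.1.1) (hps (up ⟨p, hpd⟩))
    have h3 : D.rho (s (up ⟨p, hpd⟩)).1.1 = 0 := by rw [h2, hp]
    simp only [hpd, dite_true, g₀, h1]
    obtain ⟨h4, h5⟩ := norm_eq_of_boundary h3
    have h6 := norm_mul_phase (s (up ⟨p, hpd⟩)).1.2.1
    have h7 := norm_mul_phase (s (up ⟨p, hpd⟩)).1.2.2
    rw [h4, Complex.ofReal_one, one_mul] at h6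
    rw [h5, Complex.ofReal_one, one_mul] at h7
    rw [Circle.coe_mul, h6, h7, (s (up ⟨p, hpd⟩)).2.1, h2]

end TwistedDomain


/-! ### The planar domains -/

/-- Half the length of the vertical sections of the hexagon. -/
def height (n : ℕ) (x : ℝ) : ℝ := min 2 (min (2 * (1 + x)) (2 * (2 * n + 1 - x)))

/-- A function which is negative precisely inside the first `n` square holes. -/
def holes : ℕ → ℝ × ℝ → ℝ
  | 0, _ => 1
  | k + 1, p => min (holes k p) (max |p.1 - (2 * k + 1)| |p.2| - 1 / 2)

/-- The defining function of the hexagon with `n` square holes. -/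
def hexRho (n : ℕ) (p : ℝ × ℝ) : ℝ := min (height n p.1 - |p.2|) (holes n p)

/-- The twisting function. -/
def hexTwist (p : ℝ × ℝ) : ℂ :=
  ⟨-Real.cos (Real.pi * (1 + min p.1 0)),
    max (-Real.sin (Real.pi * (1 + min p.1 0)))
      (min (Real.sin (Real.pi * (1 + min p.1 0))) (2 * p.2))⟩

theorem continuous_height (n : ℕ) : Continuous (height n) := by
  unfold height
  fun_prop

theorem continuous_holes (n : ℕ) : Continuous (holes n) := by
  induction n with
  | zero => exact continuous_const
  | succ n ih =>
    change Continuous fun p : ℝ × ℝ => min (holes n p) (max |p.1 - (2 * n + 1)| |p.2| - 1 / 2)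
    fun_prop

theorem continuous_hexRho (n : ℕ) : Continuous (hexRho n) := by
  have h1 := continuous_height n
  have h2 := continuous_holes n
  unfold hexRho
  fun_prop

theorem continuous_hexTwist : Continuous hexTwist := by
  have : hexTwist = fun p : ℝ × ℝ => ((-Real.cos (Real.pi * (1 + min p.1 0)) : ℝ) : ℂ) +
    ((max (-Real.sin (Real.pi * (1 + min p.1 0)))
      (min (Real.sin (Real.pi * (1 + min p.1 0))) (2 * p.2)) : ℝ) : ℂ) * Complex.I :=
    funext fun p => Complex.mk_eq_add_mul_I _ _
  rw [this]
  fun_prop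

/-- The bound on `c` comes from the starting value `1` of `holes`. -/
theorem le_holes_iff {n : ℕ} {p : ℝ × ℝ} {c : ℝ} (hc : c ≤ 1) :
    c ≤ holes n p ↔ ∀ k < n, c ≤ max |p.1 - (2 * k + 1)| |p.2| - 1 / 2 := by
  induction n with
  | zero => simp [holes, hc]
  | succ n ih =>
    rw [holes, le_min_iff, ih]
    constructor
    · rintro ⟨h1, h2⟩ k hk
      rcases Nat.lt_succ_iff_lt_or_eq.1 hk with h | rfl
      · exact h1 k h
      · exact h2
    · exact fun h => ⟨fun k hk => h k (hk.trans (Nat.lt_succ_self n)), h n (Nat.lt_succ_self n)⟩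

theorem exists_hole {n : ℕ} {p : ℝ × ℝ} (h : holes n p ≤ 0) :
    ∃ k < n, max |p.1 - (2 * k + 1)| |p.2| - 1 / 2 ≤ 0 := by
  by_contra! h'
  have : 0 < holes n p := by
    clear h
    induction n with
    | zero => simp [holes]
    | succ n ih =>
      exact lt_min (ih fun k hk => h' k (hk.trans (Nat.lt_succ_self n))) (h' n (Nat.lt_succ_self n))
  linarith

theorem one_le_abs_sub {x : ℝ} {j k : ℕ} (hjk : j ≠ k) (hx : |x - (2 * k + 1)| < 1) :
    1 ≤ |x - (2 * j + 1)| := by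
  have h1 : (1 : ℝ) ≤ |(j : ℝ) - k| := by
    have : (1 : ℤ) ≤ |(j : ℤ) - k| := Int.one_le_abs (sub_ne_zero.2 (by exact_mod_cast hjk))
    exact_mod_cast this
  have h3 : |2 * ((j : ℝ) - k)| ≤ |x - (2 * j + 1)| + |x - (2 * k + 1)| := by
    have : 2 * ((j : ℝ) - k) = -(x - (2 * j + 1)) + (x - (2 * k + 1)) := by ring
    rw [this]
    refine (abs_add_le _ _).trans ?_
    rw [abs_neg]
  rw [abs_mul, abs_two] at h3
  linarith

/-- The centres of the holes have distance at least two, so all other terms are at least `1 / 2`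
here, while this one is smaller. -/
theorem holes_eq {n k : ℕ} (hk : k < n) {p : ℝ × ℝ} (h1 : |p.1 - (2 * k + 1)| < 1)
    (h2 : |p.2| < 1) : holes n p = max |p.1 - (2 * k + 1)| |p.2| - 1 / 2 := by
  have h3 : max |p.1 - (2 * k + 1)| |p.2| < 1 := max_lt h1 h2
  refine le_antisymm ?_ ?_
  · by_contra! h
    have h4 : min 1 (holes n p) ≤ holes n p := min_le_right _ _
    have := (le_holes_iff (min_le_left _ _)).1 h4 k hk
    have h5 : max |p.1 - (2 * k + 1)| |p.2| - 1 / 2 < min 1 (holes n p) := lt_min (by linarith) h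
    linarith
  · refine (le_holes_iff (by linarith)).2 fun j hj => ?_
    by_cases hjk : j = k
    · rw [hjk]
    · have := one_le_abs_sub hjk h1
      have h6 := le_max_left |p.1 - (2 * j + 1)| |p.2|
      linarith

theorem height_eq_two {n : ℕ} {x : ℝ} (h0 : 0 ≤ x) (h1 : x ≤ 2 * n) : height n x = 2 := by
  unfold height
  rw [min_eq_left]
  exact le_min (by linarith) (by linarith)

theorem height_le_two (n : ℕ) (x : ℝ) : height n x ≤ 2 := min_le_left _ _

theorem hole_bounds {n k : ℕ} (hk : k < n) {p : ℝ × ℝ}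
    (h : max |p.1 - (2 * k + 1)| |p.2| - 1 / 2 ≤ 0) :
    0 ≤ p.1 ∧ p.1 ≤ 2 * n ∧ |p.1 - (2 * k + 1)| < 1 ∧ |p.2| < 1 := by
  have h1 : |p.1 - (2 * k + 1)| ≤ 1 / 2 := (le_max_left _ |p.2|).trans (by linarith)
  have h2 : |p.2| ≤ 1 / 2 := (le_max_right |p.1 - (2 * k + 1)| _).trans (by linarith)
  have h3 : (k : ℝ) + 1 ≤ n := by exact_mod_cast hk
  have h4 : (0 : ℝ) ≤ k := by positivity
  have h5 := abs_le.1 h1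
  refine ⟨by linarith [h5.1], by linarith [h5.2], by linarith, by linarith⟩

theorem mem_hex_iff {n : ℕ} {p : ℝ × ℝ} :
    0 ≤ hexRho n p ↔ |p.2| ≤ height n p.1 ∧
      ∀ k < n, 0 ≤ max |p.1 - (2 * k + 1)| |p.2| - 1 / 2 := by
  rw [hexRho, le_min_iff, sub_nonneg, le_holes_iff zero_le_one]

theorem bounds_of_height_nonneg {n : ℕ} {x : ℝ} (h : 0 ≤ height n x) :
    -1 ≤ x ∧ x ≤ 2 * n + 1 := by
  have h1 : height n x ≤ 2 * (1 + x) := (min_le_right _ _).trans (min_le_left _ _)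
  have h2 : height n x ≤ 2 * (2 * n + 1 - x) := (min_le_right _ _).trans (min_le_right _ _)
  constructor <;> linarith

theorem height_nonneg {n : ℕ} {x : ℝ} (h1 : -1 ≤ x) (h2 : x ≤ 2 * n + 1) : 0 ≤ height n x :=
  le_min (by norm_num) (le_min (by linarith) (by linarith))

/-- All holes lie in this half plane, so the twist occurs only along the left side of the outer
boundary. -/
theorem hexTwist_of_nonneg {p : ℝ × ℝ} (h : 0 ≤ p.1) : hexTwist p = 1 := by
  unfold hexTwist
  rw [min_eq_right h, add_zero, mul_one, Real.cos_pi, Real.sin_pi]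
  apply Complex.ext
  · simp
  · simp

/-- With `r = |y| / 2` the real part is `-cos (π r)`. The imaginary part is `2 * y` cut off at `±
sin (π r)`, and the cut-off is reached because `sin (π r) ≤ π r ≤ 2 |y|`. From `y = -2` to `y = 2`
the angle runs from `2 π` to `0`: one full turn. -/
theorem hexTwist_left {y : ℝ} (hy : |y| ≤ 2) :
    hexTwist (|y| / 2 - 1, y) = Circle.exp (Real.pi - Real.pi * y / 2) := by
  have hpi := Real.pi_pos
  have h0 := abs_nonneg y
  have hs : 0 ≤ Real.sin (Real.pi * (|y| / 2)) :=
    Real.sin_nonneg_of_nonneg_of_le_pi (by positivity) (by nlinarith)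
  have hs2 : Real.sin (Real.pi * (|y| / 2)) ≤ 2 * |y| := by
    refine (Real.sin_le (by positivity)).trans ?_
    nlinarith [Real.pi_le_four]
  have hr : 1 + min (|y| / 2 - 1) 0 = |y| / 2 := by
    rw [min_eq_left (by linarith)]
    ring
  unfold hexTwist
  rw [Circle.coe_exp]
  simp only [hr]
  apply Complex.ext
  · rw [Complex.exp_ofReal_mul_I_re, Real.cos_pi_sub]
    simp only
    rcases abs_choice y with h | h <;> rw [h]
    · ring_nf
    · rw [← Real.cos_neg]
      ring_nf
  · rw [Complex.exp_ofReal_mul_I_im, Real.sin_pi_sub]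
    simp only
    rcases le_total 0 y with h | h
    · rw [abs_of_nonneg h] at hs hs2 ⊢
      rw [min_eq_left hs2, max_eq_right (by linarith)]
      ring_nf
    · rw [abs_of_nonpos h] at hs hs2 ⊢
      rw [min_eq_right (by linarith), max_eq_left (by linarith), ← Real.sin_neg]
      ring_nf

/-- The holes stay away from the outer boundary, so near a boundary point only one of the defining
functions matters. -/
theorem hexRho_boundary {n : ℕ} {p : ℝ × ℝ} (h : hexRho n p = 0) :
    (|p.2| = height n p.1 ∧ 0 < holes n p) ∨
      (0 < height n p.1 - |p.2| ∧ ∃ k < n, |p.1 - (2 * k + 1)| < 1 ∧ |p.2| < 1 ∧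
        max |p.1 - (2 * k + 1)| |p.2| - 1 / 2 = 0) := by
  have h1 : 0 ≤ height n p.1 - |p.2| := h ▸ min_le_left _ _
  have h2 : 0 ≤ holes n p := h ▸ min_le_right _ _
  rcases h2.lt_or_eq with h3 | h3
  · left
    refine ⟨?_, h3⟩
    rcases min_choice (height n p.1 - |p.2|) (holes n p) with h4 | h4
    · rw [hexRho, h4] at h
      linarith
    · rw [hexRho, h4] at h
      linarith
  · right
    obtain ⟨k, hk, hkp⟩ := exists_hole h3.ge
    obtain ⟨h4, h5, h6, h7⟩ := hole_bounds hk hkp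
    rw [height_eq_two h4 h5]
    refine ⟨by linarith, k, hk, h6, h7, ?_⟩
    rw [← holes_eq hk h6 h7, ← h3]

theorem hexRho_left {n : ℕ} {y : ℝ} (hy : |y| ≤ 2) : hexRho n (|y| / 2 - 1, y) = 0 := by
  have h0 := abs_nonneg y
  have hn : (0 : ℝ) ≤ n := by positivity
  have h1 : height n (|y| / 2 - 1) = |y| := by
    unfold height
    rw [min_eq_left (a := 2 * (1 + (|y| / 2 - 1))) (by linarith), min_eq_right (by linarith)]
    ring
  rw [hexRho]
  simp only [h1, sub_self]
  refine min_eq_left ((le_holes_iff zero_le_one).2 fun k hk => ?_)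
  have hk' : (0 : ℝ) ≤ k := by positivity
  have : 1 ≤ |(|y| / 2 - 1) - (2 * k + 1)| := by
    rw [abs_of_nonpos (by linarith)]
    linarith
  have := le_max_left |(|y| / 2 - 1) - (2 * k + 1)| |y|
  simp only
  linarith

theorem hexRho_graph {n : ℕ} {x y : ℝ} (hy : |y| = height n x) :
    hexRho n (x, y) = 0 := by
  rw [hexRho]
  simp only [hy, sub_self]
  refine min_eq_left ((le_holes_iff zero_le_one).2 fun k hk => ?_)
  have hk0 : (0 : ℝ) ≤ k := by positivity
  have hk' : (k : ℝ) + 1 ≤ n := by exact_mod_cast hk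
  simp only [hy]
  have h5 := le_max_left |x - (2 * k + 1)| (height n x)
  have h6 := le_max_right |x - (2 * k + 1)| (height n x)
  rcases le_total x 0 with hx | hx
  · rw [abs_of_nonpos (by linarith)] at h5 ⊢
    linarith
  rcases le_total (2 * (n : ℝ)) x with hx' | hx'
  · rw [abs_of_nonneg (by linarith)] at h5 ⊢
    linarith
  · have := height_eq_two hx hx'
    linarith

theorem norm_hexTwist {n : ℕ} {p : ℝ × ℝ} (h : hexRho n p = 0) : ‖hexTwist p‖ = 1 := by
  rcases le_total 0 p.1 with h0 | h0
  · rw [hexTwist_of_nonneg h0, norm_one]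
  rcases hexRho_boundary h with ⟨h1, -⟩ | ⟨-, k, hk, h2, -⟩
  · have hn : (0 : ℝ) ≤ n := by positivity
    have h3 : height n p.1 = 2 * (1 + p.1) := by
      unfold height
      rw [min_eq_left (a := 2 * (1 + p.1)) (by linarith), min_eq_right (by linarith)]
    have h4 : p = (|p.2| / 2 - 1, p.2) := Prod.ext (by rw [h1, h3]; ring) rfl
    rw [h4, hexTwist_left (h1.le.trans (height_le_two _ _)), Circle.norm_coe]
  · have hk' : (0 : ℝ) ≤ k := by positivity
    have := (abs_lt.1 h2).1
    linarith

/-! ### Local flatness of the boundary. -/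

/-- The homeomorphism of the plane that straightens the graph of a function. -/
def shear (g : ℝ → ℝ) (hg : Continuous g) : ℝ × ℝ ≃ₜ ℝ × ℝ where
  toFun p := (g p.1 - p.2, p.1)
  invFun q := (q.2, g q.2 - q.1)
  left_inv p := by simp
  right_inv q := by simp
  continuous_toFun := by fun_prop
  continuous_invFun := by fun_prop

/-- The homeomorphism of the plane that straightens the boundary of a quadrant. -/
def straightenQuadrant : ℝ × ℝ ≃ₜ ℝ × ℝ where
  toFun p := (max p.1 p.2 - 1 / 2, p.1 - p.2)
  invFun q := (q.1 + 1 / 2 + min q.2 0, q.1 + 1 / 2 - max q.2 0)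
  left_inv p := by
    rcases le_total p.1 p.2 with h | h
    · apply Prod.ext <;> simp [h]
    · apply Prod.ext <;> simp [h]
  right_inv q := by
    rcases le_total q.2 0 with h | h
    · apply Prod.ext <;> simp [h]
    · apply Prod.ext <;> simp [h]
  continuous_toFun := by fun_prop
  continuous_invFun := by fun_prop

/-- After sign changes of the coordinates `p` lies in the half plane `x + y > 0`, where `max |x| |y|
= max x y`. -/
theorem exists_straightening_square {p : ℝ × ℝ} (hp : max |p.1| |p.2| - 1 / 2 = 0) :
    ∃ H : ℝ × ℝ ≃ₜ ℝ × ℝ, ∀ᶠ q in 𝓝 p, max |q.1| |q.2| - 1 / 2 = (H q).1 := by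
  have key : ∀ q : ℝ × ℝ, 0 < q.1 + q.2 → max |q.1| |q.2| = max q.1 q.2 := by
    intro q hq
    refine le_antisymm (max_le (abs_le.2 ⟨?_, le_max_left _ _⟩) (abs_le.2 ⟨?_, le_max_right _ _⟩))
      (max_le_max (le_abs_self _) (le_abs_self _))
    · linarith [le_max_right q.1 q.2]
    · linarith [le_max_left q.1 q.2]
  let N : ℝ ≃ₜ ℝ := Homeomorph.neg ℝ
  rcases lt_trichotomy (p.1 + p.2) 0 with h | h | h
  · refine ⟨(N.prodCongr N).trans straightenQuadrant, ?_⟩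
    have : ∀ᶠ q : ℝ × ℝ in 𝓝 p, q.1 + q.2 < 0 :=
      (isOpen_lt (by fun_prop) continuous_const).mem_nhds h
    filter_upwards [this] with q hq
    have := key (-q) (by simp only [Prod.fst_neg, Prod.snd_neg]; linarith)
    simp only [Prod.fst_neg, Prod.snd_neg, abs_neg] at this
    rw [this]
    rfl
  · have hp1 : p.2 = -p.1 := by linarith
    have hp2 : p.1 ≠ 0 := by
      intro h0
      rw [hp1, h0] at hp
      norm_num at hp
    rcases lt_or_gt_of_ne hp2 with h3 | h3
    · refine ⟨(N.prodCongr (Homeomorph.refl ℝ)).trans straightenQuadrant, ?_⟩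
      have : ∀ᶠ q : ℝ × ℝ in 𝓝 p, 0 < -q.1 + q.2 :=
        (isOpen_lt continuous_const (by fun_prop)).mem_nhds (by
          change 0 < -p.1 + p.2
          linarith)
      filter_upwards [this] with q hq
      have := key (-q.1, q.2) hq
      simp only [abs_neg] at this
      rw [this]
      rfl
    · refine ⟨((Homeomorph.refl ℝ).prodCongr N).trans straightenQuadrant, ?_⟩
      have : ∀ᶠ q : ℝ × ℝ in 𝓝 p, 0 < q.1 + -q.2 :=
        (isOpen_lt continuous_const (by fun_prop)).mem_nhds (by
          change 0 < p.1 + -p.2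
          linarith)
      filter_upwards [this] with q hq
      have := key (q.1, -q.2) hq
      simp only [abs_neg] at this
      rw [this]
      rfl
  · refine ⟨straightenQuadrant, ?_⟩
    have : ∀ᶠ q : ℝ × ℝ in 𝓝 p, 0 < q.1 + q.2 :=
      (isOpen_lt continuous_const (by fun_prop)).mem_nhds h
    filter_upwards [this] with q hq
    rw [key q hq]
    rfl

/-- The homeomorphism of the plane that straightens the tip of the hexagon. -/
def straightenTip (c : ℝ) : ℝ × ℝ ≃ₜ ℝ × ℝ where
  toFun p := (2 * (p.1 - c) - |p.2|, p.2)
  invFun q := ((q.1 + |q.2|) / 2 + c, q.2)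
  left_inv p := Prod.ext (by simp) rfl
  right_inv q := Prod.ext (by simp only; ring) rfl
  continuous_toFun := by fun_prop
  continuous_invFun := by fun_prop

/-- Off the axis the boundary is the graph of `± height`. On the axis `p` is one of the two tips. -/
theorem exists_straightening_hexagon {n : ℕ} {p : ℝ × ℝ} (hp : |p.2| = height n p.1) :
    ∃ H : ℝ × ℝ ≃ₜ ℝ × ℝ, ∀ᶠ q in 𝓝 p, height n q.1 - |q.2| = (H q).1 := by
  have hn : (0 : ℝ) ≤ n := by positivity
  let N : ℝ ≃ₜ ℝ := Homeomorph.neg ℝ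
  rcases lt_trichotomy p.2 0 with h | h | h
  · refine ⟨((Homeomorph.refl ℝ).prodCongr N).trans (shear (height n) (continuous_height n)), ?_⟩
    have : ∀ᶠ q : ℝ × ℝ in 𝓝 p, q.2 < 0 :=
      (isOpen_lt (by fun_prop) continuous_const).mem_nhds h
    filter_upwards [this] with q hq
    rw [abs_of_neg hq]
    rfl
  · rw [h, abs_zero] at hp
    have hx : p.1 < 0 ∨ 2 * (n : ℝ) < p.1 := by
      by_contra! h1
      rw [height_eq_two h1.1 h1.2] at hp
      norm_num at hp
    rcases hx with h1 | h1
    · refine ⟨straightenTip (-1), ?_⟩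
      have : ∀ᶠ q : ℝ × ℝ in 𝓝 p, q.1 < 0 :=
        (isOpen_lt (by fun_prop) continuous_const).mem_nhds h1
      filter_upwards [this] with q hq
      change _ = 2 * (q.1 - -1) - |q.2|
      rw [height, min_eq_left (a := 2 * (1 + q.1)) (by linarith), min_eq_right (by linarith)]
      ring
    · refine ⟨(N.prodCongr (Homeomorph.refl ℝ)).trans (straightenTip (-(2 * n + 1))), ?_⟩
      have : ∀ᶠ q : ℝ × ℝ in 𝓝 p, 2 * (n : ℝ) < q.1 :=
        (isOpen_lt continuous_const (by fun_prop)).mem_nhds h1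
      filter_upwards [this] with q hq
      change _ = 2 * (-q.1 - -(2 * n + 1)) - |q.2|
      rw [height, min_eq_right (b := 2 * (2 * n + 1 - q.1)) (by linarith),
        min_eq_right (by linarith)]
      ring
  · refine ⟨shear (height n) (continuous_height n), ?_⟩
    have : ∀ᶠ q : ℝ × ℝ in 𝓝 p, 0 < q.2 :=
      (isOpen_lt continuous_const (by fun_prop)).mem_nhds h
    filter_upwards [this] with q hq
    rw [abs_of_pos hq]
    rfl

theorem hexRho_flat {n : ℕ} {p : ℝ × ℝ} (h : hexRho n p = 0) :
    ∃ H : ℝ × ℝ ≃ₜ ℝ × ℝ, ∀ᶠ q in 𝓝 p, hexRho n q = (H q).1 := by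
  have c1 : Continuous fun q : ℝ × ℝ => height n q.1 - |q.2| := by
    have := continuous_height n
    fun_prop
  have c2 := continuous_holes n
  rcases hexRho_boundary h with ⟨h1, h2⟩ | ⟨h1, k, hk, h2, h3, h4⟩
  · obtain ⟨H, hH⟩ := exists_straightening_hexagon h1
    refine ⟨H, ?_⟩
    have : ∀ᶠ q in 𝓝 p, height n q.1 - |q.2| < holes n q := by
      refine (isOpen_lt c1 c2).mem_nhds ?_
      change height n p.1 - |p.2| < holes n p
      rwa [h1, sub_self]
    filter_upwards [hH, this] with q hq hq'
    rw [hexRho, min_eq_left hq'.le, hq]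
  · let T : ℝ × ℝ ≃ₜ ℝ × ℝ := (Homeomorph.addRight (-(2 * k + 1 : ℝ))).prodCongr (Homeomorph.refl ℝ)
    have hT : ∀ q, T q = (q.1 - (2 * k + 1), q.2) := fun q => Prod.ext (by simp [T]; ring) rfl
    have h4' : max |(T p).1| |(T p).2| - 1 / 2 = 0 := by rw [hT]; exact h4
    obtain ⟨H, hH⟩ := exists_straightening_square h4'
    refine ⟨T.trans H, ?_⟩
    have e1 : ∀ᶠ q in 𝓝 p, holes n q < height n q.1 - |q.2| := by
      refine (isOpen_lt c2 c1).mem_nhds ?_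
      change holes n p < height n p.1 - |p.2|
      rwa [holes_eq hk h2 h3, h4]
    have e2 : ∀ᶠ q : ℝ × ℝ in 𝓝 p, |q.1 - (2 * k + 1)| < 1 :=
      (isOpen_lt (by fun_prop) continuous_const).mem_nhds h2
    have e3 : ∀ᶠ q : ℝ × ℝ in 𝓝 p, |q.2| < 1 :=
      (isOpen_lt (by fun_prop) continuous_const).mem_nhds h3
    filter_upwards [T.continuous.continuousAt.eventually hH, e1, e2, e3] with q hq g1 g2 g3
    rw [hexRho, min_eq_right g1.le, holes_eq hk g2 g3]
    rw [hT] at hq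
    rw [hq, ← hT]
    rfl

theorem isCompact_hexRho (n : ℕ) : IsCompact {p | 0 ≤ hexRho n p} := by
  refine (isCompact_Icc (a := ((-1 : ℝ), (-2 : ℝ))) (b := ((2 * n + 1 : ℝ), (2 : ℝ)))).of_isClosed_subset
    (isClosed_le continuous_const (continuous_hexRho n)) fun p hp => ?_
  obtain ⟨h1, -⟩ := mem_hex_iff.1 hp
  obtain ⟨h2, h3⟩ := bounds_of_height_nonneg ((abs_nonneg _).trans h1)
  obtain ⟨h4, h5⟩ := abs_le.1 (h1.trans (height_le_two _ _))
  exact ⟨⟨h2, h4⟩, h3, h5⟩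

/-- Moving vertically away from the axis increases `|y|` and so never enters a hole. Once the outer
boundary is reached, it is followed to the left tip. -/
theorem joinedIn_tip {n : ℕ} {p : ℝ × ℝ} (hp : 0 ≤ hexRho n p) :
    JoinedIn {p | 0 ≤ hexRho n p} p (-1, 0) := by
  have hc := continuous_height n
  obtain ⟨h1, h2⟩ := mem_hex_iff.1 hp
  obtain ⟨h3, h4⟩ := bounds_of_height_nonneg ((abs_nonneg _).trans h1)
  obtain ⟨s, hs, hsp⟩ : ∃ s : ℝ, |s| = 1 ∧ p.2 = s * |p.2| := by
    rcases le_total 0 p.2 with h | h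
    · exact ⟨1, abs_one, by rw [abs_of_nonneg h, one_mul]⟩
    · exact ⟨-1, by simp, by rw [abs_of_nonpos h]; ring⟩
  have j1 : JoinedIn {p | 0 ≤ hexRho n p} p (p.1, s * height n p.1) := by
    refine JoinedIn.ofLine (f := fun t => (p.1, s * (|p.2| + t * (height n p.1 - |p.2|))))
      (by fun_prop) (Prod.ext rfl ?_) (Prod.ext rfl ?_) ?_
    · simp only [zero_mul, add_zero, ← hsp]
    · simp only [one_mul, add_sub_cancel]
    · rintro _ ⟨t, ⟨ht0, ht1⟩, rfl⟩
      have h5 : 0 ≤ t * (height n p.1 - |p.2|) := mul_nonneg ht0 (sub_nonneg.2 h1)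
      have h6 : t * (height n p.1 - |p.2|) ≤ height n p.1 - |p.2| := by
        nlinarith [sub_nonneg.2 h1]
      have h7 : |s * (|p.2| + t * (height n p.1 - |p.2|))| =
          |p.2| + t * (height n p.1 - |p.2|) := by
        rw [abs_mul, hs, one_mul, abs_of_nonneg (by positivity)]
      refine mem_hex_iff.2 ⟨?_, fun k hk => ?_⟩
      · rw [h7]
        linarith
      · simp only [h7]
        have := h2 k hk
        have h8 := max_le_max (le_refl |p.1 - (2 * k + 1)|)
          (show |p.2| ≤ |p.2| + t * (height n p.1 - |p.2|) by linarith)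
        linarith
  have h0 : height n (-1) = 0 := by
    have hn : (0 : ℝ) ≤ n := by positivity
    unfold height
    rw [min_eq_left (a := 2 * (1 + (-1 : ℝ))) (by linarith), min_eq_right (by linarith)]
    norm_num
  refine j1.trans ?_
  refine JoinedIn.ofLine (f := fun t => (p.1 + t * (-1 - p.1), s * height n (p.1 + t * (-1 - p.1))))
    (by fun_prop) (by simp) (by simp [h0]) ?_
  rintro _ ⟨t, ⟨ht0, ht1⟩, rfl⟩
  refine (hexRho_graph ?_).ge
  rw [abs_mul, hs, one_mul, abs_of_nonneg]
  exact height_nonneg (by nlinarith) (by nlinarith)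

/-- The hexagon with `n` square holes as a twisted domain. -/
def hexagon (n : ℕ) : TwistedDomain where
  rho := hexRho n
  twist := hexTwist
  continuous_rho := continuous_hexRho n
  continuous_twist := continuous_hexTwist
  norm_twist _ := norm_hexTwist
  flat _ := hexRho_flat
  isCompact := isCompact_hexRho n
  isPathConnected := by
    have h : hexRho n (-1, 0) = 0 := by
      have := hexRho_left (n := n) (y := 0) (by simp)
      simpa using this
    exact ⟨(-1, 0), h.ge, fun {_} hp => (joinedIn_tip hp).symm⟩
  exists_boundary := ⟨_, hexRho_left (y := 0) (by simp)⟩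

/-- An extension could be filled in by the constant `1` over the holes, hence extended to the plane
and lifted to a real angle `θ`. But `twist` makes a full turn along the outer boundary. -/
theorem not_exists_extension (n : ℕ) : ¬ ∃ g : ℝ × ℝ → Circle, ContinuousOn g (hexagon n).domain ∧
    ∀ p, hexRho n p = 0 → (g p : ℂ) = hexTwist p := by
  rintro ⟨g, hg, hgt⟩
  have hn : (0 : ℝ) ≤ n := by positivity
  have hc := continuous_height n
  classical
  -- fill in the holes
  let g₁ : ℝ × ℝ → Circle := fun p => if holes n p ≤ 0 then 1 else g p
  have hg₁ : ∀ p, 0 ≤ hexRho n p → g₁ p = g p := by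
    intro p hp
    by_cases h : holes n p ≤ 0
    · have h1 : hexRho n p = 0 := le_antisymm ((min_le_right _ _).trans h) hp
      obtain ⟨k, hk, hkp⟩ := exists_hole h
      have h2 := hgt p h1
      rw [hexTwist_of_nonneg (hole_bounds hk hkp).1] at h2
      simp only [g₁, h, if_true]
      exact (Circle.ext h2).symm
    · simp only [g₁, h, if_false]
  have hg₁c : ContinuousOn g₁ ({p | 0 ≤ hexRho n p} ∪ {p | holes n p ≤ 0}) := by
    refine ContinuousOn.union_of_isClosed (hg.congr hg₁) ?_
      (isClosed_le continuous_const (continuous_hexRho n))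
      (isClosed_le (continuous_holes n) continuous_const)
    exact (continuousOn_const (c := (1 : Circle))).congr fun p hp => if_pos hp
  -- extend to the plane
  let cx : ℝ → ℝ := fun x => max (-1) (min (2 * n + 1) x)
  have hcx0 : ∀ x, 0 ≤ height n (cx x) := fun x =>
    height_nonneg (le_max_left _ _) (max_le (by linarith) (min_le_left _ _))
  let r : ℝ × ℝ → ℝ × ℝ := fun p =>
    (cx p.1, max (-height n (cx p.1)) (min (height n (cx p.1)) p.2))
  have hr : Continuous r := by fun_prop
  have hrm : ∀ p, r p ∈ {p | 0 ≤ hexRho n p} ∪ {p | holes n p ≤ 0} := by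
    intro p
    by_cases h : holes n (r p) ≤ 0
    · exact Or.inr h
    · refine Or.inl (le_min (sub_nonneg.2 (abs_le.2 ⟨le_max_left _ _, ?_⟩)) (le_of_not_ge h))
      exact max_le (by linarith [hcx0 p.1]) (min_le_left _ _)
  have hrid : ∀ p : ℝ × ℝ, |p.2| ≤ height n p.1 → r p = p := by
    intro p hp
    obtain ⟨h1, h2⟩ := bounds_of_height_nonneg ((abs_nonneg _).trans hp)
    have h3 : cx p.1 = p.1 := by
      simp only [cx]
      rw [min_eq_right h2, max_eq_right h1]
    have h4 := abs_le.1 hp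
    refine Prod.ext h3 ?_
    simp only [r, h3]
    rw [min_eq_right h4.2, max_eq_right h4.1]
  let G : C(ℝ × ℝ, Circle) := ⟨g₁ ∘ r, hg₁c.comp_continuous hr hrm⟩
  have hG : ∀ p, hexRho n p = 0 → (G p : ℂ) = hexTwist p := by
    intro p hp
    have h1 := (mem_hex_iff.1 hp.ge).1
    change (g₁ (r p) : ℂ) = _
    rw [hrid p h1, hg₁ p hp.ge, hgt p hp]
  obtain ⟨a, ha⟩ := Circle.exp_surjective (G 0)
  obtain ⟨θ, ⟨-, hθ⟩, -⟩ := Circle.isCoveringMap_exp.existsUnique_continuousMap_lifts G 0 a ha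
  have hθ' : ∀ p, hexRho n p = 0 → (Circle.exp (θ p) : ℂ) = hexTwist p := fun p hp => by
    rw [← hG p hp]
    exact congrArg (fun w : Circle => (w : ℂ)) (congrFun hθ p)
  -- On the upper and the lower side right of `x = 0` the twist is `1`, so `θ` is constant up to the
  -- right tip.
  have side : ∀ s : ℝ, |s| = 1 → θ (0, s * 2) = θ (2 * n + 1, 0) := by
    intro s hs
    have hx : ∀ x ∈ Set.Icc (0 : ℝ) (2 * n + 1), Circle.exp (θ (x, s * height n x)) = 1 := by
      intro x hx
      refine Circle.ext ?_
      rw [hθ', hexTwist_of_nonneg hx.1, Circle.coe_one]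
      refine hexRho_graph ?_
      rw [abs_mul, hs, one_mul, abs_of_nonneg (height_nonneg (by linarith [hx.1]) hx.2)]
    have := Circle.isCoveringMap_exp.constOn_of_comp
      (isPreconnected_Icc (a := (0 : ℝ)) (b := 2 * n + 1))
      (g := fun x => θ (x, s * height n x)) (by fun_prop)
      (fun x h1 x' h2 => by rw [hx x h1, hx x' h2])
      (Set.left_mem_Icc.2 (by positivity)) (Set.right_mem_Icc.2 (by positivity))
    simp only [height_eq_two le_rfl (mul_nonneg zero_le_two hn)] at this
    rw [this]
    congr 2
    have : height n (2 * n + 1) = 0 := by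
      unfold height
      rw [min_eq_right (b := 2 * (2 * (n : ℝ) + 1 - (2 * n + 1))) (by linarith),
        min_eq_right (by linarith)]
      ring
    rw [this, mul_zero]
  -- On the left side `θ` differs from the explicit angle by a constant, so its values at the ends
  -- differ by `2 π`.
  have left : θ (0, 2) - (Real.pi - Real.pi * 2 / 2) =
      θ (0, -2) - (Real.pi - Real.pi * (-2) / 2) := by
    have hx : ∀ y ∈ Set.Icc (-2 : ℝ) 2,
        Circle.exp (θ (|y| / 2 - 1, y) - (Real.pi - Real.pi * y / 2)) = 1 := by
      intro y hy
      have hy' : |y| ≤ 2 := abs_le.2 hy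
      rw [Circle.exp_sub, div_eq_one]
      refine Circle.ext ?_
      rw [hθ' _ (hexRho_left hy'), hexTwist_left hy']
    have := Circle.isCoveringMap_exp.constOn_of_comp
      (isPreconnected_Icc (a := (-2 : ℝ)) (b := 2))
      (g := fun y => θ (|y| / 2 - 1, y) - (Real.pi - Real.pi * y / 2)) (by fun_prop)
      (fun x h1 x' h2 => by rw [hx x h1, hx x' h2])
      (Set.right_mem_Icc.2 (by norm_num)) (Set.left_mem_Icc.2 (by norm_num))
    simp only [abs_neg, abs_two] at this
    rw [div_self two_ne_zero, sub_self] at this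
    exact this
  have s1 := side 1 abs_one
  have s2 := side (-1) (by simp)
  rw [one_mul] at s1
  rw [neg_one_mul] at s2
  rw [s1, s2] at left
  linarith [Real.pi_pos]


/-! ### The ball as a quotient of a triangle times the circle -/

theorem re_sq_add_im_sq (w : Circle) : (w : ℂ).re ^ 2 + (w : ℂ).im ^ 2 = 1 := by
  have h := Circle.normSq_coe w
  rw [Complex.normSq_apply] at h
  linarith

/-- The confocal ellipses in the unit disc. -/
def ellipse (σ : ℝ) (w : Circle) : ℂ := ⟨Real.sqrt ((1 + σ ^ 2) / 2) * (w : ℂ).re, σ * (w : ℂ).im⟩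

theorem continuous_ellipse : Continuous fun q : ℝ × Circle => ellipse q.1 q.2 := by
  have : (fun q : ℝ × Circle => ellipse q.1 q.2) = fun q : ℝ × Circle =>
      ((Real.sqrt ((1 + q.1 ^ 2) / 2) * (q.2 : ℂ).re : ℝ) : ℂ) +
        ((q.1 * (q.2 : ℂ).im : ℝ) : ℂ) * Complex.I :=
    funext fun q => Complex.mk_eq_add_mul_I _ _
  rw [this]
  fun_prop

theorem ellipse_one (w : Circle) : ellipse 1 w = w := by
  apply Complex.ext <;> simp [ellipse]

theorem ellipse_neg (σ : ℝ) (w : Circle) : ellipse σ (-w) = -ellipse σ w := by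
  have h : ((-w : Circle) : ℂ) = -(w : ℂ) := rfl
  apply Complex.ext <;> simp [ellipse, h]

/-- The last factor is at least `1 / 2`, so the ellipse is inside the open disc exactly for `σ < 1`.
-/
theorem norm_sq_ellipse (σ : ℝ) (w : Circle) :
    ‖ellipse σ w‖ ^ 2 = 1 - (1 - σ ^ 2) * (1 - (w : ℂ).re ^ 2 / 2) := by
  have h1 := re_sq_add_im_sq w
  have h2 := Real.sq_sqrt (show 0 ≤ (1 + σ ^ 2) / 2 by positivity)
  rw [← Complex.normSq_eq_norm_sq, Complex.normSq_apply, ellipse]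
  linear_combination (w : ℂ).re ^ 2 * h2 + σ ^ 2 * h1

theorem re_sq_le_one (w : Circle) : (w : ℂ).re ^ 2 ≤ 1 := by
  nlinarith [re_sq_add_im_sq w, sq_nonneg (w : ℂ).im]

theorem norm_ellipse_le_one {σ : ℝ} (h0 : 0 ≤ σ) (h1 : σ ≤ 1) (w : Circle) :
    ‖ellipse σ w‖ ≤ 1 := by
  have h2 := norm_sq_ellipse σ w
  have h3 := re_sq_le_one w
  have h4 : 0 ≤ (1 - σ ^ 2) * (1 - (w : ℂ).re ^ 2 / 2) :=
    mul_nonneg (by nlinarith) (by linarith)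
  exact (sq_le_one_iff₀ (norm_nonneg _)).1 (by linarith)

theorem norm_ellipse_lt_one_iff {σ : ℝ} (h0 : 0 ≤ σ) (w : Circle) :
    ‖ellipse σ w‖ < 1 ↔ σ < 1 := by
  have h2 := norm_sq_ellipse σ w
  have h3 := re_sq_le_one w
  rw [← sq_lt_one_iff₀ (norm_nonneg _), h2, sub_lt_self_iff, mul_pos_iff_of_pos_right (by linarith),
    sub_pos, sq_lt_one_iff₀ h0]

/-- Both semi-axes grow with `σ`, so the ellipses are nested. Only the one for `σ = 0` degenerates,
to a segment covered twice by conjugate points of the circle. -/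
theorem ellipse_eq_iff {σ σ' : ℝ} (h0 : 0 ≤ σ) (h0' : 0 ≤ σ') {w w' : Circle} :
    ellipse σ w = ellipse σ' w' ↔ σ = σ' ∧ (w = w' ∨ σ = 0 ∧ w * w' = 1) := by
  constructor
  · intro h
    have hre : Real.sqrt ((1 + σ ^ 2) / 2) * (w : ℂ).re =
      Real.sqrt ((1 + σ' ^ 2) / 2) * (w' : ℂ).re := congrArg Complex.re h
    have him : σ * (w : ℂ).im = σ' * (w' : ℂ).im := congrArg Complex.im h
    have h1 := re_sq_add_im_sq w
    have h1' := re_sq_add_im_sq w'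
    have h2 := Real.sq_sqrt (show 0 ≤ (1 + σ ^ 2) / 2 by positivity)
    have h2' := Real.sq_sqrt (show 0 ≤ (1 + σ' ^ 2) / 2 by positivity)
    have e1 : (1 + σ ^ 2) * (w : ℂ).re ^ 2 = (1 + σ' ^ 2) * (w' : ℂ).re ^ 2 := by
      have := congrArg (· ^ 2) hre
      simp only [mul_pow, h2, h2'] at this
      linarith
    have e2 : σ ^ 2 * (w : ℂ).im ^ 2 = σ' ^ 2 * (w' : ℂ).im ^ 2 := by
      have := congrArg (· ^ 2) him
      simpa only [mul_pow] using this
    have key : ∀ {s s' X X' Y Y' : ℝ}, 0 ≤ s → 0 ≤ Y → X + Y = 1 → X' + Y' = 1 →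
        (1 + s) * X = (1 + s') * X' → s * Y = s' * Y' → ¬ s < s' := by
      intro s s' X X' Y Y' hs hY hX hX' g1 g2 hlt
      -- The sum of the two equations reads `s + X = s' + X'`.
      have g3 : Y' - Y = s' - s := by linear_combination g1 + g2 - (s + 1) * hX + (s' + 1) * hX'
      have : s * Y < s' * Y' := by
        have : Y < Y' := by linarith
        calc s * Y ≤ s' * Y := mul_le_mul_of_nonneg_right hlt.le hY
          _ < s' * Y' := mul_lt_mul_of_pos_left this (hs.trans_lt hlt)
      linarith
    have hσ : σ = σ' := by
      have k1 := key (sq_nonneg σ) (sq_nonneg (w : ℂ).im) h1 h1' e1 e2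
      have k2 := key (sq_nonneg σ') (sq_nonneg (w' : ℂ).im) h1' h1 e1.symm e2.symm
      have : σ ^ 2 = σ' ^ 2 := le_antisymm (not_lt.1 k2) (not_lt.1 k1)
      exact (pow_left_inj₀ h0 h0' two_ne_zero).1 this
    subst hσ
    refine ⟨rfl, ?_⟩
    have hp : 0 < Real.sqrt ((1 + σ ^ 2) / 2) := Real.sqrt_pos.2 (by positivity)
    have hX := mul_left_cancel₀ hp.ne' hre
    rcases h0.eq_or_lt with h | h
    · have : (w : ℂ).im ^ 2 = (w' : ℂ).im ^ 2 := by rw [hX] at h1; linarith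
      rcases sq_eq_sq_iff_eq_or_eq_neg.1 this with h3 | h3
      · exact Or.inl (Circle.ext (Complex.ext hX h3))
      · refine Or.inr ⟨h.symm, ?_⟩
        have : w = w'⁻¹ := Circle.ext (by
          rw [Circle.coe_inv_eq_conj]
          exact Complex.ext (by simpa using hX) (by simpa using h3))
        rw [this, inv_mul_cancel]
    · exact Or.inl (Circle.ext (Complex.ext hX (mul_left_cancel₀ h.ne' him)))
  · rintro ⟨rfl, rfl | ⟨rfl, h⟩⟩
    · rfl
    · have : w = w'⁻¹ := eq_inv_of_mul_eq_one_left h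
      rw [this]
      apply Complex.ext <;> simp [ellipse]

theorem exists_circle {a b : ℝ} (h : a ^ 2 + b ^ 2 = 1) : ∃ w : Circle, (w : ℂ) = ⟨a, b⟩ := by
  refine ⟨⟨⟨a, b⟩, ?_⟩, rfl⟩
  change (⟨a, b⟩ : ℂ) ∈ Metric.sphere (0 : ℂ) 1
  rw [mem_sphere_zero_iff_norm, ← pow_eq_one_iff_of_nonneg (norm_nonneg _) two_ne_zero,
    ← Complex.normSq_eq_norm_sq, Complex.normSq_apply]
  linarith

/-- The equation of the ellipse through `z`, cleared of denominators, is solved for `σ` by the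
intermediate value theorem on `[0, 1]`. On the real axis it has the spurious root `σ = 0`, so this
case is done by hand. -/
theorem exists_ellipse {z : ℂ} (hz : ‖z‖ ≤ 1) :
    ∃ σ w, 0 ≤ σ ∧ σ ≤ 1 ∧ ellipse σ w = z := by
  have hz2 : z.re ^ 2 + z.im ^ 2 ≤ 1 := by
    have := Complex.normSq_eq_norm_sq z
    rw [Complex.normSq_apply] at this
    nlinarith [norm_nonneg z]
  have pos : ∀ σ, 0 < σ → σ ≤ 1 →
      2 * z.re ^ 2 * σ ^ 2 + z.im ^ 2 * (1 + σ ^ 2) = σ ^ 2 * (1 + σ ^ 2) →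
      ∃ σ w, 0 ≤ σ ∧ σ ≤ 1 ∧ ellipse σ w = z := by
    intro σ h0 h1 h
    have hp : 0 < Real.sqrt ((1 + σ ^ 2) / 2) := Real.sqrt_pos.2 (by positivity)
    have h2 := Real.sq_sqrt (show 0 ≤ (1 + σ ^ 2) / 2 by positivity)
    obtain ⟨w, hw⟩ := exists_circle (a := z.re / Real.sqrt ((1 + σ ^ 2) / 2)) (b := z.im / σ) (by
      rw [div_pow, div_pow, h2]
      field_simp
      linear_combination h)
    refine ⟨σ, w, h0.le, h1, ?_⟩
    apply Complex.ext
    · simp only [ellipse, hw]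
      field_simp
    · simp only [ellipse, hw]
      field_simp
  by_cases hb : z.im = 0
  · by_cases ha : 2 * z.re ^ 2 ≤ 1
    · have h2 := Real.sq_sqrt (show (0 : ℝ) ≤ 1 / 2 by positivity)
      have hp : 0 < Real.sqrt (1 / 2) := Real.sqrt_pos.2 (by positivity)
      obtain ⟨w, hw⟩ := exists_circle (a := z.re / Real.sqrt (1 / 2))
        (b := Real.sqrt (1 - 2 * z.re ^ 2)) (by
          rw [div_pow, h2, Real.sq_sqrt (by linarith)]
          ring)
      refine ⟨0, w, le_rfl, zero_le_one, ?_⟩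
      apply Complex.ext
      · simp only [ellipse, hw]
        rw [zero_pow two_ne_zero, add_zero]
        field_simp
      · simp [ellipse, hb]
    · have ha := not_le.1 ha
      have h2 := Real.sq_sqrt (show 0 ≤ 2 * z.re ^ 2 - 1 by linarith)
      refine pos (Real.sqrt (2 * z.re ^ 2 - 1)) (Real.sqrt_pos.2 (by linarith)) ?_ ?_
      · rw [hb] at hz2
        exact Real.sqrt_le_one.2 (by linarith)
      · rw [h2, hb]
        ring
  · have hc : ContinuousOn (fun σ : ℝ => 2 * z.re ^ 2 * σ ^ 2 + z.im ^ 2 * (1 + σ ^ 2) -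
        σ ^ 2 * (1 + σ ^ 2)) (Set.Icc 0 1) := by fun_prop
    obtain ⟨σ, ⟨h0, h1⟩, h⟩ := intermediate_value_Icc' zero_le_one hc
      (show (0 : ℝ) ∈ _ from ⟨by norm_num; linarith, by norm_num; positivity⟩)
    simp only at h
    refine pos σ (lt_of_le_of_ne h0 ?_) h1 (by linarith)
    rintro rfl
    norm_num at h
    exact hb h

/-! ### The triangle `|y| ≤ 2 r` bent to a half square, and the model ball. -/

/-- The coordinates in the half square of a point of the triangle. -/
def triσ (r y : ℝ) : ℝ := min r (2 * r - |y|)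

/-- The coordinates in the half square of a point of the triangle. -/
def triτ (r y : ℝ) : ℝ := max (-r) (min r y)

theorem triσ_nonneg {r y : ℝ} (hy : |y| ≤ 2 * r) : 0 ≤ triσ r y :=
  le_min (by linarith [abs_nonneg y]) (by linarith)

theorem triσ_le (r y : ℝ) : triσ r y ≤ r := min_le_left _ _

theorem abs_triτ_le {r y : ℝ} (hr : 0 ≤ r) : |triτ r y| ≤ r :=
  abs_le.2 ⟨le_max_left _ _, max_le (by linarith) (min_le_left _ _)⟩

/-- The segment of the triangle at `r` is bent to three sides of a rectangle. So `r = 1` goes to the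
three sides `σ = 1`, `τ = ±1`, and the slanted sides `|y| = 2 r` go to `σ = 0`, where the ellipses
fold the circle. -/
theorem tri_cases {r y : ℝ} (hr : 0 ≤ r) :
    (|y| ≤ r ∧ triσ r y = r ∧ triτ r y = y) ∨
    (r < y ∧ triσ r y = 2 * r - y ∧ triτ r y = r) ∨
    (y < -r ∧ triσ r y = 2 * r + y ∧ triτ r y = -r) := by
  unfold triσ triτ
  by_cases h : |y| ≤ r
  · left
    have := abs_le.1 h
    exact ⟨h, min_eq_left (by linarith), by rw [min_eq_right this.2, max_eq_right this.1]⟩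
  · right
    rcases lt_abs.1 (not_le.1 h) with h1 | h1
    · left
      rw [abs_of_pos (by linarith), min_eq_right (a := r) (by linarith), min_eq_left h1.le,
        max_eq_right (by linarith)]
      exact ⟨h1, rfl, rfl⟩
    · right
      rw [abs_of_neg (by linarith), min_eq_right (a := r) (by linarith), min_eq_right (by linarith),
        max_eq_left (by linarith)]
      exact ⟨by linarith, by ring, rfl⟩

theorem tri_injective {r y r' y' : ℝ} (hy : |y| ≤ 2 * r) (hy' : |y'| ≤ 2 * r')
    (hσ : triσ r y = triσ r' y')
    (hτ : triτ r y = triτ r' y') : r = r' ∧ y = y' := by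
  have hr : 0 ≤ r := by linarith [abs_nonneg y]
  have hr' : 0 ≤ r' := by linarith [abs_nonneg y']
  have hy := abs_le.1 hy
  have hy' := abs_le.1 hy'
  rcases tri_cases (y := y) hr with ⟨h1, h2, h3⟩ | ⟨h1, h2, h3⟩ | ⟨h1, h2, h3⟩ <;>
  rcases tri_cases (y := y') hr' with ⟨h1', h2', h3'⟩ | ⟨h1', h2', h3'⟩ | ⟨h1', h2', h3'⟩ <;>
  rw [h2, h2'] at hσ <;> rw [h3, h3'] at hτ <;>
  first
    | exact ⟨by linarith, by linarith⟩
    | (exfalso; have := abs_le.1 h1; linarith)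
    | (exfalso; have := abs_le.1 h1'; linarith)

theorem exists_tri {σ τ : ℝ} (hσ : 0 ≤ σ) (hσ1 : σ ≤ 1) (hτ : |τ| ≤ 1) :
    ∃ r y, 0 ≤ r ∧ r ≤ 1 ∧ |y| ≤ 2 * r ∧ triσ r y = σ ∧ triτ r y = τ := by
  unfold triσ triτ
  by_cases h : |τ| ≤ σ
  · have := abs_le.1 h
    exact ⟨σ, τ, hσ, hσ1, by linarith, min_eq_left (by linarith), by
      rw [min_eq_right this.2, max_eq_right this.1]⟩
  · have h := not_le.1 h
    rcases le_total 0 τ with h1 | h1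
    · rw [abs_of_nonneg h1] at h hτ
      refine ⟨τ, 2 * τ - σ, h1, hτ, ?_, ?_, ?_⟩
      · rw [abs_of_nonneg (by linarith)]
        linarith
      · rw [abs_of_nonneg (by linarith), min_eq_right (by linarith)]
        ring
      · rw [min_eq_left (by linarith), max_eq_right (by linarith)]
    · rw [abs_of_nonpos h1] at h hτ
      refine ⟨-τ, 2 * τ + σ, by linarith, hτ, ?_, ?_, ?_⟩
      · rw [abs_of_nonpos (by linarith)]
        linarith
      · rw [abs_of_nonpos (by linarith), min_eq_right (by linarith)]
        ring
      · rw [min_eq_right (by linarith), max_eq_left (by linarith), neg_neg]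

theorem triσ_eq_zero_iff {r y : ℝ} (hy : |y| ≤ 2 * r) : triσ r y = 0 ↔ |y| = 2 * r := by
  have := abs_nonneg y
  unfold triσ
  constructor
  · intro h
    rcases min_choice r (2 * r - |y|) with h1 | h1 <;> rw [h1] at h <;> linarith
  · intro h
    rw [min_eq_right (by linarith)]
    linarith

/-- The map of the triangle times the circle to the model ball. -/
def pill (r y : ℝ) (w : Circle) : ℂ × ℝ := (ellipse (triσ r y) w, triτ r y)

theorem continuous_pill : Continuous fun q : ℝ × ℝ × Circle => pill q.1 q.2.1 q.2.2 := by
  have h1 : Continuous fun q : ℝ × ℝ × Circle => (triσ q.1 q.2.1, q.2.2) := by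
    unfold triσ
    fun_prop
  have h2 : Continuous fun q : ℝ × ℝ × Circle => triτ q.1 q.2.1 := by
    unfold triτ
    fun_prop
  exact (continuous_ellipse.comp h1).prodMk h2

theorem pill_eq_iff {r y r' y' : ℝ} (hy : |y| ≤ 2 * r) (hy' : |y'| ≤ 2 * r') {w w' : Circle} :
    pill r y w = pill r' y' w' ↔ r = r' ∧ y = y' ∧ (w = w' ∨ |y| = 2 * r ∧ w * w' = 1) := by
  unfold pill
  rw [Prod.mk.injEq, ellipse_eq_iff (triσ_nonneg hy) (triσ_nonneg hy'), triσ_eq_zero_iff hy]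
  constructor
  · rintro ⟨⟨h1, h2⟩, h3⟩
    obtain ⟨h4, h5⟩ := tri_injective hy hy' h1 h3
    exact ⟨h4, h5, h2⟩
  · rintro ⟨rfl, rfl, h⟩
    exact ⟨⟨rfl, h⟩, rfl⟩

theorem norm_pill_le_one {r y : ℝ} (hr : r ≤ 1) (hy : |y| ≤ 2 * r) (w : Circle) :
    ‖pill r y w‖ ≤ 1 := by
  have hr0 : 0 ≤ r := by linarith [abs_nonneg y]
  rw [Prod.norm_def]
  refine max_le (norm_ellipse_le_one (triσ_nonneg hy) ((triσ_le r y).trans hr) w) ?_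
  exact (abs_triτ_le hr0).trans hr

/-- The side `r = 1` times the circle becomes the boundary sphere. -/
theorem norm_pill_lt_one_iff {r y : ℝ} (hy : |y| ≤ 2 * r) (w : Circle) :
    ‖pill r y w‖ < 1 ↔ r < 1 := by
  have hr0 : 0 ≤ r := by linarith [abs_nonneg y]
  have h : ‖pill r y w‖ < 1 ↔ triσ r y < 1 ∧ |triτ r y| < 1 := by
    rw [Prod.norm_def, max_lt_iff, Real.norm_eq_abs]
    exact and_congr_left' (norm_ellipse_lt_one_iff (triσ_nonneg hy) w)
  rw [h]
  constructor
  · rintro ⟨h1, h2⟩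
    have h2 := abs_lt.1 h2
    rcases tri_cases (y := y) hr0 with ⟨-, h3, h4⟩ | ⟨-, h3, h4⟩ | ⟨-, h3, h4⟩ <;>
      rw [h4] at h2 <;> rw [h3] at h1 <;> linarith [h2.1, h2.2]
  · intro h1
    exact ⟨(triσ_le _ _).trans_lt h1, (abs_triτ_le hr0).trans_lt h1⟩

theorem exists_pill {b : ℂ × ℝ} (hb : ‖b‖ ≤ 1) :
    ∃ r y w, 0 ≤ r ∧ r ≤ 1 ∧ |y| ≤ 2 * r ∧ pill r y w = b := by
  obtain ⟨h1, h2⟩ := max_le_iff.1 (Prod.norm_def b ▸ hb)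
  obtain ⟨σ, w, h3, h4, h5⟩ := exists_ellipse h1
  obtain ⟨r, y, h6, h7, h8, h9, h10⟩ := exists_tri h3 h4 (Real.norm_eq_abs _ ▸ h2)
  exact ⟨r, y, w, h6, h7, h8, Prod.ext (by rw [← h5, ← h9]; rfl) h10⟩

theorem norm_pill_one {y : ℝ} (hy : |y| ≤ 2) (w : Circle) : ‖pill 1 y w‖ = 1 := by
  refine le_antisymm (norm_pill_le_one le_rfl (by linarith) w) (not_lt.1 fun h => ?_)
  exact lt_irrefl _ ((norm_pill_lt_one_iff (by linarith) w).1 h)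


/-! ### The three-sphere as a quotient of a hexagon times the circle -/

/-- The radial projection to the three-sphere. -/
def radialS3 (v : ℂ × ℂ) : S3 :=
  if h : ‖v.1‖ ^ 2 + ‖v.2‖ ^ 2 = 0 then ⟨(1, 0), by simp⟩ else
    ⟨((Real.sqrt (‖v.1‖ ^ 2 + ‖v.2‖ ^ 2))⁻¹ : ℝ) • v, by
      have h1 : 0 ≤ ‖v.1‖ ^ 2 + ‖v.2‖ ^ 2 := by positivity
      simp only [Prod.smul_fst, Prod.smul_snd, norm_smul, norm_inv, Real.norm_eq_abs, mul_pow,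
        inv_pow, sq_abs, Real.sq_sqrt h1]
      field_simp⟩

theorem norm_sq_add_norm_sq_ne_zero {v : ℂ × ℂ} (hv : v ≠ 0) : ‖v.1‖ ^ 2 + ‖v.2‖ ^ 2 ≠ 0 := by
  contrapose! hv
  have h1 := sq_nonneg ‖v.1‖
  have h2 := sq_nonneg ‖v.2‖
  refine Prod.ext (norm_eq_zero.1 (sq_eq_zero_iff.1 ?_)) (norm_eq_zero.1 (sq_eq_zero_iff.1 ?_)) <;>
    linarith

theorem coe_radialS3 {v : ℂ × ℂ} (hv : v ≠ 0) :
    (radialS3 v : ℂ × ℂ) = ((Real.sqrt (‖v.1‖ ^ 2 + ‖v.2‖ ^ 2))⁻¹ : ℝ) • v := by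
  rw [radialS3, dif_neg (norm_sq_add_norm_sq_ne_zero hv)]

theorem radialS3_factor_pos {v : ℂ × ℂ} (hv : v ≠ 0) :
    0 < (Real.sqrt (‖v.1‖ ^ 2 + ‖v.2‖ ^ 2))⁻¹ :=
  inv_pos.2 (Real.sqrt_pos.2 (lt_of_le_of_ne (by positivity) (norm_sq_add_norm_sq_ne_zero hv).symm))

theorem radialS3_coe (q : S3) : radialS3 q = q := by
  have h : (q : ℂ × ℂ) ≠ 0 := by
    intro h
    have := q.2
    rw [h] at this
    simp at this
  apply Subtype.ext
  rw [coe_radialS3 h, q.2, Real.sqrt_one, inv_one, one_smul]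

theorem radialS3_smul {r : ℝ} (hr : 0 < r) {v : ℂ × ℂ} (hv : v ≠ 0) :
    radialS3 (r • v) = radialS3 v := by
  apply Subtype.ext
  rw [coe_radialS3 hv, coe_radialS3 (smul_ne_zero hr.ne' hv)]
  simp only [Prod.smul_fst, Prod.smul_snd, norm_smul, Real.norm_eq_abs, mul_pow, sq_abs]
  rw [← mul_add, Real.sqrt_mul (sq_nonneg r), Real.sqrt_sq hr.le, smul_smul, mul_inv, mul_right_comm,
    inv_mul_cancel₀ hr.ne', one_mul]

theorem exists_smul_of_radialS3_eq {v v' : ℂ × ℂ} (hv : v ≠ 0) (hv' : v' ≠ 0)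
    (h : radialS3 v = radialS3 v') :
    ∃ r : ℝ, 0 < r ∧ v'.1 = r • v.1 ∧ v'.2.re = r * v.2.re ∧ v'.2.im = r * v.2.im := by
  have h1 := radialS3_factor_pos hv
  have h2 := radialS3_factor_pos hv'
  have h3 := congrArg Subtype.val h
  rw [coe_radialS3 hv, coe_radialS3 hv'] at h3
  have h4 : v' = ((Real.sqrt (‖v'.1‖ ^ 2 + ‖v'.2‖ ^ 2))⁻¹⁻¹ *
      (Real.sqrt (‖v.1‖ ^ 2 + ‖v.2‖ ^ 2))⁻¹ : ℝ) • v := by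
    rw [mul_smul, h3, smul_smul, inv_mul_cancel₀ h2.ne', one_smul]
  exact ⟨_, mul_pos (inv_pos.2 h2) h1, congrArg Prod.fst h4,
    (congrArg (fun v : ℂ × ℂ => v.2.re) h4).trans (Complex.smul_re _ _),
    (congrArg (fun v : ℂ × ℂ => v.2.im) h4).trans (Complex.smul_im _ _)⟩

theorem continuousAt_radialS3 {v : ℂ × ℂ} (hv : v ≠ 0) : ContinuousAt radialS3 v := by
  rw [IsEmbedding.subtypeVal.isInducing.continuousAt_iff]
  have h : (fun v : ℂ × ℂ => ((Real.sqrt (‖v.1‖ ^ 2 + ‖v.2‖ ^ 2))⁻¹ : ℝ) • v) =ᶠ[𝓝 v]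
      Subtype.val ∘ radialS3 := by
    filter_upwards [isOpen_ne.mem_nhds hv] with y hy
    exact (coe_radialS3 hy).symm
  refine ContinuousAt.congr ?_ h
  have h1 : Continuous fun v : ℂ × ℂ => Real.sqrt (‖v.1‖ ^ 2 + ‖v.2‖ ^ 2) := by fun_prop
  exact (h1.continuousAt.inv₀ (inv_pos.1 (radialS3_factor_pos hv)).ne').smul continuousAt_id

/-- The coordinate change relating the half-angle description of the ball in the three-sphere to
the central projection. -/
def widen (p : ℂ × ℝ) : ℂ := Real.sqrt (1 + p.2 ^ 2) * p.1

/-- A homogeneous gauge on `ℂ × ℝ`. -/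
def gauge (a : ℂ) (t : ℝ) : ℝ := Real.sqrt (max (t ^ 2) (‖a‖ ^ 2 - t ^ 2))

theorem gauge_nonneg (a : ℂ) (t : ℝ) : 0 ≤ gauge a t := Real.sqrt_nonneg _

theorem gauge_smul {r : ℝ} (hr : 0 ≤ r) (a : ℂ) (t : ℝ) : gauge (r • a) (r * t) = r * gauge a t := by
  unfold gauge
  rw [norm_smul, mul_pow, mul_pow, Real.norm_eq_abs, sq_abs, ← mul_sub,
    ← mul_max_of_nonneg _ _ (sq_nonneg r), Real.sqrt_mul (sq_nonneg r), Real.sqrt_sq hr]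

theorem gauge_zero : gauge 0 0 = 0 := by simp [gauge]

theorem norm_widen_sq (p : ℂ × ℝ) : ‖widen p‖ ^ 2 = (1 + p.2 ^ 2) * ‖p.1‖ ^ 2 := by
  rw [widen, norm_mul, mul_pow, Complex.norm_real, Real.norm_eq_abs, sq_abs,
    Real.sq_sqrt (by positivity)]

theorem gauge_le_iff {c : ℝ} (hc : 0 ≤ c) (a : ℂ) (t : ℝ) :
    gauge a t ≤ c ↔ |t| ≤ c ∧ ‖a‖ ^ 2 ≤ c ^ 2 + t ^ 2 := by
  rw [gauge, Real.sqrt_le_left hc, max_le_iff, sq_le_sq, abs_of_nonneg hc, sub_le_iff_le_add]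

/-- After `widen`, the condition `|z| ≤ 1` becomes `|a|² ≤ 1 + t²`. The gauge is the positively
homogeneous function with this unit ball. -/
theorem norm_le_one_iff_gauge (p : ℂ × ℝ) : ‖p‖ ≤ 1 ↔ gauge (widen p) p.2 ≤ 1 := by
  rw [gauge_le_iff zero_le_one, norm_widen_sq, Prod.norm_def, max_le_iff, and_comm, Real.norm_eq_abs,
    one_pow, mul_le_iff_le_one_right (by positivity), sq_le_one_iff₀ (norm_nonneg _)]

theorem norm_lt_one_iff_gauge (p : ℂ × ℝ) : ‖p‖ < 1 ↔ gauge (widen p) p.2 < 1 := by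
  rw [gauge, Real.sqrt_lt' one_pos, one_pow, max_lt_iff, sub_lt_iff_lt_add, norm_widen_sq,
    Prod.norm_def, max_lt_iff, and_comm, Real.norm_eq_abs, sq_lt_one_iff_abs_lt_one,
    mul_lt_iff_lt_one_right (by positivity), sq_lt_one_iff₀ (norm_nonneg _)]

theorem widen_injective {p p' : ℂ × ℝ} (h1 : widen p = widen p') (h2 : p.2 = p'.2) : p = p' := by
  refine Prod.ext ?_ h2
  unfold widen at h1
  rw [h2] at h1
  refine mul_left_cancel₀ ?_ h1
  have : 0 < Real.sqrt (1 + p'.2 ^ 2) := Real.sqrt_pos.2 (by positivity)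
  exact_mod_cast this.ne'

/-- As `e^{i arctan t} = (1 + i t) / √(1 + t²)`, the ball is the central projection of the affine
space `Re b = 1`. -/
theorem discS3_eq (p : ℂ × ℝ) : discS3 p = radialS3 (widen p, ⟨1, p.2⟩) := by
  have hpos : 0 < Real.sqrt (1 + p.2 ^ 2) := Real.sqrt_pos.2 (by positivity)
  have h1 : (Circle.exp (Real.arctan p.2) : ℂ) =
      ((Real.sqrt (1 + p.2 ^ 2))⁻¹ : ℝ) • (⟨1, p.2⟩ : ℂ) := by
    rw [Circle.coe_exp]
    apply Complex.ext
    · rw [Complex.exp_ofReal_mul_I_re, Real.cos_arctan]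
      simp
    · rw [Complex.exp_ofReal_mul_I_im, Real.sin_arctan, Complex.smul_im, smul_eq_mul]
      simp only
      ring
  have h2 : (p.1, (Circle.exp (Real.arctan p.2) : ℂ)) =
      ((Real.sqrt (1 + p.2 ^ 2))⁻¹ : ℝ) • ((widen p, ⟨1, p.2⟩) : ℂ × ℂ) := by
    refine Prod.ext ?_ h1
    rw [Prod.smul_fst, widen, Complex.real_smul]
    push_cast
    rw [inv_mul_cancel_left₀]
    exact_mod_cast hpos.ne'
  have h3 : ((widen p, ⟨1, p.2⟩) : ℂ × ℂ) ≠ 0 := fun h => by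
    have := congrArg (fun v : ℂ × ℂ => v.2.re) h
    simp at this
  rw [← radialS3_smul (inv_pos.2 hpos) h3, ← h2]
  apply Subtype.ext
  rw [coe_radialS3]
  · simp only [Circle.norm_coe, one_pow, discS3]
    rw [add_comm (‖p.1‖ ^ 2)]
    refine Prod.ext ?_ ?_ <;>
    · simp only [Prod.smul_mk, Complex.real_smul]
      push_cast
      rw [div_eq_inv_mul]
  · intro h
    exact Circle.coe_ne_zero _ (congrArg Prod.snd h)

/-- The ball in the three-sphere complementary to the one given by `discS3`. -/
def codiscS3 (p : ℂ × ℝ) : S3 := radialS3 (widen p, ⟨2 * gauge (widen p) p.2 - 1, p.2⟩)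

theorem discS3_ne_zero (p : ℂ × ℝ) : ((widen p, ⟨1, p.2⟩) : ℂ × ℂ) ≠ 0 := fun h => by
  have := congrArg (fun v : ℂ × ℂ => v.2.re) h
  simp at this

theorem codiscS3_ne_zero (p : ℂ × ℝ) :
    ((widen p, ⟨2 * gauge (widen p) p.2 - 1, p.2⟩) : ℂ × ℂ) ≠ 0 := fun h => by
  have h1 : widen p = 0 := congrArg Prod.fst h
  have h2 : p.2 = 0 := congrArg (fun v : ℂ × ℂ => v.2.im) h
  have h3 := congrArg (fun v : ℂ × ℂ => v.2.re) h
  simp only [h1, h2, gauge_zero] at h3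
  norm_num at h3

theorem discS3_injective : Function.Injective discS3 := by
  intro p p' h
  rw [discS3_eq, discS3_eq] at h
  obtain ⟨r, -, h1, h3, h2⟩ := exists_smul_of_radialS3_eq (discS3_ne_zero _) (discS3_ne_zero _) h
  simp only at h1 h2 h3
  rw [mul_one] at h3
  rw [← h3, one_smul] at h1
  rw [← h3, one_mul] at h2
  exact (widen_injective h1 h2).symm

theorem codiscS3_injective : Function.Injective codiscS3 := by
  intro p p' h
  obtain ⟨r, hr0, h1, h3, h2⟩ := exists_smul_of_radialS3_eq (codiscS3_ne_zero _) (codiscS3_ne_zero _) h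
  simp only at h1 h2 h3
  rw [h1, h2, gauge_smul hr0.le] at h3
  have h4 : r = 1 := by linarith
  rw [h4, one_smul] at h1
  rw [h4, one_mul] at h2
  exact (widen_injective h1 h2).symm

/-- On rays `(a, b)` the two balls are given by `gauge a (Im b) ≤ Re b` and the reverse inequality,
so they meet only where the gauge equals `Re b`. -/
theorem eq_of_discS3_eq_codiscS3 {p p' : ℂ × ℝ} (hp : ‖p‖ ≤ 1) (hp' : ‖p'‖ ≤ 1)
    (h : discS3 p = codiscS3 p') : p = p' ∧ ¬ ‖p‖ < 1 := by
  rw [discS3_eq] at h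
  obtain ⟨r, hr0, h1, h3, h2⟩ := exists_smul_of_radialS3_eq (codiscS3_ne_zero _) (discS3_ne_zero _) h.symm
  simp only at h1 h2 h3
  have h4 : gauge (widen p) p.2 = r * gauge (widen p') p'.2 := by rw [h1, h2, gauge_smul hr0.le]
  have h5 := (norm_le_one_iff_gauge p).1 hp
  have h6 := (norm_le_one_iff_gauge p').1 hp'
  have h7 : r = 1 := by
    refine le_antisymm (by linarith) ?_
    nlinarith
  rw [h7, one_smul] at h1
  rw [h7, one_mul] at h2
  refine ⟨widen_injective h1 h2, fun h8 => ?_⟩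
  have := (norm_lt_one_iff_gauge p).1 h8
  rw [h7, one_mul] at h3 h4
  linarith

theorem discS3_eq_codiscS3 {p : ℂ × ℝ} (hp : ‖p‖ = 1) : discS3 p = codiscS3 p := by
  have h1 : gauge (widen p) p.2 = 1 := le_antisymm ((norm_le_one_iff_gauge p).1 hp.le)
    (not_lt.1 fun h => ((norm_lt_one_iff_gauge p).2 h).ne hp)
  rw [discS3_eq, codiscS3, h1]
  norm_num

theorem widen_div {a : ℂ} {t : ℝ} : widen (a / Real.sqrt (1 + t ^ 2), t) = a := by
  have : 0 < Real.sqrt (1 + t ^ 2) := Real.sqrt_pos.2 (by positivity)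
  exact mul_div_cancel₀ _ (by exact_mod_cast this.ne')

theorem exists_discS3_or_codiscS3 (q : S3) :
    ∃ p : ℂ × ℝ, ‖p‖ ≤ 1 ∧ (discS3 p = q ∨ codiscS3 p = q) := by
  obtain ⟨⟨a, b⟩, hq⟩ := q
  have hne : ((a, b) : ℂ × ℂ) ≠ 0 := fun h => by
    rw [h] at hq
    simp at hq
  have h0 := gauge_nonneg a b.im
  have key : ∀ r : ℝ, 0 < r → r * gauge a b.im ≤ 1 → ‖(((r • a) / Real.sqrt (1 + (r * b.im) ^ 2) : ℂ),
      r * b.im)‖ ≤ 1 := by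
    intro r hr h
    rwa [norm_le_one_iff_gauge, widen_div, gauge_smul hr.le]
  by_cases h : gauge a b.im ≤ b.re
  · have hre : 0 < b.re := by
      refine lt_of_le_of_ne (h0.trans h) fun h1 => hne ?_
      obtain ⟨h2, h3⟩ := (gauge_le_iff (h0.trans h) _ _).1 h
      rw [← h1] at h2 h3
      have h4 : b.im = 0 := abs_nonpos_iff.1 h2
      rw [h4] at h3
      have h5 : ‖a‖ ^ 2 = 0 := le_antisymm (by simpa using h3) (sq_nonneg _)
      exact Prod.ext (norm_eq_zero.1 (sq_eq_zero_iff.1 h5)) (Complex.ext h1.symm h4)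
    refine ⟨_, key _ (inv_pos.2 hre) ?_, Or.inl ?_⟩
    · rw [inv_mul_le_iff₀ hre, mul_one]
      exact h
    · rw [discS3_eq, widen_div]
      refine Eq.trans ?_ (radialS3_coe ⟨(a, b), hq⟩)
      rw [← radialS3_smul (inv_pos.2 hre) hne]
      congr 1
      refine Prod.ext rfl (Complex.ext ?_ ?_)
      · simp [hre.ne']
      · simp
  · have h := not_le.1 h
    -- The image of `codiscS3` satisfies `2 * gauge - Re b = 1` before projection; this is the
    -- factor that rescales the ray.
    have h1 : 0 < 2 * gauge a b.im - b.re := by linarith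
    refine ⟨_, key _ (inv_pos.2 h1) ?_, Or.inr ?_⟩
    · rw [inv_mul_le_iff₀ h1]
      linarith
    · rw [codiscS3, widen_div, gauge_smul (inv_pos.2 h1).le]
      refine Eq.trans ?_ (radialS3_coe ⟨(a, b), hq⟩)
      rw [← radialS3_smul (inv_pos.2 h1) hne]
      congr 1
      refine Prod.ext rfl (Complex.ext ?_ ?_)
      · simp only [Prod.smul_mk, Complex.smul_re, smul_eq_mul]
        field_simp
        ring
      · exact (Complex.smul_im (2 * gauge a b.im - b.re)⁻¹ b).symm

theorem continuous_widen : Continuous widen := by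
  unfold widen
  fun_prop

theorem continuous_discS3 : Continuous discS3 := by
  have : discS3 = fun p => radialS3 (widen p, ⟨1, p.2⟩) := funext discS3_eq
  rw [this]
  refine continuous_iff_continuousAt.2 fun p =>
    ContinuousAt.comp (f := fun p : ℂ × ℝ => (widen p, (⟨1, p.2⟩ : ℂ)))
      (continuousAt_radialS3 (discS3_ne_zero p))
      (Continuous.continuousAt ?_)
  have h : (fun p : ℂ × ℝ => (⟨1, p.2⟩ : ℂ)) = fun p => ((1 : ℝ) : ℂ) + p.2 * Complex.I :=
    funext fun p => Complex.mk_eq_add_mul_I _ _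
  refine continuous_widen.prodMk ?_
  rw [h]
  fun_prop

theorem continuous_codiscS3 : Continuous codiscS3 := by
  refine continuous_iff_continuousAt.2 fun p =>
    ContinuousAt.comp (f := fun p : ℂ × ℝ => (widen p, (⟨2 * gauge (widen p) p.2 - 1, p.2⟩ : ℂ)))
      (continuousAt_radialS3 (codiscS3_ne_zero p))
      (Continuous.continuousAt ?_)
  have h : (fun p : ℂ × ℝ => (⟨2 * gauge (widen p) p.2 - 1, p.2⟩ : ℂ)) =
      fun p => ((2 * gauge (widen p) p.2 - 1 : ℝ) : ℂ) + p.2 * Complex.I :=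
    funext fun p => Complex.mk_eq_add_mul_I _ _
  have := continuous_widen
  refine continuous_widen.prodMk ?_
  rw [h]
  unfold gauge
  fun_prop

/-- The half of the twisting function along the left side of the hexagon. -/
def halfTwist (t : ℝ) : Circle := Circle.exp (Real.pi * (1 - t) / 2)

theorem continuous_halfTwist : Continuous halfTwist := by
  unfold halfTwist
  fun_prop

/-- The rotation of the slices of the model ball by half of the twisting function. -/
def rotate (p : ℂ × ℝ) : ℂ × ℝ := (halfTwist p.2 * p.1, p.2)

theorem norm_rotate (p : ℂ × ℝ) : ‖rotate p‖ = ‖p‖ := by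
  simp [rotate, Prod.norm_def, Circle.norm_coe]

theorem rotate_injective : Function.Injective rotate := by
  intro p p' h
  have h2 : p.2 = p'.2 := (Prod.mk.inj h).2
  have h1 : (halfTwist p.2 : ℂ) * p.1 = halfTwist p'.2 * p'.1 := (Prod.mk.inj h).1
  rw [h2] at h1
  exact Prod.ext (mul_left_cancel₀ (Circle.coe_ne_zero _) h1) h2

/-- The twisted map of the triangle times the circle to the model ball. -/
def twistedPill (r y : ℝ) (w : Circle) : ℂ × ℝ :=
  rotate (pill r y ((halfTwist (triτ r y))⁻¹ * w))

theorem continuous_twistedPill :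
    Continuous fun q : ℝ × ℝ × Circle => twistedPill q.1 q.2.1 q.2.2 := by
  have h1 := continuous_halfTwist
  have h2 : Continuous rotate := by
    unfold rotate
    fun_prop
  have h3 : Continuous fun q : ℝ × ℝ × Circle => triτ q.1 q.2.1 := by
    unfold triτ
    fun_prop
  exact h2.comp (continuous_pill.comp (f := fun q : ℝ × ℝ × Circle =>
    (q.1, q.2.1, (halfTwist (triτ q.1 q.2.1))⁻¹ * q.2.2)) (by fun_prop))

/-- On the slanted sides `τ = y / 2`, so the square root of the twist depends only on the height in
the model ball. -/
theorem halfTwist_sq {r y : ℝ} (hr : r ≤ 1) (hy : |y| = 2 * r) :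
    ((halfTwist (triτ r y) * halfTwist (triτ r y) : Circle) : ℂ) = hexTwist (r - 1, y) := by
  have h1 : triτ r y = y / 2 := by
    have hr : 0 ≤ r := by linarith [abs_nonneg y]
    unfold triτ
    rcases abs_choice y with h | h
    · rw [min_eq_left (by linarith), max_eq_right (by linarith)]
      linarith
    · rw [min_eq_right (by linarith), max_eq_left (by linarith)]
      linarith
  have h2 : r - 1 = |y| / 2 - 1 := by linarith
  rw [h2, hexTwist_left (by linarith), h1, halfTwist, ← Circle.exp_add]
  congr 2
  ring

/-- Dividing the fibre coordinate by a square root `μ` of the twist turns the folding `w * w' = μ²`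
into the untwisted one. -/
theorem twistedPill_eq_iff {r y r' y' : ℝ} (hr : r ≤ 1) (hy : |y| ≤ 2 * r) (hy' : |y'| ≤ 2 * r')
    {w w' : Circle} : twistedPill r y w = twistedPill r' y' w' ↔
      r = r' ∧ y = y' ∧ (w = w' ∨ |y| = 2 * r ∧ (w * w' : ℂ) = hexTwist (r - 1, y)) := by
  have h : ∀ μ w w' : Circle, μ⁻¹ * w * (μ⁻¹ * w') = 1 ↔ w * w' = μ * μ := by
    intro μ w w'
    have : μ⁻¹ * w * (μ⁻¹ * w') = (μ * μ)⁻¹ * (w * w') := by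
      rw [mul_inv]
      exact mul_mul_mul_comm _ _ _ _
    rw [this, inv_mul_eq_one, eq_comm]
  unfold twistedPill
  rw [rotate_injective.eq_iff, pill_eq_iff hy hy']
  constructor
  · rintro ⟨rfl, rfl, h1⟩
    refine ⟨rfl, rfl, h1.imp mul_left_cancel fun ⟨h2, h3⟩ => ⟨h2, ?_⟩⟩
    rw [← halfTwist_sq hr h2, ← Circle.coe_mul, (h _ _ _).1 h3]
  · rintro ⟨rfl, rfl, h1⟩
    refine ⟨rfl, rfl, h1.imp (congrArg _) fun ⟨h2, h3⟩ => ⟨h2, (h _ _ _).2 (Circle.ext ?_)⟩⟩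
    rw [halfTwist_sq hr h2, ← h3, Circle.coe_mul]

theorem exists_twistedPill {b : ℂ × ℝ} (hb : ‖b‖ ≤ 1) :
    ∃ r y w, 0 ≤ r ∧ r ≤ 1 ∧ |y| ≤ 2 * r ∧ twistedPill r y w = b := by
  obtain ⟨r, y, w, h1, h2, h3, h4⟩ := exists_pill (b := ((halfTwist b.2)⁻¹ * b.1, b.2)) (by
    simpa [Prod.norm_def, Circle.norm_coe] using hb)
  have h5 : triτ r y = b.2 := congrArg Prod.snd h4
  refine ⟨r, y, halfTwist (triτ r y) * w, h1, h2, h3, ?_⟩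
  rw [twistedPill, inv_mul_cancel_left, h4]
  refine Prod.ext ?_ rfl
  simp [rotate]

/-- On the boundary sphere the twist disappears: on the side `σ = 1` the ellipses are round, so
rotation and division cancel, and at the heights `±1` the rotation is by `±1`, a symmetry of every
ellipse. Hence the twisted ball can be glued like the untwisted one. -/
theorem twistedPill_one (y : ℝ) (w : Circle) : twistedPill 1 y w = pill 1 y w := by
  have hw : ∀ μ : Circle, (μ : ℂ) * (μ⁻¹ * w : Circle) = w := fun μ => by
    rw [← Circle.coe_mul, mul_inv_cancel_left]
  rcases tri_cases (r := 1) (y := y) zero_le_one with ⟨-, h2, h3⟩ | ⟨-, -, h3⟩ | ⟨-, -, h3⟩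
  · refine Prod.ext ?_ rfl
    simp only [twistedPill, pill, rotate, h2, ellipse_one, hw]
  · have : halfTwist 1 = 1 := by simp [halfTwist]
    simp [twistedPill, pill, rotate, h3, this]
  · have : halfTwist (-1) = -1 := by
      apply Circle.ext
      have h : Real.pi * (1 - -1) / 2 = Real.pi := by ring
      rw [halfTwist, h, Circle.coe_exp, Complex.exp_pi_mul_I]
      rfl
    have h4 : (-1 : Circle)⁻¹ * w = -w := by
      rw [inv_neg_one, neg_one_mul]
    have h5 : ((-1 : Circle) : ℂ) = -1 := rfl
    refine Prod.ext ?_ rfl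
    simp only [twistedPill, pill, rotate, h3, this, h4, ellipse_neg, h5]
    ring


/-! ### Assembling the three-sphere from two folded triangles. -/

theorem isClosed_of_isClosed_preimage {A X : Type} [TopologicalSpace A] [TopologicalSpace X]
    [T2Space X] {K : Set A} (hK : IsCompact K) {g : A → X} (hg : ContinuousOn g K) {S : Set X}
    (hS : S ⊆ g '' K) (h : IsClosed {a | a ∈ K ∧ g a ∈ S}) : IsClosed S := by
  have h1 : S = g '' {a | a ∈ K ∧ g a ∈ S} := by
    refine Set.Subset.antisymm (fun x hx => ?_) (Set.image_subset_iff.2 fun a ha => ha.2)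
    obtain ⟨a, ha, rfl⟩ := hS hx
    exact ⟨a, ⟨ha, hx⟩, rfl⟩
  rw [h1]
  exact ((hK.of_isClosed_subset h fun a ha => ha.1).image_of_continuousOn
    (hg.mono fun a ha => ha.1)).isClosed

theorem mem_hexZero_of_nonneg {p : ℝ × ℝ} (h : 0 ≤ p.1) :
    (p ∈ (hexagon 0).domain ↔ |p.2| ≤ 2 * (1 - p.1)) ∧
      ((hexagon 0).rho p = 0 ↔ |p.2| = 2 * (1 - p.1)) := by
  have h1 : height 0 p.1 = 2 * (1 - p.1) := by
    unfold height
    rw [min_eq_right (a := 2 * (1 + p.1)), min_eq_right] <;> norm_num <;> linarith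
  change (0 ≤ min (height 0 p.1 - |p.2|) 1 ↔ _) ∧ (min (height 0 p.1 - |p.2|) 1 = 0 ↔ _)
  rw [h1, le_min_iff, sub_nonneg, and_iff_left zero_le_one]
  refine ⟨Iff.rfl, fun h2 => ?_, fun h2 => ?_⟩
  · rcases min_choice (2 * (1 - p.1) - |p.2|) 1 with h3 | h3 <;> rw [h3] at h2 <;> linarith
  · rw [h2, sub_self]
    exact min_eq_left zero_le_one

theorem mem_hexZero_of_nonpos {p : ℝ × ℝ} (h : p.1 ≤ 0) :
    (p ∈ (hexagon 0).domain ↔ |p.2| ≤ 2 * (1 + p.1)) ∧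
      ((hexagon 0).rho p = 0 ↔ |p.2| = 2 * (1 + p.1)) := by
  have h1 : height 0 p.1 = 2 * (1 + p.1) := by
    unfold height
    rw [min_eq_left (a := 2 * (1 + p.1)), min_eq_right] <;> norm_num <;> linarith
  change (0 ≤ min (height 0 p.1 - |p.2|) 1 ↔ _) ∧ (min (height 0 p.1 - |p.2|) 1 = 0 ↔ _)
  rw [h1, le_min_iff, sub_nonneg, and_iff_left zero_le_one]
  refine ⟨Iff.rfl, fun h2 => ?_, fun h2 => ?_⟩
  · rcases min_choice (2 * (1 + p.1) - |p.2|) 1 with h3 | h3 <;> rw [h3] at h2 <;> linarith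
  · rw [h2, sub_self]
    exact min_eq_left zero_le_one

/-- The folding map of the three-sphere. -/
def foldZero (p : ℝ × ℝ) (w : Circle) : S3 :=
  if 0 ≤ p.1 then discS3 (pill (1 - p.1) p.2 w) else codiscS3 (twistedPill (1 + p.1) p.2 w)

theorem foldZero_of_nonneg {p : ℝ × ℝ} (h : 0 ≤ p.1) (w : Circle) :
    foldZero p w = discS3 (pill (1 - p.1) p.2 w) := if_pos h

theorem foldZero_of_neg {p : ℝ × ℝ} (h : p.1 < 0) (w : Circle) :
    foldZero p w = codiscS3 (twistedPill (1 + p.1) p.2 w) := if_neg h.not_ge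

theorem norm_twistedPill_lt_one {r y : ℝ} (hr : r < 1) (hy : |y| ≤ 2 * r) (w : Circle) :
    ‖twistedPill r y w‖ < 1 := by
  rw [twistedPill, norm_rotate]
  exact (norm_pill_lt_one_iff hy _).2 hr

/-- The two formulas agree on the seam `x = 0`, which corresponds to the common boundary sphere of
the two balls. -/
theorem foldZero_of_nonpos {p : ℝ × ℝ} (h : p.1 ≤ 0) (hp : p ∈ (hexagon 0).domain) (w : Circle) :
    foldZero p w = codiscS3 (twistedPill (1 + p.1) p.2 w) := by
  rcases h.lt_or_eq with h1 | h1
  · exact foldZero_of_neg h1 w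
  · have h2 := (mem_hexZero_of_nonpos h).1.1 hp
    rw [h1, add_zero, mul_one] at h2
    rw [foldZero_of_nonneg h1.ge, h1, sub_zero, add_zero, twistedPill_one]
    exact discS3_eq_codiscS3 (norm_pill_one h2 w)

theorem isCompact_domain_prod (D : TwistedDomain) : IsCompact (D.domain ×ˢ (Set.univ : Set Circle)) :=
  D.isCompact.prod isCompact_univ

theorem continuousOn_foldZero : ContinuousOn (fun q : (ℝ × ℝ) × Circle => foldZero q.1 q.2)
    ((hexagon 0).domain ×ˢ Set.univ) := by
  have h1 : Continuous fun q : (ℝ × ℝ) × Circle => discS3 (pill (1 - q.1.1) q.1.2 q.2) :=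
    continuous_discS3.comp (continuous_pill.comp
      (f := fun q : (ℝ × ℝ) × Circle => (1 - q.1.1, q.1.2, q.2)) (by fun_prop))
  have h2 : Continuous fun q : (ℝ × ℝ) × Circle => codiscS3 (twistedPill (1 + q.1.1) q.1.2 q.2) :=
    continuous_codiscS3.comp (continuous_twistedPill.comp
      (f := fun q : (ℝ × ℝ) × Circle => (1 + q.1.1, q.1.2, q.2)) (by fun_prop))
  have hc := (isCompact_domain_prod (hexagon 0)).isClosed
  have h3 : ((hexagon 0).domain ×ˢ (Set.univ : Set Circle)) =
      ((hexagon 0).domain ×ˢ Set.univ ∩ {q | 0 ≤ q.1.1}) ∪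
      ((hexagon 0).domain ×ˢ Set.univ ∩ {q | q.1.1 ≤ 0}) := by
    rw [← Set.inter_union_distrib_left]
    exact (Set.inter_eq_left.2 fun q _ => le_total 0 q.1.1).symm
  rw [h3]
  refine ContinuousOn.union_of_isClosed
    (h1.continuousOn.congr fun q hq => foldZero_of_nonneg hq.2 _)
    (h2.continuousOn.congr fun q hq => foldZero_of_nonpos hq.2 hq.1.1 _) ?_ ?_
  · exact hc.inter (isClosed_le continuous_const (by fun_prop))
  · exact hc.inter (isClosed_le (by fun_prop) continuous_const)

theorem foldZero_surjective (x : S3) : ∃ p ∈ (hexagon 0).domain, ∃ w, foldZero p w = x := by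
  obtain ⟨b, hb, h | h⟩ := exists_discS3_or_codiscS3 x
  · obtain ⟨r, y, w, h1, h2, h3, rfl⟩ := exists_pill hb
    have h4 : (0 : ℝ) ≤ (1 - r, y).1 := sub_nonneg.2 h2
    have h5 : 1 - (1 - r) = r := by ring
    refine ⟨(1 - r, y), (mem_hexZero_of_nonneg h4).1.2 (by simpa only [h5] using h3), w, ?_⟩
    rw [foldZero_of_nonneg h4, ← h, h5]
  · obtain ⟨r, y, w, h1, h2, h3, rfl⟩ := exists_twistedPill hb
    have h4 : (r - 1, y).1 ≤ (0 : ℝ) := sub_nonpos.2 h2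
    have h5 : 1 + (r - 1) = r := by ring
    have h6 := (mem_hexZero_of_nonpos h4).1.2 (by simpa only [h5] using h3)
    refine ⟨(r - 1, y), h6, w, ?_⟩
    rw [foldZero_of_nonpos h4 h6, ← h, h5]

theorem foldZero_isFolding : (hexagon 0).IsFolding foldZero where
  continuousOn := continuousOn_foldZero
  surjective := foldZero_surjective
  isClosed C h := by
    refine isClosed_of_isClosed_preimage (isCompact_domain_prod (hexagon 0)) continuousOn_foldZero
      (fun x _ => ?_) (by simpa only [Set.mem_prod, Set.mem_univ, and_true] using h)
    obtain ⟨p, hp, w, hw⟩ := foldZero_surjective x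
    exact ⟨(p, w), ⟨hp, Set.mem_univ _⟩, hw⟩
  eq_iff p hp p' hp' w w' := by
    -- For `p'.1 < 0` the image is in the interior of the complementary ball.
    have mixed : ∀ p ∈ (hexagon 0).domain, ∀ p' ∈ (hexagon 0).domain, ∀ w w', 0 ≤ p.1 → p'.1 < 0 →
        foldZero p w ≠ foldZero p' w' := by
      intro p hp p' hp' w w' h0 h0' h
      have h1 := (mem_hexZero_of_nonneg h0).1.1 hp
      have h1' := (mem_hexZero_of_nonpos h0'.le).1.1 hp'
      have h2' := norm_twistedPill_lt_one (by linarith) h1' w'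
      rw [foldZero_of_nonneg h0, foldZero_of_neg h0'] at h
      obtain ⟨h3, h4⟩ := eq_of_discS3_eq_codiscS3 (norm_pill_le_one (by linarith) h1 w) h2'.le h
      rw [h3] at h4
      exact h4 h2'
    rcases le_or_gt 0 p.1 with h0 | h0 <;> rcases le_or_gt 0 p'.1 with h0' | h0'
    · rw [foldZero_of_nonneg h0, foldZero_of_nonneg h0', discS3_injective.eq_iff,
        pill_eq_iff ((mem_hexZero_of_nonneg h0).1.1 hp) ((mem_hexZero_of_nonneg h0').1.1 hp'),
        sub_right_inj, ← and_assoc, ← Prod.ext_iff, (mem_hexZero_of_nonneg h0).2]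
      have : (hexagon 0).twist p = 1 := hexTwist_of_nonneg h0
      rw [this, ← Circle.coe_mul, ← Circle.coe_one, Circle.coe_inj]
    · refine iff_of_false (mixed p hp p' hp' w w' h0 h0') fun h => ?_
      rw [h.1] at h0
      linarith
    · refine iff_of_false (mixed p' hp' p hp w' w h0' h0).symm fun h => ?_
      rw [h.1] at h0
      linarith
    · have h1 := (mem_hexZero_of_nonpos h0.le).1.1 hp
      rw [foldZero_of_neg h0, foldZero_of_neg h0', codiscS3_injective.eq_iff,
        twistedPill_eq_iff (by linarith) h1 ((mem_hexZero_of_nonpos h0'.le).1.1 hp'),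
        add_right_inj, ← and_assoc, ← Prod.ext_iff, (mem_hexZero_of_nonpos h0.le).2,
        add_sub_cancel_left]
      rfl


/-! ### The two-sphere as a quotient of a cylinder -/

/-- The height of the boundary circle of the central projection of the unit disc. -/
def rimHeight : ℝ := 1 / Real.sqrt 2

theorem rimHeight_pos : 0 < rimHeight := one_div_pos.2 (Real.sqrt_pos.2 two_pos)

theorem rimHeight_sq : rimHeight ^ 2 = 1 / 2 := by
  rw [rimHeight, div_pow, Real.sq_sqrt zero_le_two, one_pow]

theorem rimHeight_lt_one : rimHeight < 1 := by
  nlinarith [rimHeight_sq, rimHeight_pos]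

/-- The height of the image of a point of the unit disc under `lowerCap`. -/
def lowerHeight (z : ℂ) : ℝ := (1 + rimHeight) * ‖z‖ ^ 2 - 1

theorem lowerHeight_le {z : ℂ} (hz : ‖z‖ ≤ 1) : lowerHeight z ≤ rimHeight := by
  have h1 := rimHeight_pos
  have h2 : ‖z‖ ^ 2 ≤ 1 := (sq_le_one_iff₀ (norm_nonneg z)).2 hz
  unfold lowerHeight
  nlinarith

theorem lowerCap_factor_pos {z : ℂ} (hz : ‖z‖ ≤ 1) : 0 < (1 - lowerHeight z) * (1 + rimHeight) :=
  mul_pos (by linarith [lowerHeight_le hz, rimHeight_lt_one]) (by linarith [rimHeight_pos])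

/-- The parametrization by the unit disc of the complement of the open cap of the two-sphere which
is the central projection of the unit disc. -/
def lowerCap (z : ℂ) : S2 :=
  if hz : ‖z‖ ≤ 1 then
    -- With `h = lowerHeight z` one has `(1 + rimHeight) |z|² = 1 + h`, so the first coordinate has
    -- squared norm `1 - h²`.
    ⟨(Real.sqrt ((1 - lowerHeight z) * (1 + rimHeight)) * z, lowerHeight z), by
      rw [norm_mul, mul_pow, Complex.norm_real, Real.norm_eq_abs, sq_abs,
        Real.sq_sqrt (lowerCap_factor_pos hz).le]
      unfold lowerHeight
      ring⟩
  else hemisphere z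

theorem lowerCap_fst {z : ℂ} (hz : ‖z‖ ≤ 1) :
    (lowerCap z).1.1 = Real.sqrt ((1 - lowerHeight z) * (1 + rimHeight)) * z := by
  rw [lowerCap, dif_pos hz]

theorem lowerCap_snd {z : ℂ} (hz : ‖z‖ ≤ 1) : (lowerCap z).1.2 = lowerHeight z := by
  rw [lowerCap, dif_pos hz]

theorem lowerCap_injOn : Set.InjOn lowerCap {z | ‖z‖ ≤ 1} := by
  intro z hz z' hz' h
  have h1 := congrArg (fun q : S2 => q.1.2) h
  have h2 := congrArg (fun q : S2 => q.1.1) h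
  simp only [lowerCap_snd hz, lowerCap_snd hz'] at h1
  simp only [lowerCap_fst hz, lowerCap_fst hz', ← h1] at h2
  refine mul_left_cancel₀ ?_ h2
  exact_mod_cast (Real.sqrt_pos.2 (lowerCap_factor_pos hz)).ne'

theorem hemisphere_injective : Function.Injective hemisphere := by
  intro z z' h
  have h1 : 1 / Real.sqrt (1 + ‖z‖ ^ 2) = 1 / Real.sqrt (1 + ‖z'‖ ^ 2) :=
    congrArg (fun q : S2 => q.1.2) h
  have h2 : z / (Real.sqrt (1 + ‖z‖ ^ 2) : ℂ) = z' / (Real.sqrt (1 + ‖z'‖ ^ 2) : ℂ) :=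
    congrArg (fun q : S2 => q.1.1) h
  rw [one_div, one_div, inv_inj] at h1
  rw [h1] at h2
  have h3 : 0 < Real.sqrt (1 + ‖z'‖ ^ 2) := Real.sqrt_pos.2 (by positivity)
  exact (div_left_inj' (by exact_mod_cast h3.ne')).1 h2

theorem rimHeight_lt_hemisphere {z : ℂ} (hz : ‖z‖ < 1) : rimHeight < (hemisphere z).1.2 := by
  have h : ‖z‖ ^ 2 < 1 := (sq_lt_one_iff₀ (norm_nonneg z)).2 hz
  refine one_div_lt_one_div_of_lt (Real.sqrt_pos.2 (by positivity))
    (Real.sqrt_lt_sqrt (by positivity) ?_)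
  linarith

theorem lowerCap_eq_hemisphere {z : ℂ} (hz : ‖z‖ = 1) : lowerCap z = hemisphere z := by
  have h1 : lowerHeight z = rimHeight := by
    rw [lowerHeight, hz]
    ring
  have h2 : (1 : ℝ) + 1 ^ 2 = 2 := by norm_num
  have h3 : (1 - rimHeight) * (1 + rimHeight) = rimHeight ^ 2 := by
    linear_combination -2 * rimHeight_sq
  apply Subtype.ext
  refine Prod.ext ?_ ?_
  · rw [lowerCap_fst hz.le, h1, h3, Real.sqrt_sq rimHeight_pos.le]
    simp only [hemisphere, hz, h2, rimHeight]
    push_cast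
    ring
  · rw [lowerCap_snd hz.le, h1]
    simp only [hemisphere, hz, h2, rimHeight]

theorem exists_lowerCap_or_hemisphere (q : S2) :
    ∃ z : ℂ, ‖z‖ ≤ 1 ∧ (lowerCap z = q ∨ hemisphere z = q) := by
  obtain ⟨⟨a, h⟩, hq⟩ := q
  simp only at hq
  have hc := rimHeight_pos
  have hc1 := rimHeight_lt_one
  by_cases hh : h ≤ rimHeight
  · have h1 : 0 < (1 - h) * (1 + rimHeight) := mul_pos (by linarith) (by linarith)
    have h2 : 0 < Real.sqrt ((1 - h) * (1 + rimHeight)) := Real.sqrt_pos.2 h1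
    have h3 : ‖a / (Real.sqrt ((1 - h) * (1 + rimHeight)) : ℂ)‖ ^ 2 = (1 + h) / (1 + rimHeight) := by
      rw [norm_div, div_pow, Complex.norm_real, Real.norm_eq_abs, sq_abs, Real.sq_sqrt h1.le,
        div_eq_div_iff h1.ne' (by linarith)]
      linear_combination (1 + rimHeight) * hq
    have h4 : ‖a / (Real.sqrt ((1 - h) * (1 + rimHeight)) : ℂ)‖ ≤ 1 := by
      rw [← sq_le_one_iff₀ (norm_nonneg _), h3]
      exact div_le_one_of_le₀ (by linarith) (by linarith)
    have h5 : lowerHeight (a / (Real.sqrt ((1 - h) * (1 + rimHeight)) : ℂ)) = h := by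
      rw [lowerHeight, h3, mul_div_cancel₀ _ (by linarith)]
      ring
    refine ⟨_, h4, Or.inl (Subtype.ext (Prod.ext ?_ ?_))⟩
    · rw [lowerCap_fst h4, h5]
      exact mul_div_cancel₀ _ (by exact_mod_cast h2.ne')
    · rw [lowerCap_snd h4, h5]
  · have hh := not_le.1 hh
    have h0 : 0 < h := hc.trans hh
    have h1 : ‖a / (h : ℂ)‖ ^ 2 = (h⁻¹) ^ 2 - 1 := by
      rw [norm_div, div_pow, Complex.norm_real, Real.norm_eq_abs, sq_abs]
      field_simp
      linarith
    have h2 : Real.sqrt (1 + ‖a / (h : ℂ)‖ ^ 2) = h⁻¹ := by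
      rw [h1, add_sub_cancel, Real.sqrt_sq (inv_pos.2 h0).le]
    refine ⟨a / h, ?_, Or.inr (Subtype.ext (Prod.ext ?_ ?_))⟩
    · rw [← sq_le_one_iff₀ (norm_nonneg _), h1, inv_pow, sub_le_iff_le_add]
      rw [inv_le_comm₀ (by positivity) (by norm_num)]
      nlinarith [rimHeight_sq]
    · simp only [hemisphere, h2]
      push_cast
      have : (h : ℂ) ≠ 0 := by exact_mod_cast h0.ne'
      field_simp
    · simp only [hemisphere, h2, one_div, inv_inv]

/-- The map of the cylinder to the two-sphere which folds both boundary circles. -/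
def cap (s : ℝ) (w : Circle) : S2 :=
  if s ≤ 1 then lowerCap (ellipse s w) else hemisphere (ellipse (2 - s) w)

theorem cap_of_le {s : ℝ} (h : s ≤ 1) (w : Circle) : cap s w = lowerCap (ellipse s w) := if_pos h

theorem cap_of_ge {s : ℝ} (h : 1 ≤ s) (w : Circle) : cap s w = hemisphere (ellipse (2 - s) w) := by
  rcases h.lt_or_eq with h1 | rfl
  · exact if_neg h1.not_ge
  · rw [cap_of_le le_rfl, show (2 : ℝ) - 1 = 1 by norm_num, ellipse_one]
    exact lowerCap_eq_hemisphere (Circle.norm_coe w)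

/-- Each half of the cylinder folds to a disc by `ellipse`; the two discs are the caps of the sphere
below and above the rim. -/
theorem cap_eq_iff {s s' : ℝ} (h0 : 0 ≤ s) (h2 : s ≤ 2) (h0' : 0 ≤ s') (h2' : s' ≤ 2)
    {w w' : Circle} :
    cap s w = cap s' w' ↔ s = s' ∧ (w = w' ∨ (s = 0 ∨ s = 2) ∧ w * w' = 1) := by
  have mixed : ∀ {s s' w w'}, 0 ≤ s → s ≤ 1 → 1 < s' → s' ≤ 2 → cap s w ≠ cap s' w' := by
    intro s s' w w' h0 h1 h1' h2' h
    have h3 := norm_ellipse_le_one h0 h1 w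
    have h4 := (norm_ellipse_lt_one_iff (sub_nonneg.2 h2') w').2 (by linarith)
    rw [cap_of_le h1, cap_of_ge h1'.le] at h
    have h5 := rimHeight_lt_hemisphere h4
    rw [← h, lowerCap_snd h3] at h5
    exact h5.not_ge (lowerHeight_le h3)
  rcases le_or_gt s 1 with h1 | h1 <;> rcases le_or_gt s' 1 with h1' | h1'
  · have : s ≠ 2 := by
      rintro rfl
      norm_num at h1
    rw [cap_of_le h1, cap_of_le h1', lowerCap_injOn.eq_iff (norm_ellipse_le_one h0 h1 w)
      (norm_ellipse_le_one h0' h1' w'), ellipse_eq_iff h0 h0', or_iff_left this]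
  · refine iff_of_false (mixed h0 h1 h1' h2') fun h => ?_
    linarith [h.1]
  · refine iff_of_false (mixed h0' h1' h1 h2).symm fun h => ?_
    linarith [h.1]
  · have : s ≠ 0 := by
      rintro rfl
      norm_num at h1
    rw [cap_of_ge h1.le, cap_of_ge h1'.le, hemisphere_injective.eq_iff,
      ellipse_eq_iff (sub_nonneg.2 h2) (sub_nonneg.2 h2'), or_iff_right this, sub_right_inj,
      sub_eq_zero, eq_comm (a := 2)]

theorem exists_cap (q : S2) : ∃ s w, 0 ≤ s ∧ s ≤ 2 ∧ cap s w = q := by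
  obtain ⟨z, hz, h⟩ := exists_lowerCap_or_hemisphere q
  obtain ⟨σ, w, h0, h1, rfl⟩ := exists_ellipse hz
  rcases h with h | h
  · exact ⟨σ, w, h0, by linarith, by rw [cap_of_le h1, h]⟩
  · refine ⟨2 - σ, w, by linarith, by linarith, ?_⟩
    rw [cap_of_ge (by linarith), sub_sub_cancel, h]

theorem continuous_hemisphere : Continuous hemisphere := by
  refine Continuous.subtype_mk (Continuous.prodMk ?_ ?_) _
  · refine continuous_id.div (by fun_prop) fun z => ?_
    have : 0 < Real.sqrt (1 + ‖z‖ ^ 2) := Real.sqrt_pos.2 (by positivity)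
    exact_mod_cast this.ne'
  · exact continuous_const.div (by fun_prop) fun z => (Real.sqrt_pos.2 (by positivity)).ne'

theorem continuousOn_lowerCap : ContinuousOn lowerCap {z | ‖z‖ ≤ 1} := by
  rw [IsEmbedding.subtypeVal.isInducing.continuousOn_iff]
  have h : Continuous fun z : ℂ =>
      ((Real.sqrt ((1 - lowerHeight z) * (1 + rimHeight)) * z, lowerHeight z) : ℂ × ℝ) := by
    unfold lowerHeight
    fun_prop
  exact h.continuousOn.congr fun z hz => Prod.ext (lowerCap_fst hz) (lowerCap_snd hz)

theorem continuousOn_cap : ContinuousOn (fun q : ℝ × Circle => cap q.1 q.2)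
    {q | 0 ≤ q.1 ∧ q.1 ≤ 2} := by
  have h3 : {q : ℝ × Circle | 0 ≤ q.1 ∧ q.1 ≤ 2} =
      {q | 0 ≤ q.1 ∧ q.1 ≤ 1} ∪ {q | 1 ≤ q.1 ∧ q.1 ≤ 2} := by
    ext q
    constructor
    · rintro ⟨h1, h2⟩
      exact (le_total q.1 1).imp (fun h => ⟨h1, h⟩) fun h => ⟨h, h2⟩
    · rintro (⟨h1, h2⟩ | ⟨h1, h2⟩)
      · exact ⟨h1, h2.trans (by norm_num)⟩
      · exact ⟨zero_le_one.trans h1, h2⟩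
  have hl : IsClosed {q : ℝ × Circle | 0 ≤ q.1 ∧ q.1 ≤ 1} :=
    (isClosed_le continuous_const continuous_fst).inter (isClosed_le continuous_fst continuous_const)
  have hu : IsClosed {q : ℝ × Circle | 1 ≤ q.1 ∧ q.1 ≤ 2} :=
    (isClosed_le continuous_const continuous_fst).inter (isClosed_le continuous_fst continuous_const)
  rw [h3]
  refine ContinuousOn.union_of_isClosed (ContinuousOn.congr
    (continuousOn_lowerCap.comp continuous_ellipse.continuousOn fun q hq =>
      norm_ellipse_le_one hq.1 hq.2 q.2) fun q hq => cap_of_le hq.2 q.2) ?_ hl hu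
  refine ContinuousOn.congr (Continuous.continuousOn ?_) fun q hq => cap_of_ge hq.1 q.2
  exact continuous_hemisphere.comp (continuous_ellipse.comp (f := fun q : ℝ × Circle =>
    (2 - q.1, q.2)) (by fun_prop))

/-! ### Central projection of squares to the circle -/

/-- The maximum norm on the plane. -/
def supNorm (z : ℂ) : ℝ := max |z.re| |z.im|

theorem supNorm_mul {r : ℝ} (hr : 0 ≤ r) (z : ℂ) : supNorm (r * z) = r * supNorm z := by
  unfold supNorm
  rw [Complex.re_ofReal_mul, Complex.im_ofReal_mul, abs_mul, abs_mul, abs_of_nonneg hr,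
    ← mul_max_of_nonneg _ _ hr]

theorem supNorm_pos {z : ℂ} (hz : z ≠ 0) : 0 < supNorm z := by
  by_contra! h
  refine hz (Complex.ext (abs_nonpos_iff.1 ?_) (abs_nonpos_iff.1 ?_))
  · exact (le_max_left _ _).trans h
  · exact (le_max_right _ _).trans h

/-- The maximum norm and the phase are polar coordinates adapted to squares. -/
theorem eq_of_phase_eq {z z' : ℂ} (h1 : supNorm z = supNorm z') (h2 : phase z = phase z') :
    z = z' := by
  have e : ∀ z : ℂ, supNorm z = ‖z‖ * supNorm (phase z) := fun z => by
    rw [← supNorm_mul (norm_nonneg z), norm_mul_phase]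
  rw [e, e z', h2] at h1
  have h3 := mul_right_cancel₀ (supNorm_pos (Circle.coe_ne_zero _)).ne' h1
  rw [← norm_mul_phase z, ← norm_mul_phase z', h2, h3]

theorem exists_phase_eq (d : Circle) {r : ℝ} (hr : 0 < r) : ∃ z, supNorm z = r ∧ phase z = d := by
  have h := supNorm_pos (Circle.coe_ne_zero d)
  refine ⟨(r / supNorm d : ℝ) * d, ?_, phase_ofReal_mul (div_pos hr h) d⟩
  rw [supNorm_mul (div_pos hr h).le, div_mul_cancel₀ _ h.ne']

theorem phase_one_add (t : ℝ) : phase ⟨1, t⟩ = Circle.exp (Real.arctan t) := by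
  have hpos : 0 < Real.sqrt (1 + t ^ 2) := Real.sqrt_pos.2 (by positivity)
  rw [← phase_ofReal_mul hpos (Circle.exp (Real.arctan t)), Circle.coe_exp]
  congr 1
  apply Complex.ext
  · rw [Complex.re_ofReal_mul, Complex.exp_ofReal_mul_I_re, Real.cos_arctan,
      mul_one_div_cancel hpos.ne']
  · rw [Complex.im_ofReal_mul, Complex.exp_ofReal_mul_I_im, Real.sin_arctan,
      mul_div_cancel₀ _ hpos.ne']

theorem phase_neg_one_add (t : ℝ) : phase ⟨-1, t⟩ = Circle.exp (Real.pi - Real.arctan t) := by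
  have hpos : 0 < Real.sqrt (1 + t ^ 2) := Real.sqrt_pos.2 (by positivity)
  rw [← phase_ofReal_mul hpos (Circle.exp (Real.pi - Real.arctan t)), Circle.coe_exp]
  congr 1
  apply Complex.ext
  · rw [Complex.re_ofReal_mul, Complex.exp_ofReal_mul_I_re, Real.cos_pi_sub, Real.cos_arctan,
      mul_neg, mul_one_div_cancel hpos.ne']
  · rw [Complex.im_ofReal_mul, Complex.exp_ofReal_mul_I_im, Real.sin_pi_sub, Real.sin_arctan,
      mul_div_cancel₀ _ hpos.ne']


/-! ### The punctured product of the two-sphere and the circle -/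

/-- A hexagon with a square hole, truncated on the left. -/
def piece : Set (ℝ × ℝ) :=
  {q | -1 ≤ q.1 ∧ |q.2| ≤ 2 ∧ |q.2| ≤ 2 * (2 - q.1) ∧ 1 / 2 ≤ max |q.1| |q.2|}

/-- The radial coordinate on `piece`, viewed as part of an annulus. -/
def planeS (q : ℝ × ℝ) : ℝ :=
  min (2 * max |q.1| |q.2| - 1 + 2 * max (q.1 - 1) 0) (2 - triσ (min 1 (2 - q.1)) q.2)

/-- The angular coordinate on `piece`, viewed as part of an annulus, as a point of a square. -/
def planeV (q : ℝ × ℝ) : ℂ := ⟨-min q.1 1, triτ (min 1 (2 - q.1)) q.2⟩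

theorem continuous_planeS : Continuous planeS := by
  unfold planeS triσ
  fun_prop

theorem continuous_planeV : Continuous planeV := by
  have : planeV = fun q : ℝ × ℝ => ((-min q.1 1 : ℝ) : ℂ) +
      (triτ (min 1 (2 - q.1)) q.2 : ℝ) * Complex.I :=
    funext fun q => Complex.mk_eq_add_mul_I _ _
  rw [this]
  unfold triτ
  fun_prop

theorem planeV_of_le {q : ℝ × ℝ} (h : q.1 ≤ 1) : planeV q = ⟨-q.1, triτ 1 q.2⟩ := by
  rw [planeV, min_eq_left h, min_eq_left (by linarith)]

theorem planeV_of_ge {q : ℝ × ℝ} (h : 1 ≤ q.1) : planeV q = ⟨-1, triτ (2 - q.1) q.2⟩ := by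
  rw [planeV, min_eq_right h, min_eq_right (by linarith)]

/-- The boundary of the hole is `s = 0`, the square of half-width one is `s = 1`, and the rest of
the piece has `s ≥ 1`, with the outer boundary, apart from the cut on the left, at `s = 2`. -/
theorem planeS_of_abs_le {q : ℝ × ℝ} (h : q.1 ≤ 1) (h1 : |q.1| ≤ 1) (h2 : |q.2| ≤ 1) :
    planeS q = 2 * max |q.1| |q.2| - 1 := by
  have h3 : max |q.1| |q.2| ≤ 1 := max_le h1 h2
  have h4 := triσ_le 1 q.2
  rw [planeS, min_eq_left (a := (1 : ℝ)) (by linarith), max_eq_right (a := q.1 - 1) (by linarith),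
    min_eq_left (by linarith)]
  ring

theorem planeS_of_le_abs {q : ℝ × ℝ} (h : q.1 ≤ 1) (h2 : 1 ≤ |q.2|) : planeS q = |q.2| := by
  have h3 := le_max_right |q.1| |q.2|
  have h4 : triσ 1 q.2 = 2 - |q.2| := by
    rw [triσ, min_eq_right (by linarith)]
    ring
  rw [planeS, min_eq_left (a := (1 : ℝ)) (by linarith), max_eq_right (a := q.1 - 1) (by linarith),
    h4, min_eq_right (by linarith)]
  ring

theorem planeS_of_ge {q : ℝ × ℝ} (h : 1 ≤ q.1) :
    planeS q = 2 - triσ (2 - q.1) q.2 := by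
  have h3 := le_max_right |q.1| |q.2|
  have h4 := (le_abs_self q.1).trans (le_max_left |q.1| |q.2|)
  rw [planeS, min_eq_right (a := (1 : ℝ)) (by linarith), max_eq_left (a := q.1 - 1) (by linarith),
    min_eq_right]
  have : 3 - 2 * max |q.1| |q.2| - 2 * (q.1 - 1) ≤ triσ (2 - q.1) q.2 :=
    le_min (by linarith) (by linarith)
  linarith

theorem abs_fst_le {q : ℝ × ℝ} (hq : q ∈ piece) (h : q.1 ≤ 1) : |q.1| ≤ 1 := abs_le.2 ⟨hq.1, h⟩

theorem planeS_mem {q : ℝ × ℝ} (hq : q ∈ piece) : 0 ≤ planeS q ∧ planeS q ≤ 2 := by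
  rcases le_total q.1 1 with h | h
  · rcases le_total |q.2| 1 with h2 | h2
    · rw [planeS_of_abs_le h (abs_fst_le hq h) h2]
      have := max_le (abs_fst_le hq h) h2
      constructor <;> linarith [hq.2.2.2]
    · rw [planeS_of_le_abs h h2]
      exact ⟨abs_nonneg _, hq.2.1⟩
  · rw [planeS_of_ge h]
    have h1 := triσ_nonneg hq.2.2.1
    have h2 := triσ_le (2 - q.1) q.2
    constructor <;> linarith

theorem planeS_boundary_iff {q : ℝ × ℝ} (hq : q ∈ piece) : planeS q = 0 ∨ planeS q = 2 ↔
    max |q.1| |q.2| = 1 / 2 ∨ |q.2| = 2 ∨ |q.2| = 2 * (2 - q.1) := by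
  obtain ⟨h1, h2, h3, h4⟩ := hq
  rcases le_total q.1 1 with h | h
  · rcases le_total |q.2| 1 with h5 | h5
    · have h6 := max_le (abs_le.2 ⟨h1, h⟩) h5
      rw [planeS_of_abs_le h (abs_le.2 ⟨h1, h⟩) h5]
      constructor
      · rintro (h7 | h7)
        · left; linarith
        · linarith
      · rintro (h7 | h7 | h7)
        · left; linarith
        · linarith
        · linarith
    · have h6 := le_max_right |q.1| |q.2|
      rw [planeS_of_le_abs h h5]
      constructor
      · rintro (h7 | h7)
        · linarith
        · exact Or.inr (Or.inl h7)
      · rintro (h7 | h7 | h7)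
        · linarith
        · exact Or.inr h7
        · right; linarith
  · have h6 := (le_abs_self q.1).trans (le_max_left |q.1| |q.2|)
    have h7 := triσ_le (2 - q.1) q.2
    rw [planeS_of_ge h, sub_eq_self, triσ_eq_zero_iff h3]
    constructor
    · rintro (h8 | h8)
      · linarith
      · exact Or.inr (Or.inr h8)
    · rintro (h8 | h8 | h8)
      · linarith
      · right; linarith
      · exact Or.inr h8

/-- The size of `planeV` depends on `planeS` alone, so no information is lost by passing to the
phase. -/
theorem supNorm_planeV {q : ℝ × ℝ} (hq : q ∈ piece) :
    supNorm (planeV q) = min 1 ((planeS q + 1) / 2) := by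
  rcases le_total q.1 1 with h | h
  · have h1 := abs_fst_le hq h
    rw [planeV_of_le h, supNorm]
    simp only [abs_neg]
    rcases tri_cases (y := q.2) zero_le_one with ⟨h2, -, h3⟩ | ⟨h2, -, h3⟩ | ⟨h2, -, h3⟩
    · have h6 := max_le h1 h2
      rw [planeS_of_abs_le h h1 h2, h3, min_eq_right (by linarith)]
      ring
    · have h4 : 1 ≤ |q.2| := h2.le.trans (le_abs_self _)
      rw [planeS_of_le_abs h h4, h3, abs_one, max_eq_right h1, min_eq_left (by linarith)]
    · have h4 : 1 ≤ |q.2| := by linarith [neg_abs_le q.2]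
      rw [planeS_of_le_abs h h4, h3, abs_neg, abs_one, max_eq_right h1, min_eq_left (by linarith)]
  · have h3 := hq.2.2.1
    have h4 : 0 ≤ 2 - q.1 := by linarith [abs_nonneg q.2]
    have h5 := triσ_le (2 - q.1) q.2
    rw [planeV_of_ge h, supNorm, planeS_of_ge h]
    simp only [abs_neg, abs_one]
    rw [max_eq_left ((abs_triτ_le h4).trans (by linarith)), min_eq_left (by linarith)]

theorem plane_injective {q q' : ℝ × ℝ} (hq : q ∈ piece) (hq' : q' ∈ piece)
    (hS : planeS q = planeS q') (hV : planeV q = planeV q') : q = q' := by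
  have h1 : min q.1 1 = min q'.1 1 := neg_inj.1 (congrArg Complex.re hV)
  have h2 : triτ (min 1 (2 - q.1)) q.2 = triτ (min 1 (2 - q'.1)) q'.2 := congrArg Complex.im hV
  rcases lt_or_ge q.1 1 with h | h
  · have h' : q'.1 < 1 := by
      by_contra! h'
      rw [min_eq_left h.le, min_eq_right h'] at h1
      linarith
    rw [min_eq_left h.le, min_eq_left h'.le] at h1
    rw [min_eq_left (by linarith), min_eq_left (by linarith)] at h2
    refine Prod.ext h1 ?_
    have big : ∀ {q : ℝ × ℝ}, q.1 < 1 → 1 < |q.2| → planeS q = |q.2| := fun h1 h2 =>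
      planeS_of_le_abs h1.le h2.le
    have small : ∀ {q : ℝ × ℝ}, q ∈ piece → q.1 < 1 → |q.2| ≤ 1 → planeS q ≤ 1 := by
      intro q hq h1 h2
      rw [planeS_of_abs_le h1.le (abs_fst_le hq h1.le) h2]
      linarith [max_le (abs_fst_le hq h1.le) h2]
    have hp : ∀ {y : ℝ}, 1 < y → |y| = y := fun hy => abs_of_pos (by linarith)
    have hn : ∀ {y : ℝ}, y < -1 → |y| = -y := fun hy => abs_of_neg (by linarith)
    rcases tri_cases (y := q.2) zero_le_one with ⟨h3, -, h4⟩ | ⟨h3, -, h4⟩ | ⟨h3, -, h4⟩ <;>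
    rcases tri_cases (y := q'.2) zero_le_one with ⟨h3', -, h4'⟩ | ⟨h3', -, h4'⟩ | ⟨h3', -, h4'⟩ <;>
    rw [h4, h4'] at h2
    · exact h2
    · have h5 := small hq h h3
      rw [hS, big h' (by rw [hp h3']; linarith), hp h3'] at h5
      linarith
    · have h5 := small hq h h3
      rw [hS, big h' (by rw [hn h3']; linarith), hn h3'] at h5
      linarith
    · have h5 := small hq' h' h3'
      rw [← hS, big h (by rw [hp h3]; linarith), hp h3] at h5
      linarith
    · rwa [big h (by rw [hp h3]; linarith), hp h3, big h' (by rw [hp h3']; linarith), hp h3'] at hS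
    · norm_num at h2
    · have h5 := small hq' h' h3'
      rw [← hS, big h (by rw [hn h3]; linarith), hn h3] at h5
      linarith
    · norm_num at h2
    · rw [big h (by rw [hn h3]; linarith), hn h3, big h' (by rw [hn h3']; linarith), hn h3'] at hS
      linarith
  · have h' : 1 ≤ q'.1 := by
      by_contra! h'
      rw [min_eq_right h, min_eq_left h'.le] at h1
      linarith
    rw [min_eq_right (by linarith), min_eq_right (by linarith)] at h2
    rw [planeS_of_ge h, planeS_of_ge h', sub_right_inj] at hS
    obtain ⟨h3, h4⟩ := tri_injective hq.2.2.1 hq'.2.2.1 hS h2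
    exact Prod.ext (by linarith) h4

/-- The piece is an annulus from which a part next to the outer boundary is missing. The exceptional
case is this part; over it lies the interior of the ball `discIn`. -/
theorem exists_plane {s : ℝ} {z : ℂ} (h0 : 0 ≤ s) (h2 : s ≤ 2)
    (hz : supNorm z = min 1 ((s + 1) / 2)) :
    (∃ q ∈ piece, planeS q = s ∧ planeV q = z) ∨ 1 < s ∧ z.re = 1 ∧ |z.im| < 1 := by
  have hre : |z.re| ≤ supNorm z := le_max_left _ _
  have him : |z.im| ≤ supNorm z := le_max_right _ _
  rcases le_or_gt s 1 with h | h
  · left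
    rw [min_eq_right (by linarith)] at hz
    have h3 := abs_le.1 (hre.trans (hz.le.trans (show (s + 1) / 2 ≤ 1 by linarith)))
    have h4 := abs_le.1 (him.trans (hz.le.trans (show (s + 1) / 2 ≤ 1 by linarith)))
    have h5 : -z.re ≤ 1 := by linarith
    have h6 : max |-z.re| |z.im| = (s + 1) / 2 := by rw [abs_neg]; exact hz
    refine ⟨(-z.re, z.im), ⟨by simp only; linarith, (abs_le.2 h4).trans (by norm_num),
      (abs_le.2 h4).trans (by simp only; linarith), ?_⟩, ?_, ?_⟩
    · simp only [h6]
      linarith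
    · rw [planeS_of_abs_le h5 (by rw [abs_neg]; exact abs_le.2 h3) (abs_le.2 h4)]
      simp only [h6]
      ring
    · rw [planeV_of_le h5]
      refine Complex.ext (neg_neg _) ?_
      simp only [triτ]
      rw [min_eq_right h4.2, max_eq_right h4.1]
  · rw [min_eq_left (by linarith)] at hz
    rw [hz] at hre him
    by_cases h5 : z.re = -1
    · left
      obtain ⟨r, y, h6, h7, h8, h9, h10⟩ := exists_tri (σ := 2 - s) (by linarith) (by linarith) him
      have h11 : (1 : ℝ) ≤ (2 - r, y).1 := by simp only; linarith
      have h12 : |(2 - r, y).2| ≤ 2 * (2 - (2 - r, y).1) := by simpa only [sub_sub_cancel] using h8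
      refine ⟨(2 - r, y), ⟨by linarith, h8.trans (by linarith), h12,
        le_max_of_le_left ((show 1 / 2 ≤ (2 - r, y).1 by linarith).trans (le_abs_self _))⟩, ?_, ?_⟩
      · rw [planeS_of_ge h11]
        simp only [sub_sub_cancel, h9]
      · rw [planeV_of_ge h11]
        simp only [sub_sub_cancel, h10]
        exact Complex.ext h5.symm rfl
    by_cases h6 : |z.im| = 1
    · left
      have h7 := abs_le.1 hre
      have h8 : |s * z.im| = s := by rw [abs_mul, h6, mul_one, abs_of_nonneg h0]
      have h9 : -z.re ≤ 1 := by linarith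
      refine ⟨(-z.re, s * z.im), ⟨by simp only; linarith, h8.le.trans h2,
        h8.le.trans (by simp only; linarith), le_max_of_le_right ?_⟩, ?_, ?_⟩
      · rw [h8]
        linarith
      · rw [planeS_of_le_abs h9 (h.le.trans h8.ge), h8]
      · rw [planeV_of_le h9]
        refine Complex.ext (neg_neg _) ?_
        simp only [triτ]
        rcases abs_choice z.im with h10 | h10 <;> rw [h10] at h6
        · rw [h6, mul_one, min_eq_left h.le, max_eq_right (by norm_num)]
        · have h11 : z.im = -1 := by linarith
          rw [h11, min_eq_right (by linarith), max_eq_left (by linarith)]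
    · refine Or.inr ⟨h, ?_, lt_of_le_of_ne him h6⟩
      rcases max_choice |z.re| |z.im| with h7 | h7
      · rw [supNorm, h7] at hz
        rcases abs_choice z.re with h8 | h8 <;> rw [h8] at hz
        · exact hz
        · exact absurd (by linarith) h5
      · rw [supNorm, h7] at hz
        exact absurd hz h6

/-- The folding map of the complement of a ball in the product of the two-sphere and the circle. -/
def pieceMap (q : ℝ × ℝ) (w : Circle) : S2 × Circle := (cap (planeS q) w, phase (planeV q))

theorem planeV_ne_zero {q : ℝ × ℝ} (hq : q ∈ piece) : planeV q ≠ 0 := by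
  intro h
  have h1 := supNorm_planeV hq
  have h2 : (0 : ℝ) < min 1 ((planeS q + 1) / 2) := lt_min one_pos (by linarith [(planeS_mem hq).1])
  rw [h, supNorm] at h1
  simp only [Complex.zero_re, Complex.zero_im, abs_zero, max_self] at h1
  linarith

theorem continuousOn_pieceMap :
    ContinuousOn (fun q : (ℝ × ℝ) × Circle => pieceMap q.1 q.2) (piece ×ˢ Set.univ) := by
  have h1 := continuous_planeS
  refine ContinuousOn.prodMk ?_ ?_
  · exact continuousOn_cap.comp (f := fun q : (ℝ × ℝ) × Circle => (planeS q.1, q.2))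
      (Continuous.continuousOn (by fun_prop)) fun q hq => planeS_mem hq.1
  · intro q hq
    exact ((continuousAt_phase (planeV_ne_zero hq.1)).comp (f := fun q : (ℝ × ℝ) × Circle =>
      planeV q.1) (continuous_planeV.comp continuous_fst).continuousAt).continuousWithinAt

theorem pieceMap_eq_iff {q q' : ℝ × ℝ} (hq : q ∈ piece) (hq' : q' ∈ piece) {w w' : Circle} :
    pieceMap q w = pieceMap q' w' ↔ q = q' ∧ (w = w' ∨
      (max |q.1| |q.2| = 1 / 2 ∨ |q.2| = 2 ∨ |q.2| = 2 * (2 - q.1)) ∧ w * w' = 1) := by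
  have h1 := planeS_mem hq
  have h1' := planeS_mem hq'
  rw [pieceMap, pieceMap, Prod.mk.injEq, cap_eq_iff h1.1 h1.2 h1'.1 h1'.2, planeS_boundary_iff hq]
  constructor
  · rintro ⟨⟨h2, h3⟩, h4⟩
    refine ⟨plane_injective hq hq' h2 (eq_of_phase_eq ?_ h4), h3⟩
    rw [supNorm_planeV hq, supNorm_planeV hq', h2]
  · rintro ⟨rfl, h2⟩
    exact ⟨⟨rfl, h2⟩, rfl⟩

theorem discIn_pill {r y : ℝ} (hr : r ≤ 1) (w : Circle) :
    discIn (pill r y w) = (cap (2 - triσ r y) w, phase ⟨1, triτ r y⟩) := by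
  have := triσ_le r y
  rw [cap_of_ge (by linarith), sub_sub_cancel, phase_one_add]
  rfl

/-- The left cut of the piece gives the boundary sphere of the removed ball, in the same
parametrization as the tip of the preceding hexagon. -/
theorem pieceMap_neg_one {q : ℝ × ℝ} (h : q.1 = -1) (w : Circle) :
    pieceMap q w = discIn (pill 1 q.2 w) := by
  have h1 : q.1 ≤ 1 := by linarith
  have h2 : |q.1| = 1 := by rw [h, abs_neg, abs_one]
  have h3 : planeS q = 2 - triσ 1 q.2 := by
    rcases le_total |q.2| 1 with h4 | h4
    · rw [planeS_of_abs_le h1 h2.le h4, h2, max_eq_left h4, triσ, min_eq_left (by linarith)]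
      norm_num
    · rw [planeS_of_le_abs h1 h4, triσ, min_eq_right (by linarith)]
      ring
  rw [discIn_pill le_rfl, pieceMap, planeV_of_le h1, h3, h, neg_neg]

/-- The right tip of the piece carries the ball for the next connected sum. -/
theorem pieceMap_of_ge {q : ℝ × ℝ} (h : 1 ≤ q.1) (w : Circle) :
    pieceMap q w = discOut (pill (2 - q.1) q.2 w) := by
  have := triσ_le (2 - q.1) q.2
  rw [pieceMap, planeS_of_ge h, planeV_of_ge h, cap_of_ge (by linarith), sub_sub_cancel,
    phase_neg_one_add]
  rfl

theorem exp_arctan_injective : Function.Injective fun t : ℝ => Circle.exp (Real.arctan t) := by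
  intro t t' h
  have hpi := Real.pi_pos
  have h1 : ∀ t, Real.arctan t ∈ Set.Icc (-(Real.pi / 2)) (Real.pi / 2) := fun t =>
    ⟨(Real.neg_pi_div_two_lt_arctan t).le, (Real.arctan_lt_pi_div_two t).le⟩
  exact Real.arctan_injective (Circle.exp_injOn_Icc (by linarith) (h1 t) (h1 t') h)

theorem discIn_injective : Function.Injective discIn := by
  intro p p' h
  exact Prod.ext (hemisphere_injective (congrArg Prod.fst h))
    (exp_arctan_injective (congrArg Prod.snd h))

theorem pieceMap_eq_discIn {q : ℝ × ℝ} (hq : q ∈ piece) {w : Circle} {b : ℂ × ℝ} (hb : ‖b‖ ≤ 1)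
    (h : pieceMap q w = discIn b) : q.1 = -1 ∧ b = pill 1 q.2 w := by
  suffices h1 : q.1 = -1 by
    rw [pieceMap_neg_one h1] at h
    exact ⟨h1, (discIn_injective h).symm⟩
  obtain ⟨r, y, w', h0, h1, h2, rfl⟩ := exists_pill hb
  rw [discIn_pill h1, pieceMap, Prod.mk.injEq] at h
  have h3 := planeS_mem hq
  have h4 := triσ_nonneg h2
  have h5 := triσ_le r y
  have h6 := ((cap_eq_iff h3.1 h3.2 (by linarith) (by linarith)).1 h.1).1
  have h7 : planeV q = ⟨1, triτ r y⟩ := by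
    refine eq_of_phase_eq ?_ h.2
    rw [supNorm_planeV hq, min_eq_left (by linarith), supNorm]
    simp only [abs_one]
    exact (max_eq_left ((abs_triτ_le h0).trans h1)).symm
  have h8 : -min q.1 1 = 1 := congrArg Complex.re h7
  rcases min_choice q.1 1 with h9 | h9 <;> rw [h9] at h8 <;> linarith

theorem pieceMap_notMem {q : ℝ × ℝ} (hq : q ∈ piece) (w : Circle) :
    pieceMap q w ∉ discIn '' Metric.ball 0 1 := by
  rintro ⟨b, hb, h⟩
  rw [mem_ball_zero_iff] at hb
  have h1 := (pieceMap_eq_discIn hq hb.le h.symm).2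
  rw [h1, norm_pill_one hq.2.1] at hb
  exact lt_irrefl _ hb

theorem exists_pieceMap {x : S2 × Circle} (hx : x ∉ discIn '' Metric.ball 0 1) :
    ∃ q ∈ piece, ∃ w, pieceMap q w = x := by
  obtain ⟨s, w, h0, h2, hs⟩ := exists_cap x.1
  obtain ⟨z, hz, hzd⟩ := exists_phase_eq x.2 (r := min 1 ((s + 1) / 2))
    (lt_min one_pos (by linarith))
  rcases exists_plane h0 h2 hz with ⟨q, hq, h3, h4⟩ | ⟨h3, h4, h5⟩
  · exact ⟨q, hq, w, Prod.ext (by rw [← hs, ← h3]; rfl) (by rw [← hzd, ← h4]; rfl)⟩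
  · refine absurd ⟨(ellipse (2 - s) w, z.im), ?_, ?_⟩ hx
    · rw [mem_ball_zero_iff, Prod.norm_def]
      exact max_lt ((norm_ellipse_lt_one_iff (by linarith) w).2 (by linarith)) h5
    · refine Prod.ext ?_ ?_
      · rw [← hs, cap_of_ge h3.le]
        rfl
      · rw [← hzd]
        have : z = ⟨1, z.im⟩ := Complex.ext h4 rfl
        rw [this, phase_one_add]
        rfl

theorem isCompact_piece : IsCompact piece := by
  have h1 : IsClosed piece := by
    have c1 : Continuous fun q : ℝ × ℝ => |q.2| := by fun_prop
    have c2 : Continuous fun q : ℝ × ℝ => 2 * (2 - q.1) := by fun_prop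
    have c3 : Continuous fun q : ℝ × ℝ => max |q.1| |q.2| := by fun_prop
    exact (isClosed_le continuous_const continuous_fst).inter
      ((isClosed_le c1 continuous_const).inter
        ((isClosed_le c1 c2).inter (isClosed_le continuous_const c3)))
  refine (isCompact_Icc (a := ((-1 : ℝ), (-2 : ℝ))) (b := ((2 : ℝ), (2 : ℝ)))).of_isClosed_subset
    h1 fun q hq => ?_
  obtain ⟨h2, h3⟩ := abs_le.1 hq.2.1
  have h4 := hq.2.2.1
  exact ⟨⟨hq.1, h2⟩, by simp only; linarith [abs_nonneg q.2], h3⟩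


/-! ### Points of a connected sum -/

section Gluing

variable {X Y : Type} {i : ℂ × ℝ → X} {j : ℂ × ℝ → Y}

/-- The generated equivalence relation need not be computed: the predicate of being identified with
`a` respects the gluing, so it descends to the quotient and holds at the class of `a`. -/
theorem connSum_inl_eq (hj : Set.InjOn j (Metric.sphere 0 1)) (a : Punctured i)
    (x : Punctured i ⊕ Punctured j) : (Quot.mk (GlueRel i j) (Sum.inl a) = Quot.mk _ x) →
      Sum.elim (fun a' => a = a')
        (fun c => ∃ b ∈ Metric.sphere (0 : ℂ × ℝ) 1, a.1 = i b ∧ c.1 = j b) x := by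
  let f : ConnSum i j → Prop := Quot.lift (Sum.elim (fun a' => a = a')
      (fun c => ∃ b ∈ Metric.sphere (0 : ℂ × ℝ) 1, a.1 = i b ∧ c.1 = j b)) (by
    rintro _ _ ⟨b, hb, hi', hj'⟩
    refine propext ⟨fun h => ⟨b, hb, congrArg Subtype.val h, rfl⟩, ?_⟩
    rintro ⟨b', hb', h1, h2⟩
    exact Subtype.ext (h1.trans (congrArg i (hj hb hb' h2).symm)))
  intro h
  have h1 : f (Quot.mk _ (Sum.inl a)) := show a = a from rfl
  rwa [h] at h1

theorem connSum_inr_eq (hi : Set.InjOn i (Metric.sphere 0 1)) (c : Punctured j)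
    (x : Punctured i ⊕ Punctured j) : (Quot.mk (GlueRel i j) (Sum.inr c) = Quot.mk _ x) →
      Sum.elim (fun a => ∃ b ∈ Metric.sphere (0 : ℂ × ℝ) 1, a.1 = i b ∧ c.1 = j b)
        (fun c' => c = c') x := by
  let f : ConnSum i j → Prop := Quot.lift (Sum.elim
      (fun a => ∃ b ∈ Metric.sphere (0 : ℂ × ℝ) 1, a.1 = i b ∧ c.1 = j b) (fun c' => c = c')) (by
    rintro _ _ ⟨b, hb, hi', hj'⟩
    refine propext ⟨?_, fun h => ⟨b, hb, rfl, congrArg Subtype.val h⟩⟩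
    rintro ⟨b', hb', h1, h2⟩
    exact Subtype.ext (h2.trans (congrArg j (hi hb hb' h1).symm)))
  intro h
  have h1 : f (Quot.mk _ (Sum.inr c)) := show c = c from rfl
  rwa [h] at h1

end Gluing

section AddHandle

variable {X : Type} (i : ℂ × ℝ → X)

open Classical in
/-- The map of the first summand to the connected sum, with a junk value on the removed ball. -/
def glueLeft (x : X) : ConnSum i discIn :=
  if h : x ∉ i '' Metric.ball 0 1 then Quot.mk _ (Sum.inl ⟨x, h⟩)
  else Quot.mk _ (Sum.inr ⟨discOut 0, discOut_notMem 0⟩)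

open Classical in
/-- The map of the second summand to the connected sum, with a junk value on the removed ball. -/
def glueRight (y : S2 × Circle) : ConnSum i discIn :=
  if h : y ∉ discIn '' Metric.ball 0 1 then Quot.mk _ (Sum.inr ⟨y, h⟩)
  else Quot.mk _ (Sum.inr ⟨discOut 0, discOut_notMem 0⟩)

variable {i}

theorem glueLeft_of_notMem {x : X} (h : x ∉ i '' Metric.ball 0 1) :
    glueLeft i x = Quot.mk _ (Sum.inl ⟨x, h⟩) := dif_pos h

theorem glueRight_of_notMem {y : S2 × Circle} (h : y ∉ discIn '' Metric.ball 0 1) :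
    glueRight i y = Quot.mk _ (Sum.inr ⟨y, h⟩) := dif_pos h

theorem glueLeft_injOn : Set.InjOn (glueLeft i) {x | x ∉ i '' Metric.ball 0 1} := by
  intro x hx x' hx' h
  rw [glueLeft_of_notMem hx, glueLeft_of_notMem hx'] at h
  exact congrArg Subtype.val (connSum_inl_eq discIn_injective.injOn _ _ h)

theorem glueRight_injOn (hi : Set.InjOn i (Metric.sphere 0 1)) :
    Set.InjOn (glueRight i) {x | x ∉ discIn '' Metric.ball 0 1} := by
  intro x hx x' hx' h
  rw [glueRight_of_notMem hx, glueRight_of_notMem hx'] at h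
  exact congrArg Subtype.val (connSum_inr_eq hi _ _ h)

theorem exists_of_glueLeft_eq {x : X} {y : S2 × Circle} (hx : x ∉ i '' Metric.ball 0 1)
    (hy : y ∉ discIn '' Metric.ball 0 1) (h : glueLeft i x = glueRight i y) :
    ∃ b : ℂ × ℝ, ‖b‖ = 1 ∧ x = i b ∧ y = discIn b := by
  rw [glueLeft_of_notMem hx, glueRight_of_notMem hy] at h
  obtain ⟨b, hb, h1, h2⟩ := connSum_inl_eq discIn_injective.injOn _ _ h
  exact ⟨b, mem_sphere_zero_iff_norm.1 hb, h1, h2⟩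

theorem glueLeft_eq_glueRight {b : ℂ × ℝ} (hb : ‖b‖ = 1) (hx : i b ∉ i '' Metric.ball 0 1)
    (hy : discIn b ∉ discIn '' Metric.ball 0 1) : glueLeft i (i b) = glueRight i (discIn b) := by
  rw [glueLeft_of_notMem hx, glueRight_of_notMem hy]
  exact Quot.sound (GlueRel.glue b (mem_sphere_zero_iff_norm.2 hb) hx hy)

theorem continuousOn_glueLeft [TopologicalSpace X] :
    ContinuousOn (glueLeft i) {x | x ∉ i '' Metric.ball 0 1} := by
  rw [continuousOn_iff_continuous_domRestrict]
  exact (continuous_quot_mk.comp continuous_inl).congr fun x => (glueLeft_of_notMem x.2).symm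

theorem continuousOn_glueRight [TopologicalSpace X] :
    ContinuousOn (glueRight i) {x | x ∉ discIn '' Metric.ball 0 1} := by
  rw [continuousOn_iff_continuous_domRestrict]
  exact (continuous_quot_mk.comp continuous_inr).congr fun x => (glueRight_of_notMem x.2).symm

theorem isClosed_connSum [TopologicalSpace X] {C : Set (ConnSum i discIn)}
    (h1 : IsClosed {x | x ∉ i '' Metric.ball 0 1 ∧ glueLeft i x ∈ C})
    (h2 : IsClosed {y | y ∉ discIn '' Metric.ball 0 1 ∧ glueRight i y ∈ C}) : IsClosed C := by
  rw [← isQuotientMap_quot_mk.isClosed_preimage, isClosed_sum_iff]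
  constructor
  · have e : Sum.inl ⁻¹' (Quot.mk (GlueRel i discIn) ⁻¹' C) =
        Subtype.val ⁻¹' {x | x ∉ i '' Metric.ball 0 1 ∧ glueLeft i x ∈ C} := by
      ext ⟨x, hx⟩
      change Quot.mk _ _ ∈ C ↔ x ∉ i '' Metric.ball 0 1 ∧ glueLeft i x ∈ C
      rw [and_iff_right hx, glueLeft_of_notMem hx]
    rw [e]
    exact h1.preimage continuous_subtype_val
  · have e : Sum.inr ⁻¹' (Quot.mk (GlueRel i discIn) ⁻¹' C) =
        Subtype.val ⁻¹' {x | x ∉ discIn '' Metric.ball 0 1 ∧ glueRight i x ∈ C} := by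
      ext ⟨x, hx⟩
      change Quot.mk _ _ ∈ C ↔ x ∉ discIn '' Metric.ball 0 1 ∧ glueRight i x ∈ C
      rw [and_iff_right hx, glueRight_of_notMem hx]
    rw [e]
    exact h2.preimage continuous_subtype_val

end AddHandle

/-! ### The planar domains at both sides of a vertical line -/

theorem half_le_holes {n : ℕ} {p : ℝ × ℝ} (h : 2 * (n : ℝ) ≤ p.1) : 1 / 2 ≤ holes n p := by
  refine (le_holes_iff (by norm_num)).2 fun k hk => ?_
  have hk' : (k : ℝ) + 1 ≤ n := by exact_mod_cast hk
  have := (le_abs_self (p.1 - (2 * k + 1))).trans (le_max_left _ |p.2|)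
  linarith

theorem min_eq_zero_iff_of_pos {a b : ℝ} (hb : 0 < b) : min a b = 0 ↔ a = 0 := by
  constructor
  · intro h
    rcases min_choice a b with h1 | h1 <;> rw [h1] at h <;> linarith
  · rintro rfl
    exact min_eq_left hb.le

theorem hexRho_of_ge {n : ℕ} {p : ℝ × ℝ} (h : 2 * (n : ℝ) ≤ p.1) :
    (0 ≤ hexRho n p ↔ |p.2| ≤ 2 * (2 * n + 1 - p.1)) ∧
      (hexRho n p = 0 ↔ |p.2| = 2 * (2 * n + 1 - p.1)) := by
  have hn : (0 : ℝ) ≤ n := by positivity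
  have h1 : height n p.1 = 2 * (2 * n + 1 - p.1) := by
    unfold height
    rw [min_eq_right (a := 2 * (1 + p.1)) (by linarith), min_eq_right (by linarith)]
  have h2 : 0 < holes n p := by linarith [half_le_holes h]
  rw [hexRho, h1, min_eq_zero_iff_of_pos h2, le_min_iff, sub_nonneg, and_iff_left h2.le, sub_eq_zero,
    eq_comm (a := |p.2|)]
  exact ⟨Iff.rfl, Iff.rfl⟩

/-- Successive domains agree to the left of `x = 2 n`: the new hole and the new tip lie on the other
side. -/
theorem hexRho_succ_of_le {n : ℕ} {p : ℝ × ℝ} (h : p.1 ≤ 2 * (n : ℝ)) :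
    (0 ≤ hexRho (n + 1) p ↔ 0 ≤ hexRho n p) ∧ (hexRho (n + 1) p = 0 ↔ hexRho n p = 0) := by
  have h1 : height (n + 1) p.1 = height n p.1 := by
    unfold height
    rw [← min_assoc, ← min_assoc, min_eq_left (b := 2 * (2 * ((n + 1 : ℕ) : ℝ) + 1 - p.1)),
      min_eq_left (b := 2 * (2 * (n : ℝ) + 1 - p.1))]
    · exact (min_le_left _ _).trans (by linarith)
    · refine (min_le_left _ _).trans ?_
      push_cast
      linarith
  have h2 : 0 < max |p.1 - (2 * n + 1)| |p.2| - 1 / 2 := by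
    have := (neg_le_abs (p.1 - (2 * n + 1))).trans (le_max_left _ |p.2|)
    linarith
  have h3 : hexRho (n + 1) p = min (hexRho n p) (max |p.1 - (2 * n + 1)| |p.2| - 1 / 2) := by
    rw [hexRho, h1, holes, ← min_assoc, hexRho]
  rw [h3, min_eq_zero_iff_of_pos h2, le_min_iff, and_iff_left h2.le]
  exact ⟨Iff.rfl, Iff.rfl⟩

/-- The coordinates centred at the last hole. -/
def shift (n : ℕ) (p : ℝ × ℝ) : ℝ × ℝ := (p.1 - (2 * n + 1), p.2)

theorem hexRho_succ_eq {n : ℕ} {p : ℝ × ℝ} (h : 2 * (n : ℝ) ≤ p.1) :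
    hexRho (n + 1) p = min (min (min 2 (2 * (2 - (shift n p).1)) - |(shift n p).2|)
      (max |(shift n p).1| |(shift n p).2| - 1 / 2)) (holes n p) := by
  have hn : (0 : ℝ) ≤ n := by positivity
  have h1 : height (n + 1) p.1 = min 2 (2 * (2 - (p.1 - (2 * n + 1)))) := by
    have h2 : 2 * (2 * ((n + 1 : ℕ) : ℝ) + 1 - p.1) = 2 * (2 - (p.1 - (2 * n + 1))) := by
      push_cast
      ring
    rw [height, h2, ← min_assoc, min_eq_left (b := 2 * (1 + p.1)) (by linarith)]
  rw [hexRho, h1, holes, min_comm (holes n p), ← min_assoc]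
  rfl

theorem mem_piece_iff {n : ℕ} {p : ℝ × ℝ} (h : 2 * (n : ℝ) ≤ p.1) :
    0 ≤ hexRho (n + 1) p ↔ shift n p ∈ piece := by
  have h1 : 0 ≤ holes n p := by linarith [half_le_holes h]
  have h2 : -1 ≤ (shift n p).1 := by
    simp only [shift]
    linarith
  rw [hexRho_succ_eq h, le_min_iff, and_iff_left h1, le_min_iff, sub_nonneg, sub_nonneg, le_min_iff,
    and_assoc]
  exact (and_iff_right h2).symm

theorem hexRho_succ_of_ge {n : ℕ} {p : ℝ × ℝ} (h : 2 * (n : ℝ) ≤ p.1) (hp : shift n p ∈ piece) :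
    hexRho (n + 1) p = 0 ↔ max |(shift n p).1| |(shift n p).2| = 1 / 2 ∨ |(shift n p).2| = 2 ∨
      |(shift n p).2| = 2 * (2 - (shift n p).1) := by
  obtain ⟨-, h2, h3, h4⟩ := hp
  have h1 : 0 < holes n p := by linarith [half_le_holes h]
  rw [hexRho_succ_eq h, min_eq_zero_iff_of_pos h1]
  constructor
  · intro h5
    rcases min_choice (min 2 (2 * (2 - (shift n p).1)) - |(shift n p).2|)
      (max |(shift n p).1| |(shift n p).2| - 1 / 2) with h6 | h6 <;> rw [h6] at h5
    · rcases min_choice 2 (2 * (2 - (shift n p).1)) with h7 | h7 <;> rw [h7] at h5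
      · right; left; linarith
      · right; right; linarith
    · left; linarith
  · intro h5
    refine le_antisymm ?_ (le_min (sub_nonneg.2 (le_min h2 h3)) (sub_nonneg.2 h4))
    rcases h5 with h5 | h5 | h5
    · exact (min_le_right _ _).trans (by linarith)
    · exact (min_le_left _ _).trans (by linarith [min_le_left 2 (2 * (2 - (shift n p).1))])
    · exact (min_le_left _ _).trans (by linarith [min_le_right 2 (2 * (2 - (shift n p).1))])

/-! ### The folding map of the next connected sum -/

/-- The map `Φ` folds the `n`-th hexagon times the circle, and it restricts to the standard map to
the ball `i` over the right tip of the hexagon. -/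
structure IsTippedFolding (n : ℕ) {X : Type} [TopologicalSpace X] (i : ℂ × ℝ → X)
    (Φ : ℝ × ℝ → Circle → X) : Prop where
  isFolding : (hexagon n).IsFolding Φ
  tip : ∀ p ∈ (hexagon n).domain, 2 * (n : ℝ) ≤ p.1 → ∀ w,
    Φ p w = i (pill (2 * n + 1 - p.1) p.2 w)

section Step

variable {n : ℕ} {X : Type} {i : ℂ × ℝ → X} {Φ : ℝ × ℝ → Circle → X}

section

variable [TopologicalSpace X]

theorem IsTippedFolding.apply_pill (h : IsTippedFolding n i Φ) {r y : ℝ} (hr : r ≤ 1)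
    (hy : |y| ≤ 2 * r) (w : Circle) :
    (2 * n + 1 - r, y) ∈ (hexagon n).domain ∧ i (pill r y w) = Φ (2 * n + 1 - r, y) w := by
  have h1 : 2 * (n : ℝ) ≤ (2 * n + 1 - r, y).1 := by simp only; linarith
  have h2 : (2 * n + 1 - r, y) ∈ (hexagon n).domain :=
    (hexRho_of_ge h1).1.2 (by simpa only [sub_sub_cancel] using hy)
  refine ⟨h2, ?_⟩
  rw [h.tip _ h2 h1]
  simp only [sub_sub_cancel]

/-- Over the tip the twist is `1`, so `Φ` and `pill` make the same identifications. -/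
theorem IsTippedFolding.injOn (h : IsTippedFolding n i Φ) :
    Set.InjOn i (Metric.closedBall 0 1) := by
  intro b hb b' hb' hbb
  obtain ⟨r, y, w, h0, h1, h2, rfl⟩ := exists_pill (mem_closedBall_zero_iff.1 hb)
  obtain ⟨r', y', w', h0', h1', h2', rfl⟩ := exists_pill (mem_closedBall_zero_iff.1 hb')
  obtain ⟨h3, h4⟩ := h.apply_pill h1 h2 w
  obtain ⟨h3', h4'⟩ := h.apply_pill h1' h2' w'
  rw [h4, h4'] at hbb
  obtain ⟨h5, h6⟩ := (h.isFolding.eq_iff _ h3 _ h3' _ _).1 hbb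
  have h7 := Prod.mk.inj h5
  have h8 : 2 * (n : ℝ) ≤ (2 * n + 1 - r, y).1 := by simp only; linarith
  refine (pill_eq_iff h2 h2').2 ⟨by linarith [h7.1], h7.2, h6.imp id fun ⟨h9, h10⟩ => ⟨?_, ?_⟩⟩
  · have := (hexRho_of_ge h8).2.1 h9
    simpa only [sub_sub_cancel] using this
  · have h11 : (hexagon n).twist (2 * n + 1 - r, y) = 1 :=
      hexTwist_of_nonneg (le_trans (by positivity) h8)
    rw [h11] at h10
    exact Circle.ext h10

theorem IsTippedFolding.eq_of_apply_eq (h : IsTippedFolding n i Φ) {p : ℝ × ℝ}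
    (hp : p ∈ (hexagon n).domain) (hn : p.1 ≤ 2 * n) {w : Circle} {b : ℂ × ℝ} (hb : ‖b‖ ≤ 1)
    (hpb : Φ p w = i b) : p.1 = 2 * n ∧ ¬ ‖b‖ < 1 := by
  obtain ⟨r, y, w', h0, h1, h2, rfl⟩ := exists_pill hb
  obtain ⟨h3, h4⟩ := h.apply_pill h1 h2 w'
  rw [h4] at hpb
  have h5 : p.1 = 2 * n + 1 - r := congrArg Prod.fst ((h.isFolding.eq_iff _ hp _ h3 _ _).1 hpb).1
  refine ⟨by linarith, fun h6 => ?_⟩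
  have := (norm_pill_lt_one_iff h2 w').1 h6
  linarith

/-- Removing the open ball amounts to cutting off the tip `x > 2 n`. -/
theorem IsTippedFolding.notMem_iff (h : IsTippedFolding n i Φ) {p : ℝ × ℝ}
    (hp : p ∈ (hexagon n).domain) (w : Circle) :
    Φ p w ∉ i '' Metric.ball 0 1 ↔ p.1 ≤ 2 * n := by
  constructor
  · intro h1
    by_contra! h2
    have h3 := (hexRho_of_ge h2.le).1.1 hp
    refine h1 ⟨pill (2 * n + 1 - p.1) p.2 w, ?_, (h.tip p hp h2.le w).symm⟩
    exact mem_ball_zero_iff.2 ((norm_pill_lt_one_iff h3 w).2 (by linarith))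
  · rintro h1 ⟨b, hb, hbp⟩
    have hb := mem_ball_zero_iff.1 hb
    exact (h.eq_of_apply_eq hp h1 hb.le hbp.symm).2 hb

end

variable (n i Φ) in
/-- The folding map of the connected sum with the product of the two-sphere and the circle. -/
def foldSucc (p : ℝ × ℝ) (w : Circle) : ConnSum i discIn :=
  if p.1 < 2 * n then glueLeft i (Φ p w) else glueRight i (pieceMap (shift n p) w)

theorem foldSucc_of_lt {p : ℝ × ℝ} (h : p.1 < 2 * n) (w : Circle) :
    foldSucc n i Φ p w = glueLeft i (Φ p w) := if_pos h

theorem foldSucc_of_ge {p : ℝ × ℝ} (h : 2 * n ≤ p.1) (w : Circle) :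
    foldSucc n i Φ p w = glueRight i (pieceMap (shift n p) w) := if_neg h.not_gt

variable [TopologicalSpace X]

/-- On the seam `x = 2 n` both sides are `pill 1 y w` on the boundary spheres, which the connected
sum identifies. -/
theorem IsTippedFolding.foldSucc_of_le (h : IsTippedFolding n i Φ) {p : ℝ × ℝ}
    (hp : p ∈ (hexagon n).domain) (hn : p.1 ≤ 2 * n) (w : Circle) :
    foldSucc n i Φ p w = glueLeft i (Φ p w) := by
  rcases hn.lt_or_eq with h1 | h1
  · exact foldSucc_of_lt h1 w
  have h2 := (h.notMem_iff hp w).2 hn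
  have h3 := (mem_piece_iff h1.ge).1 ((hexRho_succ_of_le hn).1.2 hp)
  have h4 := pieceMap_notMem h3 w
  have h5 : (shift n p).1 = -1 := by
    simp only [shift, h1]
    ring
  rw [foldSucc_of_ge h1.ge]
  rw [pieceMap_neg_one h5] at h4 ⊢
  have h6 := h.tip p hp h1.ge w
  rw [h1, add_sub_cancel_left] at h6
  rw [h6] at h2 ⊢
  exact (glueLeft_eq_glueRight (norm_pill_one h3.2.1 w) h2 h4).symm

theorem IsTippedFolding.foldSucc_eq_iff (h : IsTippedFolding n i Φ) {p p' : ℝ × ℝ}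
    (hp : p ∈ (hexagon (n + 1)).domain) (hp' : p' ∈ (hexagon (n + 1)).domain) (w w' : Circle) :
    foldSucc n i Φ p w = foldSucc n i Φ p' w' ↔
      p = p' ∧ (w = w' ∨ (hexagon (n + 1)).rho p = 0 ∧
        (w * w' : ℂ) = (hexagon (n + 1)).twist p) := by
  have mixed : ∀ p ∈ (hexagon (n + 1)).domain, ∀ p' ∈ (hexagon (n + 1)).domain, ∀ w w',
      p.1 < 2 * n → 2 * n ≤ p'.1 → foldSucc n i Φ p w ≠ foldSucc n i Φ p' w' := by
    intro p hp p' hp' w w' h1 h1' h2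
    have h3 := (hexRho_succ_of_le h1.le).1.1 hp
    rw [foldSucc_of_lt h1, foldSucc_of_ge h1'] at h2
    obtain ⟨b, hb, h4, -⟩ := exists_of_glueLeft_eq ((h.notMem_iff h3 w).2 h1.le)
      (pieceMap_notMem ((mem_piece_iff h1').1 hp') w') h2
    exact h1.ne (h.eq_of_apply_eq h3 h1.le hb.le h4).1
  rcases lt_or_ge p.1 (2 * n) with h1 | h1 <;> rcases lt_or_ge p'.1 (2 * n) with h1' | h1'
  · have h3 := (hexRho_succ_of_le h1.le).1.1 hp
    have h3' := (hexRho_succ_of_le h1'.le).1.1 hp'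
    rw [foldSucc_of_lt h1, foldSucc_of_lt h1', glueLeft_injOn.eq_iff
      ((h.notMem_iff h3 w).2 h1.le) ((h.notMem_iff h3' w').2 h1'.le), h.isFolding.eq_iff _ h3 _ h3']
    exact and_congr_right' (or_congr_right (and_congr_left' (hexRho_succ_of_le h1.le).2.symm))
  · refine iff_of_false (mixed p hp p' hp' w w' h1 h1') fun h => ?_
    rw [h.1] at h1
    linarith
  · refine iff_of_false (mixed p' hp' p hp w' w h1' h1).symm fun h => ?_
    rw [h.1] at h1
    linarith
  · have h2 := (mem_piece_iff h1).1 hp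
    have h2' := (mem_piece_iff h1').1 hp'
    have h3 : (hexagon (n + 1)).twist p = 1 := hexTwist_of_nonneg (le_trans (by positivity) h1)
    have h4 : shift n p = shift n p' ↔ p = p' := by
      rw [Prod.ext_iff, Prod.ext_iff]
      exact and_congr_left' sub_left_inj
    rw [foldSucc_of_ge h1, foldSucc_of_ge h1', (glueRight_injOn (h.injOn.mono
      Metric.sphere_subset_closedBall)).eq_iff (pieceMap_notMem h2 w) (pieceMap_notMem h2' w'),
      pieceMap_eq_iff h2 h2', h4, h3, ← hexRho_succ_of_ge h1 h2, ← Circle.coe_mul,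
      ← Circle.coe_one, Circle.coe_inj]
    rfl

theorem continuous_shift (n : ℕ) : Continuous (shift n) := by
  unfold shift
  fun_prop

theorem IsTippedFolding.continuousOn_foldSucc (h : IsTippedFolding n i Φ) :
    ContinuousOn (fun q : (ℝ × ℝ) × Circle => foldSucc n i Φ q.1 q.2)
      ((hexagon (n + 1)).domain ×ˢ Set.univ) := by
  have hc := (isCompact_domain_prod (hexagon (n + 1))).isClosed
  have h3 : ((hexagon (n + 1)).domain ×ˢ (Set.univ : Set Circle)) =
      ((hexagon (n + 1)).domain ×ˢ Set.univ ∩ {q | q.1.1 ≤ 2 * n}) ∪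
      ((hexagon (n + 1)).domain ×ˢ Set.univ ∩ {q | 2 * n ≤ q.1.1}) := by
    rw [← Set.inter_union_distrib_left]
    exact (Set.inter_eq_left.2 fun q _ => le_total q.1.1 (2 * (n : ℝ))).symm
  rw [h3]
  have h4 : ∀ q ∈ ((hexagon (n + 1)).domain ×ˢ (Set.univ : Set Circle)) ∩ {q | q.1.1 ≤ 2 * n},
      q.1 ∈ (hexagon n).domain := fun q hq => (hexRho_succ_of_le hq.2).1.1 hq.1.1
  have h5 : ∀ q ∈ ((hexagon (n + 1)).domain ×ˢ (Set.univ : Set Circle)) ∩ {q | 2 * n ≤ q.1.1},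
      shift n q.1 ∈ piece := fun q hq => (mem_piece_iff hq.2).1 hq.1.1
  have h6 : ContinuousOn (fun q : (ℝ × ℝ) × Circle => glueLeft i (Φ q.1 q.2))
      (((hexagon (n + 1)).domain ×ˢ (Set.univ : Set Circle)) ∩ {q | q.1.1 ≤ 2 * n}) :=
    ContinuousOn.comp (f := fun q : (ℝ × ℝ) × Circle => Φ q.1 q.2) continuousOn_glueLeft
      (h.isFolding.continuousOn.mono fun q hq => ⟨h4 q hq, Set.mem_univ _⟩)
      fun q hq => (h.notMem_iff (h4 q hq) q.2).2 hq.2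
  have h7 : ContinuousOn (fun q : (ℝ × ℝ) × Circle => pieceMap (shift n q.1) q.2)
      (((hexagon (n + 1)).domain ×ˢ (Set.univ : Set Circle)) ∩ {q | 2 * n ≤ q.1.1}) := by
    have := continuous_shift n
    exact continuousOn_pieceMap.comp (f := fun q : (ℝ × ℝ) × Circle => (shift n q.1, q.2))
      (Continuous.continuousOn (by fun_prop)) fun q hq => ⟨h5 q hq, Set.mem_univ _⟩
  have h8 : ContinuousOn (fun q : (ℝ × ℝ) × Circle => glueRight i (pieceMap (shift n q.1) q.2))
      (((hexagon (n + 1)).domain ×ˢ (Set.univ : Set Circle)) ∩ {q | 2 * n ≤ q.1.1}) :=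
    ContinuousOn.comp (f := fun q : (ℝ × ℝ) × Circle => pieceMap (shift n q.1) q.2)
      continuousOn_glueRight h7 fun q hq => pieceMap_notMem (h5 q hq) q.2
  refine ContinuousOn.union_of_isClosed (h6.congr ?_) (h8.congr ?_) ?_ ?_
  · exact fun q hq => h.foldSucc_of_le (h4 q hq) hq.2 q.2
  · exact fun q hq => foldSucc_of_ge hq.2 q.2
  · exact hc.inter (isClosed_le (by fun_prop) continuous_const)
  · exact hc.inter (isClosed_le continuous_const (by fun_prop))

theorem exists_shift_eq {q : ℝ × ℝ} (hq : q ∈ piece) :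
    ∃ p ∈ (hexagon (n + 1)).domain, 2 * n ≤ p.1 ∧ shift n p = q := by
  have h1 : shift n (q.1 + (2 * n + 1), q.2) = q := by
    simp only [shift, add_sub_cancel_right]
  have h2 : 2 * (n : ℝ) ≤ (q.1 + (2 * n + 1), q.2).1 := by
    simp only
    linarith [hq.1]
  exact ⟨_, (mem_piece_iff h2).2 (h1.symm ▸ hq), h2, h1⟩

theorem IsTippedFolding.foldSucc_surjective (h : IsTippedFolding n i Φ) (x : ConnSum i discIn) :
    ∃ p ∈ (hexagon (n + 1)).domain, ∃ w, foldSucc n i Φ p w = x := by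
  induction x using Quot.ind with
  | mk x =>
    rcases x with ⟨x, hx⟩ | ⟨y, hy⟩
    · obtain ⟨p, hp, w, rfl⟩ := h.isFolding.surjective x
      have hn := (h.notMem_iff hp w).1 hx
      refine ⟨p, (hexRho_succ_of_le hn).1.2 hp, w, ?_⟩
      rw [h.foldSucc_of_le hp hn, glueLeft_of_notMem hx]
    · obtain ⟨q, hq, w, rfl⟩ := exists_pieceMap hy
      obtain ⟨p, hp, hn, rfl⟩ := exists_shift_eq (n := n) hq
      refine ⟨p, hp, w, ?_⟩
      rw [foldSucc_of_ge hn, glueRight_of_notMem hy]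

/-- Closedness is tested on the two summands: on the first by the quotient property of `Φ`, on the
second by compactness of the piece. -/
theorem IsTippedFolding.isClosed_foldSucc (h : IsTippedFolding n i Φ) {C : Set (ConnSum i discIn)}
    (hC : IsClosed {q : (ℝ × ℝ) × Circle | q.1 ∈ (hexagon (n + 1)).domain ∧
      foldSucc n i Φ q.1 q.2 ∈ C}) : IsClosed C := by
  refine isClosed_connSum (h.isFolding.isClosed _ ?_) ?_
  · have e : {q : (ℝ × ℝ) × Circle | q.1 ∈ (hexagon n).domain ∧
        Φ q.1 q.2 ∈ {x | x ∉ i '' Metric.ball 0 1 ∧ glueLeft i x ∈ C}} =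
        {q : (ℝ × ℝ) × Circle | q.1 ∈ (hexagon (n + 1)).domain ∧ foldSucc n i Φ q.1 q.2 ∈ C} ∩
          {q | q.1.1 ≤ 2 * n} := by
      ext q
      constructor
      · rintro ⟨h1, h2, h3⟩
        have hn := (h.notMem_iff h1 _).1 h2
        refine ⟨⟨(hexRho_succ_of_le hn).1.2 h1, ?_⟩, hn⟩
        rwa [h.foldSucc_of_le h1 hn]
      · rintro ⟨⟨h1, h2⟩, hn⟩
        have h1 := (hexRho_succ_of_le hn).1.1 h1
        rw [h.foldSucc_of_le h1 hn] at h2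
        exact ⟨h1, (h.notMem_iff h1 _).2 hn, h2⟩
    rw [e]
    exact hC.inter (isClosed_le (by fun_prop) continuous_const)
  · refine isClosed_of_isClosed_preimage (isCompact_piece.prod isCompact_univ) continuousOn_pieceMap
      (fun y hy => ?_) ?_
    · obtain ⟨q, hq, w, rfl⟩ := exists_pieceMap hy.1
      exact ⟨(q, w), ⟨hq, Set.mem_univ _⟩, rfl⟩
    · let T : (ℝ × ℝ) × Circle → (ℝ × ℝ) × Circle := fun q => ((q.1.1 + (2 * n + 1), q.1.2), q.2)
      have hT : Continuous T := by fun_prop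
      have hs : ∀ q, shift n (T q).1 = q.1 := fun q => by
        simp only [shift, T, add_sub_cancel_right]
      have e : {q : (ℝ × ℝ) × Circle | q ∈ piece ×ˢ (Set.univ : Set Circle) ∧
          pieceMap q.1 q.2 ∈ {y | y ∉ discIn '' Metric.ball 0 1 ∧ glueRight i y ∈ C}} =
          T ⁻¹' {q : (ℝ × ℝ) × Circle | q.1 ∈ (hexagon (n + 1)).domain ∧
            foldSucc n i Φ q.1 q.2 ∈ C} ∩ piece ×ˢ Set.univ := by
        ext q
        have key : q.1 ∈ piece → 2 * (n : ℝ) ≤ (T q).1.1 := fun hq => by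
          simp only [T]
          linarith [hq.1]
        have key2 : q.1 ∈ piece →
            foldSucc n i Φ (T q).1 (T q).2 = glueRight i (pieceMap q.1 q.2) := fun hq => by
          rw [foldSucc_of_ge (key hq), hs]
        constructor
        · rintro ⟨hq, h2, h3⟩
          refine ⟨⟨(mem_piece_iff (key hq.1)).2 ((hs q).symm ▸ hq.1), ?_⟩, hq⟩
          rwa [key2 hq.1]
        · rintro ⟨⟨h1, h2⟩, hq⟩
          rw [key2 hq.1] at h2
          exact ⟨hq, pieceMap_notMem hq.1 _, h2⟩
      rw [e]
      exact (hC.preimage hT).inter (isCompact_piece.prod isCompact_univ).isClosed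

theorem IsTippedFolding.succ (h : IsTippedFolding n i Φ) :
    IsTippedFolding (n + 1)
      (fun p => (Quot.mk _ (Sum.inr ⟨discOut p, discOut_notMem p⟩) : ConnSum i discIn))
      (foldSucc n i Φ) where
  isFolding :=
    { continuousOn := h.continuousOn_foldSucc
      surjective := h.foldSucc_surjective
      isClosed := fun _ => h.isClosed_foldSucc
      eq_iff := fun _ hp _ hp' => h.foldSucc_eq_iff hp hp' }
  tip p hp hn w := by
    push_cast at hn
    have h1 : 2 * (n : ℝ) ≤ p.1 := by linarith
    have h2 : 1 ≤ (shift n p).1 := by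
      simp only [shift]
      linarith
    have h3 : 2 - (shift n p).1 = 2 * ((n + 1 : ℕ) : ℝ) + 1 - p.1 := by
      simp only [shift]
      push_cast
      ring
    have h4 := pieceMap_notMem ((mem_piece_iff h1).1 hp) w
    -- The right tip of the new hexagon is the right tip of the piece, where `pieceMap` is `discOut`
    -- after `pill`.
    rw [foldSucc_of_ge h1]
    rw [pieceMap_of_ge h2, h3] at h4 ⊢
    exact glueRight_of_notMem h4

end Step

theorem isTippedFolding_zero : IsTippedFolding 0 discS3 foldZero where
  isFolding := foldZero_isFolding
  tip p _ hn w := by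
    have h : 0 ≤ p.1 := by simpa using hn
    rw [foldZero_of_nonneg h]
    simp

theorem exists_isTippedFolding (n : ℕ) :
    ∃ Φ : ℝ × ℝ → Circle → SharpS2S1 n, IsTippedFolding n (iterSum n).disc Φ := by
  induction n with
  | zero => exact ⟨foldZero, isTippedFolding_zero⟩
  | succ n ih =>
    obtain ⟨Φ, hΦ⟩ := ih
    exact ⟨_, hΦ.succ⟩

end BranchedCircleBundles

end

theorem mainTheorem12 (n : ℕ) :
    ∃ (E B : Type) (_ : TopologicalSpace E) (_ : TopologicalSpace B) (_ : MulAction Circle E)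
      (p : E → B) (f : C(E, BranchedCircleBundles.SharpS2S1 n)),
      BranchedCircleBundles.IsClosedSurface B ∧
      BranchedCircleBundles.IsCircleBundle p ∧
      ¬ IsHomeomorphicTrivialFiberBundle Circle p ∧
      BranchedCircleBundles.IsBranchedDoubleCovering f ∧
      BranchedCircleBundles.IsPiOneSurjective f := by
  open BranchedCircleBundles in
  obtain ⟨Φ, hΦ⟩ := exists_isTippedFolding n
  have h := hΦ.isFolding
  exact ⟨(hexagon n).Total, (hexagon n).Double, inferInstance, inferInstance, inferInstance,
    TwistedDomain.proj, ⟨TwistedDomain.fold Φ, h.continuous_fold⟩, TwistedDomain.isClosedSurface,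
    TwistedDomain.isCircleBundle,
    fun ht => not_exists_extension n (TwistedDomain.exists_extension_of_trivial ht),
    h.isBranchedDoubleCovering, h.isPiOneSurjective⟩
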